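/- Let $q,m\ge 1$, let $U^{(1)},\dots,U^{(m)}$ be linearly independent real skew-symmetric $q\times q$ matrices, write $\langle\mathbb U x,y\rangle=(\langle U^{(1)}x,y\rangle,\dots,\langle U^{(m)}x,y\rangle)$, and let $\mathbb G=\mathbb R^q\times\mathbb R^m$ with group law $(x,t)\cdot(x',t')=(x+x',\,t+t'+\tfrac12\langle\mathbb U x,x'\rangle)$ and identity $o=(0,0)$. Let $d(g)$ be the Carnot–Carathéodory distance from $o$ to $g$ associated with the vector fields $\mathrm X_l=\partial_{x_l}+\tfrac12\sum_{j}(U^{(j)}x)_l\,\partial_{t_j}$ ($1\le l\le q$), i.e. the infimum of the lengths $\int_0^1|u(s)|\,ds$ of the absolutely continuous curves on $[0,1]$ from $o$ to $g$ with derivative $\sum_l u_l\mathrm X_l$ a.e., and let $\ell$ denote length. For $\theta\in\mathbb R^m$ put $\widetilde U(\theta)=\sum_j\theta_jU^{(j)}$ and $U(\theta)=i\,\widetilde U(\theta)$ (a Hermitian matrix); functions of $U(\theta)$ are taken by functional calculus, with $\lambda\cot\lambda$, $\lambda/\sin\lambda$ and $\sin(s\lambda)/\sin\lambda$ equal to $1$,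 $1$ and $s$ at $\lambda=0$. Let $$\mathcal V=\{\theta\in\mathbb R^m:\ \det(k\pi\,\mathbb I_q-U(\theta))\ne0\ \text{ for all } k=1,2,\dots\},$$ $$\phi(g;\theta)=\langle U(\theta)\cot U(\theta)\,x,x\rangle+4\,t\cdot\theta\qquad(g=(x,t)\in\mathbb G,\ \theta\in\mathcal V).$$ The normal geodesic $\gamma(\zeta_0,2\theta_0;\cdot)=(x(\cdot),t(\cdot))$ on $[0,1]$ starting at $o$ with initial covector $(\zeta_0,2\theta_0)\in\mathbb R^q\times\mathbb R^m$ is given by $\zeta(s)=e^{2s\widetilde U(\theta_0)}\zeta_0$, $x(s)=\int_0^s\zeta(r)\,dr$, $t(s)=\tfrac12\int_0^s\langle\mathbb Ux(r),\zeta(r)\rangle\,dr$. It is called good if $\theta_0\in\mathcal V$ and bad otherwise. Let $\mathcal W$ be the set of the endpoints $\gamma(\zeta_0,2\theta_0;1)$ of all bad normal geodesics ($\zeta_0\in\mathbb R^q$, $\theta_0\notin\mathcal V$). Let $x_0\in\mathbb R^q\setminus\{0\}$ and $\theta_0\in\mathcal V$, and define $\gamma=(x,t)$ on $[0,1]$ by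 $$x(s)=\frac{\sin(sU(\theta_0))}{\sin U(\theta_0)}e^{(s-1)\widetilde U(\theta_0)}x_0,\quad \zeta(s)=\frac{U(\theta_0)}{\sin U(\theta_0)}e^{(2s-1)\widetilde U(\theta_0)}x_0,\quad t(s)=\tfrac12\int_0^s\langle\mathbb Ux(r),\zeta(r)\rangle\,dr .$$ 1. The vectors $x(s),\zeta(s)$ are real, $\zeta(0)\neq0$, and $\gamma$ is the good normal geodesic $\gamma(\zeta(0),2\theta_0;\cdot)$; it is horizontal with horizontal velocity $\zeta$. 2. If $\theta_0$ is a critical point of $\phi(g_0;\cdot)$ for some $g_0=(x_0,t_0)$, then $\gamma$ joins $o$ to $g_0$, and $$d(g_0)^2\le\ell(\gamma)^2=\Big|\frac{U(\theta_0)}{\sin U(\theta_0)}x_0\Big|^2=\phi(g_0;\theta_0).$$ 3. Conversely, $\theta_0$ is a critical point of $\phi((x_0,t(1));\cdot)$. Moreover, every good normal geodesic $\gamma(\zeta_0,2\theta_0;\cdot)$ with $\zeta_0\neq0$, $\theta_0\in\mathcal V$, arises in this way: its endpoint $g_0=(x_0,t_0)$ satisfies $x_0\neq0$, $\theta_0$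 is a critical point of $\phi(g_0;\cdot)$, and the geodesic and its velocity are given by the above formulas for $x_0$ and $\theta_0$. 4. Consequently, for every $g=(x,t)\in\mathbb G\setminus\mathcal W$, $$d(g)^2=\inf\Big\{\phi(g;\theta)=\Big|\frac{U(\theta)}{\sin U(\theta)}x\Big|^2:\ \theta\in\mathcal V\text{ is a critical point of }\phi(g;\cdot)\Big\}.$$ -/

import Mathlib

open scoped Matrix
open MeasureTheory

/-- The step-two group `ℝ^q × ℝ^m` (horizontal coordinate `x`, central coordinate `t`), with identity
`o = 0`. The matrices `U j` below are the `m` skew-symmetric matrices that define its group law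
`(x, t) · (x', t') = (x + x', t + t' + ½ ⟨𝕌 x, x'⟩)`. -/
abbrev StepTwo (q m : ℕ) : Type := EuclideanSpace ℝ (Fin q) × EuclideanSpace ℝ (Fin m)

/-- A real matrix acting on a Euclidean vector. -/
noncomputable def matAct {q : ℕ} (A : Matrix (Fin q) (Fin q) ℝ) (x : EuclideanSpace ℝ (Fin q)) :
    EuclideanSpace ℝ (Fin q) :=
  WithLp.toLp 2 (A *ᵥ x.ofLp)

/-- `⟨𝕌 x, y⟩ = (⟨U⁽¹⁾ x, y⟩, …, ⟨U⁽ᵐ⁾ x, y⟩) ∈ ℝ^m`. -/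
noncomputable def pairing {q m : ℕ} (U : Fin m → Matrix (Fin q) (Fin q) ℝ)
    (x y : EuclideanSpace ℝ (Fin q)) : EuclideanSpace ℝ (Fin m) :=
  WithLp.toLp 2 fun j => inner ℝ (matAct (U j) x) y

/-- The real skew-symmetric matrix `Ũ(θ) = ∑ⱼ θⱼ U⁽ʲ⁾`. -/
noncomputable def tildeU {q m : ℕ} (U : Fin m → Matrix (Fin q) (Fin q) ℝ)
    (θ : EuclideanSpace ℝ (Fin m)) : Matrix (Fin q) (Fin q) ℝ :=
  ∑ j, θ j • U j

/-- The Hermitian matrix `U(θ) = i ∑ⱼ θⱼ U⁽ʲ⁾`. -/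
noncomputable def hermU {q m : ℕ} (U : Fin m → Matrix (Fin q) (Fin q) ℝ)
    (θ : EuclideanSpace ℝ (Fin m)) : Matrix (Fin q) (Fin q) ℂ :=
  Complex.I • (tildeU U θ).map Complex.ofReal

/-- The open set `𝒱` of those `θ` such that no `kπ`, `k = 1, 2, …`, is an eigenvalue of `U(θ)`. -/
def goodSet {q m : ℕ} (U : Fin m → Matrix (Fin q) (Fin q) ℝ) : Set (EuclideanSpace ℝ (Fin m)) :=
  {θ | ∀ k : ℕ, 0 < k →
    (((k : ℂ) * (Real.pi : ℂ)) • (1 : Matrix (Fin q) (Fin q) ℂ) - hermU U θ).det ≠ 0}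

/-- A real vector seen in `ℂ^q`. -/
def toComplexVec {q : ℕ} (x : EuclideanSpace ℝ (Fin q)) : Fin q → ℂ := fun l => (x l : ℂ)

/-- The real part, in `ℝ^q`, of a vector of `ℂ^q`. -/
noncomputable def reVec {q : ℕ} (z : Fin q → ℂ) : EuclideanSpace ℝ (Fin q) :=
  WithLp.toLp 2 fun l => (z l).re

/-- `U(θ) cot U(θ)`, by functional calculus with `λ ↦ λ cot λ = cos λ / (sin λ / λ)`, which is `1`
at `λ = 0`. -/
noncomputable def UcotU {q m : ℕ} (U : Fin m → Matrix (Fin q) (Fin q) ℝ)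
    (θ : EuclideanSpace ℝ (Fin m)) : Matrix (Fin q) (Fin q) ℂ :=
  cfc (fun y : ℝ => Real.cos y / Real.sinc y) (hermU U θ)

/-- `U(θ) / sin U(θ)`, by functional calculus with `λ ↦ λ / sin λ`, which is `1` at `λ = 0`. -/
noncomputable def UdivSinU {q m : ℕ} (U : Fin m → Matrix (Fin q) (Fin q) ℝ)
    (θ : EuclideanSpace ℝ (Fin m)) : Matrix (Fin q) (Fin q) ℂ :=
  cfc (fun y : ℝ => (Real.sinc y)⁻¹) (hermU U θ)

/-- `sin (s U(θ)) / sin U(θ)`, by functional calculus with `λ ↦ sin (s λ) / sin λ`, which is `s` at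
`λ = 0`; indeed `s sinc (s λ) / sinc λ = sin (s λ) / sin λ` for `λ ≠ 0`. -/
noncomputable def sinDivSinU {q m : ℕ} (U : Fin m → Matrix (Fin q) (Fin q) ℝ)
    (θ : EuclideanSpace ℝ (Fin m)) (s : ℝ) : Matrix (Fin q) (Fin q) ℂ :=
  cfc (fun y : ℝ => s * Real.sinc (s * y) / Real.sinc y) (hermU U θ)

/-- The reference function `φ(g; τ) = ⟨U(τ) cot U(τ) x, x⟩ + 4 t · τ` for `g = (x, t)`. The first
summand is a Hermitian form, hence real; `.re` only changes its type. -/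
noncomputable def refFun {q m : ℕ} (U : Fin m → Matrix (Fin q) (Fin q) ℝ) (g : StepTwo q m)
    (τ : EuclideanSpace ℝ (Fin m)) : ℝ :=
  (star (toComplexVec g.1) ⬝ᵥ (UcotU U τ *ᵥ toComplexVec g.1)).re + 4 * inner ℝ g.2 τ

/-- `θ` is a critical point of `φ(g; ·)`. -/
def IsCriticalPt {q m : ℕ} (U : Fin m → Matrix (Fin q) (Fin q) ℝ) (g : StepTwo q m)
    (θ : EuclideanSpace ℝ (Fin m)) : Prop :=
  HasGradientAt (refFun U g) 0 θ

/-- The Euclidean (Hermitian) norm `|U(θ)/sin U(θ) x|` in `ℂ^q`. -/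
noncomputable def normUdivSinU {q m : ℕ} (U : Fin m → Matrix (Fin q) (Fin q) ℝ)
    (θ : EuclideanSpace ℝ (Fin m)) (x : EuclideanSpace ℝ (Fin q)) : ℝ :=
  ‖(WithLp.toLp 2 (UdivSinU U θ *ᵥ toComplexVec x) : EuclideanSpace ℂ (Fin q))‖

/-- `γ` restricted to `[0, 1]` is an absolutely continuous curve with
`γ' = ∑ₗ uₗ Xₗ(γ)` almost everywhere, where `Xₗ = ∂_{xₗ} + ½ ∑ⱼ (U⁽ʲ⁾ x)ₗ ∂_{tⱼ}` and
`u ∈ L¹([0, 1])`. -/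
structure IsHorizontal {q m : ℕ} (U : Fin m → Matrix (Fin q) (Fin q) ℝ)
    (γ : ℝ → StepTwo q m) (u : ℝ → EuclideanSpace ℝ (Fin q)) : Prop where
  integrable : IntervalIntegrable u volume 0 1
  eq_fst : ∀ s ∈ Set.Icc (0 : ℝ) 1, (γ s).1 = (γ 0).1 + ∫ r in (0 : ℝ)..s, u r
  eq_snd : ∀ s ∈ Set.Icc (0 : ℝ) 1,
    (γ s).2 = (γ 0).2 + (1 / 2 : ℝ) • ∫ r in (0 : ℝ)..s, pairing U (γ r).1 (u r)

/-- The sub-Riemannian length of a horizontal curve on `[0, 1]` with horizontal velocity `u`. -/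
noncomputable def horLength {q : ℕ} (u : ℝ → EuclideanSpace ℝ (Fin q)) : ℝ :=
  ∫ s in (0 : ℝ)..1, ‖u s‖

/-- The Carnot–Carathéodory distance: the infimum of the lengths of the horizontal curves from `g`
to `h` (there is always one when the `U j` are linearly independent). -/
noncomputable def ccDist {q m : ℕ} (U : Fin m → Matrix (Fin q) (Fin q) ℝ) (g h : StepTwo q m) : ℝ :=
  sInf {L : ℝ | ∃ (γ : ℝ → StepTwo q m) (u : ℝ → EuclideanSpace ℝ (Fin q)),
    IsHorizontal U γ u ∧ γ 0 = g ∧ γ 1 = h ∧ L = horLength u}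

/-- `ζ(s) = exp(2 s Ũ(θ₀)) ζ₀`, the velocity of a normal geodesic. -/
noncomputable def normalVel {q m : ℕ} (U : Fin m → Matrix (Fin q) (Fin q) ℝ)
    (ζ₀ : EuclideanSpace ℝ (Fin q)) (θ₀ : EuclideanSpace ℝ (Fin m)) (s : ℝ) :
    EuclideanSpace ℝ (Fin q) :=
  matAct (NormedSpace.exp ((2 * s) • tildeU U θ₀)) ζ₀

/-- The normal geodesic `γ(ζ₀, 2θ₀; s) = (x(s), t(s))` starting at `o`, with initial covector
`(ζ₀, 2θ₀)`. -/
noncomputable def normalGeod {q m : ℕ} (U : Fin m → Matrix (Fin q) (Fin q) ℝ)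
    (ζ₀ : EuclideanSpace ℝ (Fin q)) (θ₀ : EuclideanSpace ℝ (Fin m)) (s : ℝ) : StepTwo q m :=
  (∫ r in (0 : ℝ)..s, normalVel U ζ₀ θ₀ r,
    (1 / 2 : ℝ) • ∫ r in (0 : ℝ)..s,
      pairing U (∫ w in (0 : ℝ)..r, normalVel U ζ₀ θ₀ w) (normalVel U ζ₀ θ₀ r))

/-- The set `𝒲` of endpoints of the bad normal geodesics, those with `θ₀ ∉ 𝒱`. -/
def badEndpoints {q m : ℕ} (U : Fin m → Matrix (Fin q) (Fin q) ℝ) : Set (StepTwo q m) :=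
  {g | ∃ (ζ₀ : EuclideanSpace ℝ (Fin q)) (θ₀ : EuclideanSpace ℝ (Fin m)),
    θ₀ ∉ goodSet U ∧ g = normalGeod U ζ₀ θ₀ 1}

/-- The vector `(sin (s U(θ₀)) / sin U(θ₀)) exp((s - 1) Ũ(θ₀)) x₀`, a priori in `ℂ^q`. -/
noncomputable def explicitPosC {q m : ℕ} (U : Fin m → Matrix (Fin q) (Fin q) ℝ)
    (x₀ : EuclideanSpace ℝ (Fin q)) (θ₀ : EuclideanSpace ℝ (Fin m)) (s : ℝ) : Fin q → ℂ :=
  sinDivSinU U θ₀ s *ᵥ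
    toComplexVec (matAct (NormedSpace.exp ((s - 1) • tildeU U θ₀)) x₀)

/-- The vector `(U(θ₀) / sin U(θ₀)) exp((2 s - 1) Ũ(θ₀)) x₀`, a priori in `ℂ^q`. -/
noncomputable def explicitVelC {q m : ℕ} (U : Fin m → Matrix (Fin q) (Fin q) ℝ)
    (x₀ : EuclideanSpace ℝ (Fin q)) (θ₀ : EuclideanSpace ℝ (Fin m)) (s : ℝ) : Fin q → ℂ :=
  UdivSinU U θ₀ *ᵥ
    toComplexVec (matAct (NormedSpace.exp ((2 * s - 1) • tildeU U θ₀)) x₀)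

/-- The horizontal velocity `ζ(s) ∈ ℝ^q` of the explicit geodesic built from `x₀` and `θ₀`. -/
noncomputable def explicitVel {q m : ℕ} (U : Fin m → Matrix (Fin q) (Fin q) ℝ)
    (x₀ : EuclideanSpace ℝ (Fin q)) (θ₀ : EuclideanSpace ℝ (Fin m)) (s : ℝ) :
    EuclideanSpace ℝ (Fin q) :=
  reVec (explicitVelC U x₀ θ₀ s)

/-- The horizontal position `x(s) ∈ ℝ^q` of the explicit geodesic built from `x₀` and `θ₀`. -/
noncomputable def explicitPos {q m : ℕ} (U : Fin m → Matrix (Fin q) (Fin q) ℝ)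
    (x₀ : EuclideanSpace ℝ (Fin q)) (θ₀ : EuclideanSpace ℝ (Fin m)) (s : ℝ) :
    EuclideanSpace ℝ (Fin q) :=
  reVec (explicitPosC U x₀ θ₀ s)

/-- The explicit geodesic `γ(s) = (x(s), t(s))` built from `x₀` and `θ₀`, where
`t(s) = ½ ∫₀ˢ ⟨𝕌 x(r), ζ(r)⟩ dr`. -/
noncomputable def explicitGeod {q m : ℕ} (U : Fin m → Matrix (Fin q) (Fin q) ℝ)
    (x₀ : EuclideanSpace ℝ (Fin q)) (θ₀ : EuclideanSpace ℝ (Fin m)) (s : ℝ) : StepTwo q m :=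
  (explicitPos U x₀ θ₀ s,
    (1 / 2 : ℝ) • ∫ r in (0 : ℝ)..s, pairing U (explicitPos U x₀ θ₀ r) (explicitVel U x₀ θ₀ r))

/-! For fixed `θ` the horizontal endpoint of a normal geodesic is a linear function `posMap` of its
initial velocity. For `θ ∈ 𝒱` this map is invertible with inverse `x ↦ explicitVel U x θ 0`, because
the explicit velocity solves the geodesic equation and its primitive from 0 is the explicit
position, which equals `x` at time 1 (`posMap_explicitVel`). So for given `x` and good `θ` there is
exactly one normal geodesic above `x`, and only its central endpoint is left to match.

Criticality does exactly this matching. The quadratic form in `φ` is `⟨x, ζ⟩` with `ζ` the initial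
velocity (`UcotU_form`), and the gradient of `φ(g; ·)` at `θ` is four times the difference between
`t` and the central endpoint of the geodesic (`hasGradientAt_refFun`). Hence critical points in `𝒱`
are the covectors of good geodesics ending at `g` (`isCriticalPt_iff`), and `4 t · θ = ‖ζ‖² - ⟨ζ,
x⟩` turns the critical value into the squared length (`refFun_of_isCriticalPt`).

For the distance formula it remains to see that normal geodesics suffice: every horizontal curve
shorter than `L` can be replaced by a normal geodesic with the same endpoints and length at most `L`
(`exists_normalGeod_of_isHorizontal`). If the endpoint is outside `𝒲`, that geodesic is good and so
gives a critical point.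

The replacement is obtained from polygons. One minimizes the discrete energy plus a penalty for
missing the central coordinate. The Euler equation is the implicit midpoint rule for the geodesic
equation, with multiplier `p • (t - area)`. The point special to step two is that the second
variation bounds this multiplier uniformly in the mesh (`exists_multiplier_bound`): `m + 1` small
triangles leave one variation on which the first-order change of the `m` central coordinates
vanishes, while their areas add up without cancelling. Compactness then gives limiting velocities
and multipliers, and the stability of the midpoint rule identifies the limit as a normal geodesic.
-/

/-! ### The skew operators `Ũ(θ)` and the central pairing. -/

section Basics

variable {q m : ℕ} (U : Fin m → Matrix (Fin q) (Fin q) ℝ)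

/-- The operator `Ũ(θ)` on Euclidean space, as a function of `θ`. -/
noncomputable def opU : EuclideanSpace ℝ (Fin m) →L[ℝ]
    (EuclideanSpace ℝ (Fin q) →L[ℝ] EuclideanSpace ℝ (Fin q)) :=
  LinearMap.toContinuousLinearMap
    { toFun := fun θ => Matrix.toEuclideanCLM (n := Fin q) (𝕜 := ℝ) (tildeU U θ)
      map_add' := fun a b => by
        rw [← map_add]; congr 1
        simp [tildeU, add_smul, Finset.sum_add_distrib]
      map_smul' := fun c a => by
        rw [RingHom.id_apply, ← map_smul]; congr 1
        simp [tildeU, mul_smul, Finset.smul_sum] }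

theorem opU_eq (θ : EuclideanSpace ℝ (Fin m)) :
    opU U θ = Matrix.toEuclideanCLM (n := Fin q) (𝕜 := ℝ) (tildeU U θ) := rfl

theorem matAct_eq (A : Matrix (Fin q) (Fin q) ℝ) (x : EuclideanSpace ℝ (Fin q)) :
    matAct A x = Matrix.toEuclideanCLM (n := Fin q) (𝕜 := ℝ) A x := rfl

section
open scoped Matrix.Norms.L2Operator
theorem toEuclideanCLM_exp (A : Matrix (Fin q) (Fin q) ℝ) :
    Matrix.toEuclideanCLM (n := Fin q) (𝕜 := ℝ) (NormedSpace.exp A) =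
      NormedSpace.exp (Matrix.toEuclideanCLM (n := Fin q) (𝕜 := ℝ) A) := by
  let _ : NormedAlgebra ℚ (Matrix (Fin q) (Fin q) ℝ) := NormedAlgebra.restrictScalars ℚ ℝ _
  refine NormedSpace.map_exp (Matrix.toEuclideanCLM (n := Fin q) (𝕜 := ℝ)) ?_ A
  exact LinearMap.continuous_of_finiteDimensional
    ((Matrix.toEuclideanCLM (n := Fin q) (𝕜 := ℝ)).toAlgEquiv.toLinearMap)
end

theorem matAct_exp (c : ℝ) (θ : EuclideanSpace ℝ (Fin m)) (x : EuclideanSpace ℝ (Fin q)) :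
    matAct (NormedSpace.exp (c • tildeU U θ)) x = NormedSpace.exp (c • opU U θ) x := by
  rw [matAct_eq, toEuclideanCLM_exp, map_smul, opU_eq]

/-- `pairing` as a continuous bilinear map. -/
noncomputable def pairingL : EuclideanSpace ℝ (Fin q) →L[ℝ]
    (EuclideanSpace ℝ (Fin q) →L[ℝ] EuclideanSpace ℝ (Fin m)) :=
  LinearMap.toContinuousLinearMap
    (LinearMap.toContinuousLinearMap.toLinearMap ∘ₗ
      LinearMap.mk₂ ℝ (pairing U)
        (fun a b c => by
          ext j; simp [pairing, matAct_eq, inner_add_left])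
        (fun r a b => by
          ext j; simp [pairing, matAct_eq, inner_smul_left])
        (fun a b c => by
          ext j; simp [pairing, matAct_eq, inner_add_right])
        (fun r a b => by
          ext j; simp [pairing, matAct_eq, inner_smul_right]))

theorem pairingL_apply (x y : EuclideanSpace ℝ (Fin q)) : pairingL U x y = pairing U x y := rfl

/-- This duality turns statements about the central coordinate into statements about the operator
`Ũ(θ)`. -/
theorem inner_pairing (x y : EuclideanSpace ℝ (Fin q)) (θ : EuclideanSpace ℝ (Fin m)) :
    inner ℝ (pairingL U x y) θ = inner ℝ (opU U θ x) y := by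
  have h : opU U θ x = ∑ j, θ j • matAct (U j) x := by
    simp [opU_eq, tildeU, matAct_eq, map_sum]
  rw [h, sum_inner, pairingL_apply, PiLp.inner_apply]
  refine Finset.sum_congr rfl fun j _ => ?_
  simp [pairing, inner_smul_left]

variable {U} (hskew : ∀ j, (U j)ᵀ = -U j)
include hskew

theorem matAct_skew (j : Fin m) (x y : EuclideanSpace ℝ (Fin q)) :
    inner ℝ (matAct (U j) x) y = - inner ℝ (matAct (U j) y) x := by
  rw [real_inner_comm, matAct_eq, Matrix.inner_toEuclideanCLM, real_inner_comm, matAct_eq,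
    Matrix.inner_toEuclideanCLM, Matrix.dotProduct_mulVec, ← Matrix.mulVec_transpose, hskew,
    Matrix.neg_mulVec, neg_dotProduct, dotProduct_comm]

theorem pairing_skew (x y : EuclideanSpace ℝ (Fin q)) : pairingL U x y = - pairingL U y x := by
  ext j
  simp only [pairingL_apply, pairing, PiLp.neg_apply]
  exact matAct_skew hskew j x y

theorem pairing_self (x : EuclideanSpace ℝ (Fin q)) : pairingL U x x = 0 :=
  by
  have h := pairing_skew hskew x x
  rwa [eq_neg_iff_add_eq_zero, ← two_smul ℝ, smul_eq_zero_iff_right two_ne_zero] at h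

theorem opU_skew (θ : EuclideanSpace ℝ (Fin m)) (x y : EuclideanSpace ℝ (Fin q)) :
    inner ℝ (opU U θ x) y = - inner ℝ x (opU U θ y) := by
  rw [← inner_pairing, pairing_skew hskew, inner_neg_left, inner_pairing, real_inner_comm]

theorem opU_inner_self (θ : EuclideanSpace ℝ (Fin m)) (x : EuclideanSpace ℝ (Fin q)) :
    inner ℝ (opU U θ x) x = 0 := by
  rw [← inner_pairing, pairing_self hskew, inner_zero_left]

end Basics

/-! ### Normal geodesics: constant speed and first integrals. -/

section NormalGeodesics

variable {q m : ℕ} (U : Fin m → Matrix (Fin q) (Fin q) ℝ)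

theorem hasDerivAt_exp_smul_apply {E : Type*} [NormedAddCommGroup E] [NormedSpace ℝ E]
    [CompleteSpace E] (A : E →L[ℝ] E) (v : E) (s : ℝ) :
    HasDerivAt (fun r : ℝ => NormedSpace.exp (r • A) v) (A (NormedSpace.exp (s • A) v)) s := by
  have h := hasDerivAt_exp_smul_const' (𝕂 := ℝ) A s
  have := ((ContinuousLinearMap.apply ℝ E v).hasFDerivAt.comp_hasDerivAt s h)
  simpa [Function.comp_def] using this

theorem norm_exp_smul_apply {E : Type*} [NormedAddCommGroup E] [InnerProductSpace ℝ E]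
    [CompleteSpace E] (A : E →L[ℝ] E) (hA : ∀ x, inner ℝ (A x) x = 0) (v : E) (s : ℝ) :
    ‖NormedSpace.exp (s • A) v‖ = ‖v‖ := by
  have hd : ∀ r : ℝ, HasDerivAt (fun r : ℝ => ‖NormedSpace.exp (r • A) v‖ ^ 2) 0 r := fun r => by
    have := (hasDerivAt_exp_smul_apply A v r).norm_sq
    rwa [real_inner_comm, hA, mul_zero] at this
  have h := is_const_of_deriv_eq_zero (fun r => (hd r).differentiableAt) (fun r => (hd r).deriv) s 0
  simp only [zero_smul, NormedSpace.exp_zero, one_apply_eq_self] at h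
  exact (pow_left_inj₀ (norm_nonneg _) (norm_nonneg _) two_ne_zero).mp h

theorem normalVel_eq (ζ : EuclideanSpace ℝ (Fin q)) (θ : EuclideanSpace ℝ (Fin m)) (s : ℝ) :
    normalVel U ζ θ s = NormedSpace.exp ((2 * s) • opU U θ) ζ :=
  matAct_exp U _ _ _

theorem normalVel_zero (ζ : EuclideanSpace ℝ (Fin q)) (θ : EuclideanSpace ℝ (Fin m)) :
    normalVel U ζ θ 0 = ζ := by
  have h : (2 * (0 : ℝ)) • opU U θ = 0 := by rw [mul_zero]; exact zero_smul ℝ (opU U θ)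
  rw [normalVel_eq, h, NormedSpace.exp_zero, one_apply_eq_self]

theorem hasDerivAt_normalVel (ζ : EuclideanSpace ℝ (Fin q)) (θ : EuclideanSpace ℝ (Fin m)) (s : ℝ) :
    HasDerivAt (normalVel U ζ θ) ((2 : ℝ) • opU U θ (normalVel U ζ θ s)) s := by
  have h := hasDerivAt_exp_smul_apply ((2 : ℝ) • opU U θ) ζ s
  have e : ∀ r : ℝ, normalVel U ζ θ r = NormedSpace.exp (r • (2 : ℝ) • opU U θ) ζ := fun r => by
    rw [normalVel_eq, smul_smul, mul_comm]
  rw [show normalVel U ζ θ = _ from funext e]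
  simpa using h

theorem continuous_normalVel (ζ : EuclideanSpace ℝ (Fin q)) (θ : EuclideanSpace ℝ (Fin m)) :
    Continuous (normalVel U ζ θ) :=
  continuous_iff_continuousAt.mpr fun s => (hasDerivAt_normalVel U ζ θ s).continuousAt

/-- The horizontal position of the normal geodesic. -/
noncomputable def normalPos (ζ : EuclideanSpace ℝ (Fin q)) (θ : EuclideanSpace ℝ (Fin m)) (s : ℝ) :
    EuclideanSpace ℝ (Fin q) := ∫ r in (0 : ℝ)..s, normalVel U ζ θ r

theorem normalGeod_fst (ζ : EuclideanSpace ℝ (Fin q)) (θ : EuclideanSpace ℝ (Fin m)) (s : ℝ) :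
    (normalGeod U ζ θ s).1 = normalPos U ζ θ s := rfl

theorem normalGeod_snd (ζ : EuclideanSpace ℝ (Fin q)) (θ : EuclideanSpace ℝ (Fin m)) (s : ℝ) :
    (normalGeod U ζ θ s).2 = (1 / 2 : ℝ) • ∫ r in (0 : ℝ)..s,
      pairingL U (normalPos U ζ θ r) (normalVel U ζ θ r) := rfl

theorem normalPos_zero (ζ : EuclideanSpace ℝ (Fin q)) (θ : EuclideanSpace ℝ (Fin m)) :
    normalPos U ζ θ 0 = 0 := by simp [normalPos]

theorem hasDerivAt_normalPos (ζ : EuclideanSpace ℝ (Fin q)) (θ : EuclideanSpace ℝ (Fin m)) (s : ℝ) :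
    HasDerivAt (normalPos U ζ θ) (normalVel U ζ θ s) s :=
  ((continuous_normalVel U ζ θ).integral_hasStrictDerivAt 0 s).hasDerivAt

theorem continuous_normalPos (ζ : EuclideanSpace ℝ (Fin q)) (θ : EuclideanSpace ℝ (Fin m)) :
    Continuous (normalPos U ζ θ) :=
  continuous_iff_continuousAt.mpr fun s => (hasDerivAt_normalPos U ζ θ s).continuousAt

/-- A first integral of the geodesic equation: both sides have the same derivative and agree at 0.
It allows `Ũ x(s)` to be replaced by half the change of velocity. -/
theorem normalVel_eq_add (ζ : EuclideanSpace ℝ (Fin q)) (θ : EuclideanSpace ℝ (Fin m)) (s : ℝ) :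
    normalVel U ζ θ s = ζ + (2 : ℝ) • opU U θ (normalPos U ζ θ s) := by
  have hd : ∀ r, HasDerivAt
      (fun r => normalVel U ζ θ r - (2 : ℝ) • opU U θ (normalPos U ζ θ r)) 0 r := fun r => by
    have h1 := ((opU U θ).hasFDerivAt.comp_hasDerivAt r
      (hasDerivAt_normalPos U ζ θ r)).const_smul (2 : ℝ)
    exact ((hasDerivAt_normalVel U ζ θ r).fun_sub h1).congr_deriv (sub_self _)
  have h := is_const_of_deriv_eq_zero (fun r => (hd r).differentiableAt) (fun r => (hd r).deriv) s 0
  simp only [normalVel_zero, normalPos_zero, map_zero, smul_zero, sub_zero] at h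
  exact sub_eq_iff_eq_add.mp h

theorem continuous_pairing_normal (ζ : EuclideanSpace ℝ (Fin q)) (θ : EuclideanSpace ℝ (Fin m)) :
    Continuous fun r => pairingL U (normalPos U ζ θ r) (normalVel U ζ θ r) :=
  ((pairingL U).continuous.comp (continuous_normalPos U ζ θ)).clm_apply (continuous_normalVel U ζ θ)

theorem isHorizontal_normalGeod (ζ : EuclideanSpace ℝ (Fin q)) (θ : EuclideanSpace ℝ (Fin m)) :
    IsHorizontal U (normalGeod U ζ θ) (normalVel U ζ θ) where
  integrable := (continuous_normalVel U ζ θ).intervalIntegrable _ _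
  eq_fst s _ := by simp [normalGeod]
  eq_snd s _ := by simp [normalGeod]

variable {U} (hskew : ∀ j, (U j)ᵀ = -U j)
include hskew

theorem norm_normalVel (ζ : EuclideanSpace ℝ (Fin q)) (θ : EuclideanSpace ℝ (Fin m)) (s : ℝ) :
    ‖normalVel U ζ θ s‖ = ‖ζ‖ := by
  rw [normalVel_eq]
  exact norm_exp_smul_apply _ (opU_inner_self hskew θ) _ _

theorem horLength_normalVel (ζ : EuclideanSpace ℝ (Fin q)) (θ : EuclideanSpace ℝ (Fin m)) :
    horLength (normalVel U ζ θ) = ‖ζ‖ := by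
  simp [horLength, norm_normalVel hskew]

/-- By the first integral, the integrand `⟨Ũ x, ζ(r)⟩` is `½ (‖ζ‖² - ⟨ζ, ζ(r)⟩)`, since the speed is
constant. This identity makes critical values equal to squared lengths. -/
theorem inner_normalGeod_snd (ζ : EuclideanSpace ℝ (Fin q)) (θ : EuclideanSpace ℝ (Fin m)) :
    4 * inner ℝ (normalGeod U ζ θ 1).2 θ = ‖ζ‖ ^ 2 - inner ℝ ζ (normalPos U ζ θ 1) := by
  have hi : IntervalIntegrable (fun r => pairingL U (normalPos U ζ θ r) (normalVel U ζ θ r))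
      volume 0 1 := (continuous_pairing_normal U ζ θ).intervalIntegrable _ _
  have h1 : inner ℝ (∫ r in (0 : ℝ)..1, pairingL U (normalPos U ζ θ r) (normalVel U ζ θ r)) θ =
      ∫ r in (0 : ℝ)..1, inner ℝ θ (pairingL U (normalPos U ζ θ r) (normalVel U ζ θ r)) := by
    rw [real_inner_comm]
    exact ((innerSL ℝ θ).intervalIntegral_comp_comm hi).symm
  have h2 : ∀ r, inner ℝ θ (pairingL U (normalPos U ζ θ r) (normalVel U ζ θ r)) =
      (1 / 2) * (‖ζ‖ ^ 2 - inner ℝ ζ (normalVel U ζ θ r)) := fun r => by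
    rw [real_inner_comm, inner_pairing]
    have : opU U θ (normalPos U ζ θ r) = (1 / 2 : ℝ) • (normalVel U ζ θ r - ζ) := by
      rw [normalVel_eq_add]; simp [smul_smul]
    rw [this, inner_smul_left, inner_sub_left, real_inner_self_eq_norm_sq, norm_normalVel hskew]
    simp
  have h3 : ∫ r in (0 : ℝ)..1, inner ℝ ζ (normalVel U ζ θ r) = inner ℝ ζ (normalPos U ζ θ 1) :=
    (innerSL ℝ ζ).intervalIntegral_comp_comm ((continuous_normalVel U ζ θ).intervalIntegrable 0 1)
  rw [normalGeod_snd, inner_smul_left, h1]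
  simp_rw [h2]
  rw [intervalIntegral.integral_const_mul, intervalIntegral.integral_sub (by simp), h3]
  · simp; ring
  · exact (continuous_const.inner (continuous_normalVel U ζ θ)).intervalIntegrable _ _

end NormalGeodesics

/-! ### Functional calculus of a Hermitian matrix with complex-valued functions. -/

section SpectralFunctions

variable {n : Type*} [Fintype n] [DecidableEq n] {H : Matrix n n ℂ} (hH : H.IsHermitian)

/-- `f(H)` for a Hermitian matrix `H` and a complex function `f` on the line. -/
noncomputable def specFn (f : ℝ → ℂ) : Matrix n n ℂ :=
  Unitary.conjStarAlgAut ℂ _ hH.eigenvectorUnitary (Matrix.diagonal fun i => f (hH.eigenvalues i))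

theorem specFn_congr {f g : ℝ → ℂ} (h : ∀ i, f (hH.eigenvalues i) = g (hH.eigenvalues i)) :
    specFn hH f = specFn hH g := by
  simp only [specFn, h]

theorem specFn_mul (f g : ℝ → ℂ) : specFn hH f * specFn hH g = specFn hH fun y => f y * g y := by
  simp only [specFn, ← map_mul, Matrix.diagonal_mul_diagonal]

theorem specFn_add (f g : ℝ → ℂ) : specFn hH f + specFn hH g = specFn hH fun y => f y + g y := by
  simp only [specFn, ← map_add, Matrix.diagonal_add]

theorem specFn_smul (c : ℂ) (f : ℝ → ℂ) : c • specFn hH f = specFn hH fun y => c * f y := by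
  simp only [specFn, ← map_smul, ← Matrix.diagonal_smul]; rfl

theorem specFn_ofReal : specFn hH (fun y => (y : ℂ)) = H :=
  hH.spectral_theorem.symm

theorem cfc_eq_specFn (f : ℝ → ℝ) : cfc f H = specFn hH fun y => (f y : ℂ) := by
  rw [hH.cfc_eq]; rfl

theorem specFn_apply (f : ℝ → ℂ) : specFn hH f = (hH.eigenvectorUnitary : Matrix n n ℂ) *
    Matrix.diagonal (fun i => f (hH.eigenvalues i)) *
      star (hH.eigenvectorUnitary : Matrix n n ℂ) := rfl

theorem exp_smul_eq_specFn (c : ℂ) :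
    NormedSpace.exp (c • H) = specFn hH fun y => Complex.exp (c * y) := by
  have h1 : c • H = specFn hH fun y => c * y := by
    rw [← specFn_smul, specFn_ofReal]
  have h2 : star (hH.eigenvectorUnitary : Matrix n n ℂ) =
      (hH.eigenvectorUnitary : Matrix n n ℂ)⁻¹ :=
    (Matrix.inv_eq_left_inv (Unitary.coe_star_mul_self _)).symm
  have h3 : IsUnit (hH.eigenvectorUnitary : Matrix n n ℂ) :=
    (Unitary.toUnits hH.eigenvectorUnitary).isUnit
  rw [h1, specFn_apply, specFn_apply, h2, Matrix.exp_conj _ _ h3, Matrix.exp_diagonal]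
  congr 3
  ext i
  rw [Pi.coe_exp, Complex.exp_eq_exp_ℂ]

theorem specFn_mulVec_eigenvector (f : ℝ → ℂ) (i : n) :
    specFn hH f *ᵥ ⇑(hH.eigenvectorBasis i) =
      f (hH.eigenvalues i) • ⇑(hH.eigenvectorBasis i) := by
  rw [specFn_apply, ← Matrix.mulVec_mulVec, hH.star_eigenvectorUnitary_mulVec,
    ← Matrix.mulVec_mulVec, Matrix.diagonal_mulVec_single, mul_one,
    show Pi.single i (f (hH.eigenvalues i)) =
      f (hH.eigenvalues i) • (Pi.single i 1 : n → ℂ) by rw [← Pi.single_smul, smul_eq_mul, mul_one],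
    Matrix.mulVec_smul, hH.eigenvectorUnitary_mulVec]

theorem hasDerivAt_specFn_mulVec {f f' : ℝ → ℝ → ℂ} {s : ℝ}
    (h : ∀ i, HasDerivAt (fun r => f r (hH.eigenvalues i)) (f' s (hH.eigenvalues i)) s)
    (v : n → ℂ) :
    HasDerivAt (fun r => specFn hH (f r) *ᵥ v) (specFn hH (f' s) *ᵥ v) s := by
  rw [hasDerivAt_pi]
  intro l
  -- In the eigenbasis each coordinate is a fixed linear combination of the values of the function
  -- at the eigenvalues, so differentiation is termwise.
  obtain ⟨c, hc⟩ : ∃ c : n → ℂ, ∀ g : ℝ → ℂ,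
      (specFn hH g *ᵥ v) l = ∑ i, g (hH.eigenvalues i) * c i := by
    let V : Matrix n n ℂ := hH.eigenvectorUnitary
    refine ⟨fun i => V l i * (star V *ᵥ v) i, fun g => ?_⟩
    have : specFn hH g *ᵥ v = V *ᵥ fun i => g (hH.eigenvalues i) * (star V *ᵥ v) i := by
      rw [specFn_apply, ← Matrix.mulVec_mulVec, ← Matrix.mulVec_mulVec]
      congr 1
      ext i
      rw [Matrix.mulVec_diagonal]
    rw [this, Matrix.mulVec, dotProduct]
    exact Finset.sum_congr rfl fun i _ => by ring
  simp only [hc]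
  exact HasDerivAt.fun_sum fun i _ => (h i).mul_const _

theorem det_sub_eq_zero_iff (z : ℂ) :
    (z • (1 : Matrix n n ℂ) - H).det = 0 ↔ ∃ i, z = hH.eigenvalues i := by
  have h : (z • (1 : Matrix n n ℂ) - H).det = H.charpoly.eval z := by
    rw [Matrix.eval_charpoly, Matrix.smul_one_eq_diagonal]; rfl
  rw [h, hH.charpoly_eq, Polynomial.eval_prod, Finset.prod_eq_zero_iff]
  simp [sub_eq_zero]

/-- Entrywise complex conjugation of matrices. -/
noncomputable def conjMatrix (n : Type*) [Fintype n] [DecidableEq n] :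
    Matrix n n ℂ →⋆ₐ[ℝ] Matrix n n ℂ :=
  { (Complex.conjAe.toAlgHom).mapMatrix with
    map_star' := fun M => by
      ext i j; simp [Matrix.star_eq_conjTranspose] }

theorem conjMatrix_apply (M : Matrix n n ℂ) (i j : n) :
    conjMatrix n M i j = (starRingEnd ℂ) (M i j) := rfl

/-- Conjugation commutes with the calculus and sends `H` to `-H`, so even functions of `H` are real
matrices. This is why the explicit position and velocity are real. -/
theorem conjMatrix_cfc (hH : H.IsHermitian) (hc : conjMatrix n H = -H) {f : ℝ → ℝ} (hf : ∀ y, f (-y) = f y) :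
    conjMatrix n (cfc f H) = cfc f H := by
  have hH' : IsSelfAdjoint H := hH
  have hfin : (spectrum ℝ H).Finite := Matrix.finite_real_spectrum
  have hcont : Continuous (conjMatrix n) :=
    LinearMap.continuous_of_finiteDimensional (conjMatrix n).toAlgHom.toLinearMap
  rw [StarAlgHomClass.map_cfc (S := ℝ) (conjMatrix n) f H (hfin.continuousOn f) hcont hH'
    (by rw [hc]; exact hH'.neg), hc, ← cfc_comp_neg f H ((hfin.image _).continuousOn f) hH']
  simp only [hf]

end SpectralFunctions

/-! ### Passage between real and complex vectors. -/

section ComplexVectors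

variable {q : ℕ}

theorem toComplexVec_reVec {z : Fin q → ℂ} (hz : ∀ l, (starRingEnd ℂ) (z l) = z l) :
    toComplexVec (reVec z) = z := by
  ext l
  exact Complex.conj_eq_iff_re.mp (hz l)

theorem reVec_toComplexVec (x : EuclideanSpace ℝ (Fin q)) : reVec (toComplexVec x) = x := by
  ext l; simp [reVec, toComplexVec]

theorem toComplexVec_injective : Function.Injective (toComplexVec (q := q)) :=
  Function.LeftInverse.injective reVec_toComplexVec

theorem conj_toComplexVec (x : EuclideanSpace ℝ (Fin q)) (l : Fin q) :
    (starRingEnd ℂ) (toComplexVec x l) = toComplexVec x l := Complex.conj_ofReal _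

theorem toComplexVec_matAct (A : Matrix (Fin q) (Fin q) ℝ) (x : EuclideanSpace ℝ (Fin q)) :
    toComplexVec (matAct A x) = A.map Complex.ofReal *ᵥ toComplexVec x := by
  ext l
  simp [toComplexVec, matAct, Matrix.mulVec, dotProduct]

theorem reVec_mulVec_map (A : Matrix (Fin q) (Fin q) ℝ) (z : Fin q → ℂ) :
    reVec (A.map Complex.ofReal *ᵥ z) = matAct A (reVec z) := by
  ext l
  simp [reVec, matAct, Matrix.mulVec, dotProduct]

theorem conj_mulVec_toComplexVec {A : Matrix (Fin q) (Fin q) ℂ} (hA : conjMatrix (Fin q) A = A)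
    (x : EuclideanSpace ℝ (Fin q)) (l : Fin q) :
    (starRingEnd ℂ) ((A *ᵥ toComplexVec x) l) = (A *ᵥ toComplexVec x) l := by
  simp only [Matrix.mulVec, dotProduct, map_sum, map_mul, conj_toComplexVec]
  refine Finset.sum_congr rfl fun i _ => ?_
  rw [← conjMatrix_apply, hA]

theorem norm_toComplexVec (x : EuclideanSpace ℝ (Fin q)) :
    ‖(WithLp.toLp 2 (toComplexVec x) : EuclideanSpace ℂ (Fin q))‖ = ‖x‖ := by
  simp [EuclideanSpace.norm_eq, toComplexVec]

theorem re_star_dotProduct_toComplexVec (x y : EuclideanSpace ℝ (Fin q)) :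
    (star (toComplexVec x) ⬝ᵥ toComplexVec y).re = inner ℝ x y := by
  simp [dotProduct, toComplexVec, PiLp.inner_apply, mul_comm]

open scoped Matrix.Norms.L2Operator in
theorem map_ofReal_exp (A : Matrix (Fin q) (Fin q) ℝ) :
    (NormedSpace.exp A).map Complex.ofReal = NormedSpace.exp (A.map Complex.ofReal) := by
  let _ : NormedAlgebra ℚ (Matrix (Fin q) (Fin q) ℝ) := NormedAlgebra.restrictScalars ℚ ℝ _
  let φ : Matrix (Fin q) (Fin q) ℝ →+* Matrix (Fin q) (Fin q) ℂ := Complex.ofRealHom.mapMatrix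
  have hφ : Continuous φ := continuous_id.matrix_map Complex.continuous_ofReal
  exact NormedSpace.map_exp φ hφ A

end ComplexVectors

/-! ### The explicit curve as a normal geodesic. -/

section HermU

variable {q m : ℕ} {U : Fin m → Matrix (Fin q) (Fin q) ℝ} (hskew : ∀ j, (U j)ᵀ = -U j)
include hskew

theorem tildeU_transpose (θ : EuclideanSpace ℝ (Fin m)) : (tildeU U θ)ᵀ = -tildeU U θ := by
  simp [tildeU, Matrix.transpose_sum, hskew]

theorem tildeU_swap (θ : EuclideanSpace ℝ (Fin m)) (i j : Fin q) :
    tildeU U θ i j = -tildeU U θ j i := by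
  rw [← Matrix.neg_apply, ← tildeU_transpose hskew, Matrix.transpose_apply]

theorem hermU_isHermitian (θ : EuclideanSpace ℝ (Fin m)) : (hermU U θ).IsHermitian := by
  ext i j
  simp [hermU, tildeU_swap hskew θ j i]

omit hskew in
theorem conjMatrix_hermU (θ : EuclideanSpace ℝ (Fin m)) :
    conjMatrix (Fin q) (hermU U θ) = -hermU U θ := by
  ext i j
  simp [hermU, conjMatrix_apply]

omit hskew in
theorem smul_tildeU_map (c : ℝ) (θ : EuclideanSpace ℝ (Fin m)) :
    (c • tildeU U θ).map Complex.ofReal = (-(Complex.I * c)) • hermU U θ := by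
  ext i j
  simp only [Matrix.map_apply, Matrix.smul_apply, hermU, smul_eq_mul, Complex.ofReal_mul]
  linear_combination (c : ℂ) * (tildeU U θ i j : ℂ) * Complex.I_sq

theorem map_exp_smul_tildeU (c : ℝ) (θ : EuclideanSpace ℝ (Fin m)) :
    (NormedSpace.exp (c • tildeU U θ)).map Complex.ofReal =
      specFn (hermU_isHermitian hskew θ) fun y => Complex.exp (-(Complex.I * c) * y) := by
  rw [map_ofReal_exp, smul_tildeU_map, exp_smul_eq_specFn (hermU_isHermitian hskew θ)]

theorem sinc_eigenvalues_ne_zero {θ : EuclideanSpace ℝ (Fin m)} (hθ : θ ∈ goodSet U) (i : Fin q) :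
    Real.sinc ((hermU_isHermitian hskew θ).eigenvalues i) ≠ 0 := by
  set y := (hermU_isHermitian hskew θ).eigenvalues i with hy
  by_cases h0 : y = 0
  · simp [h0]
  rw [Real.sinc_of_ne_zero h0]
  refine div_ne_zero (fun hs => ?_) h0
  obtain ⟨k, hk⟩ := Real.sin_eq_zero_iff.mp hs
  have hk0 : k ≠ 0 := by rintro rfl; simp at hk; exact h0 hk.symm
  have hdet : ((y : ℂ) • (1 : Matrix (Fin q) (Fin q) ℂ) - hermU U θ).det = 0 :=
    (det_sub_eq_zero_iff (hermU_isHermitian hskew θ) _).mpr ⟨i, rfl⟩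
  rcases lt_or_gt_of_ne hk0 with hneg | hpos
  -- The set `𝒱` excludes only positive multiples of `π`. Negative ones are reduced to these by
  -- transposition, which changes the sign of `U(θ)` and keeps the determinant up to sign.
  · refine hθ k.natAbs (by omega) ?_
    have hT : (hermU U θ)ᵀ = -hermU U θ := by
      ext a b
      simp [hermU, tildeU_swap hskew θ b a]
    have e : ((k.natAbs : ℂ) * (Real.pi : ℂ)) • (1 : Matrix (Fin q) (Fin q) ℂ) - hermU U θ =
        -((y : ℂ) • (1 : Matrix (Fin q) (Fin q) ℂ) - hermU U θ)ᵀ := by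
      have : ((k.natAbs : ℂ) * (Real.pi : ℂ)) = -(y : ℂ) := by
        rw [← hk, Nat.cast_natAbs, abs_of_neg hneg]; push_cast; ring
      rw [this, Matrix.transpose_sub, hT, Matrix.transpose_smul, Matrix.transpose_one]
      simp [neg_smul]; abel
    rw [e, Matrix.det_neg, Matrix.det_transpose, hdet, mul_zero]
  · refine hθ k.natAbs (by omega) ?_
    have : ((k.natAbs : ℂ) * (Real.pi : ℂ)) = (y : ℂ) := by
      rw [← hk, Nat.cast_natAbs, abs_of_pos hpos]; push_cast; ring
    rw [this, hdet]

omit hskew in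
theorem hasDerivAt_sinc_exp {y : ℝ} (hy : Real.sinc y ≠ 0) (s : ℝ) :
    HasDerivAt (fun r : ℝ => ((r * Real.sinc (r * y) / Real.sinc y : ℝ) : ℂ) *
        Complex.exp (-(Complex.I * ((r - 1 : ℝ) : ℂ)) * y))
      (((Real.sinc y)⁻¹ : ℝ) * Complex.exp (-(Complex.I * ((2 * s - 1 : ℝ) : ℂ)) * y)) s := by
  by_cases h0 : y = 0
  · subst h0
    simpa using (hasDerivAt_id s).ofReal_comp
  have hyC : (y : ℂ) ≠ 0 := Complex.ofReal_ne_zero.mpr h0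
  have hyc : (Real.sinc y : ℂ) ≠ 0 := Complex.ofReal_ne_zero.mpr hy
  have e : ∀ r : ℝ, r * Real.sinc (r * y) = Real.sin (r * y) / y := fun r => by
    by_cases hr : r = 0
    · simp [hr]
    · rw [Real.sinc_of_ne_zero (mul_ne_zero hr h0)]; field_simp
  -- Writing the sine with exponentials leaves a single `r`-dependent exponential, whose derivative
  -- is immediate.
  have key : ∀ r : ℝ, ((r * Real.sinc (r * y) / Real.sinc y : ℝ) : ℂ) *
      Complex.exp (-(Complex.I * ((r - 1 : ℝ) : ℂ)) * y) =
      (2 * Complex.I * y * Real.sinc y)⁻¹ *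
        (Complex.exp (Complex.I * y) - Complex.exp (-(Complex.I * ((2 * r - 1 : ℝ) : ℂ)) * y)) := by
    intro r
    rw [e r]
    push_cast
    rw [Complex.sin]
    have h1 : Complex.exp (Complex.I * y) =
        Complex.exp (r * y * Complex.I) * Complex.exp (-(Complex.I * (r - 1)) * y) := by
      rw [← Complex.exp_add]; congr 1; ring
    have h2 : Complex.exp (-(Complex.I * (2 * r - 1)) * y) =
        Complex.exp (-(r * y) * Complex.I) * Complex.exp (-(Complex.I * (r - 1)) * y) := by
      rw [← Complex.exp_add]; congr 1; ring
    rw [h1, h2]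
    field_simp
    linear_combination (Complex.exp (-(r * y * Complex.I)) - Complex.exp (r * y * Complex.I)) *
      Complex.I_sq
  simp only [key]
  have hd : HasDerivAt (fun r : ℝ => -(Complex.I * ((2 * r - 1 : ℝ) : ℂ)) * (y : ℂ))
      (-(Complex.I * 2) * y) s := by
    have h1 : HasDerivAt (fun r : ℝ => ((2 * r - 1 : ℝ) : ℂ)) 2 s := by
      have := (((hasDerivAt_id s).const_mul (2 : ℝ)).sub_const 1).ofReal_comp
      simpa using this
    exact ((h1.const_mul Complex.I).fun_neg).mul_const _
  refine ((hd.cexp.const_sub _).const_mul _).congr_deriv ?_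
  push_cast
  field_simp

theorem explicitVelC_eq (x : EuclideanSpace ℝ (Fin q)) (θ : EuclideanSpace ℝ (Fin m)) (s : ℝ) :
    explicitVelC U x θ s = specFn (hermU_isHermitian hskew θ) (fun y => ((Real.sinc y)⁻¹ : ℝ) *
      Complex.exp (-(Complex.I * ((2 * s - 1 : ℝ) : ℂ)) * y)) *ᵥ toComplexVec x := by
  rw [explicitVelC, toComplexVec_matAct, map_exp_smul_tildeU hskew, UdivSinU,
    cfc_eq_specFn (hermU_isHermitian hskew θ), Matrix.mulVec_mulVec, specFn_mul]

theorem explicitPosC_eq (x : EuclideanSpace ℝ (Fin q)) (θ : EuclideanSpace ℝ (Fin m)) (s : ℝ) :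
    explicitPosC U x θ s = specFn (hermU_isHermitian hskew θ)
      (fun y => ((s * Real.sinc (s * y) / Real.sinc y : ℝ) : ℂ) *
        Complex.exp (-(Complex.I * ((s - 1 : ℝ) : ℂ)) * y)) *ᵥ toComplexVec x := by
  rw [explicitPosC, toComplexVec_matAct, map_exp_smul_tildeU hskew, sinDivSinU,
    cfc_eq_specFn (hermU_isHermitian hskew θ), Matrix.mulVec_mulVec, specFn_mul]

theorem toComplexVec_explicitVel (x : EuclideanSpace ℝ (Fin q)) (θ : EuclideanSpace ℝ (Fin m))
    (s : ℝ) : toComplexVec (explicitVel U x θ s) = explicitVelC U x θ s := by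
  refine toComplexVec_reVec fun l => ?_
  exact conj_mulVec_toComplexVec (conjMatrix_cfc (hermU_isHermitian hskew θ) (conjMatrix_hermU θ)
    fun y => by rw [Real.sinc_neg]) _ l

theorem toComplexVec_explicitPos (x : EuclideanSpace ℝ (Fin q)) (θ : EuclideanSpace ℝ (Fin m))
    (s : ℝ) : toComplexVec (explicitPos U x θ s) = explicitPosC U x θ s := by
  refine toComplexVec_reVec fun l => ?_
  exact conj_mulVec_toComplexVec (conjMatrix_cfc (hermU_isHermitian hskew θ) (conjMatrix_hermU θ)
    fun y => by rw [Real.sinc_neg, mul_neg, Real.sinc_neg]) _ l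

theorem explicitVel_eq_normalVel (x : EuclideanSpace ℝ (Fin q)) (θ : EuclideanSpace ℝ (Fin m))
    (s : ℝ) : explicitVel U x θ s = normalVel U (explicitVel U x θ 0) θ s := by
  apply toComplexVec_injective
  rw [normalVel, toComplexVec_matAct, toComplexVec_explicitVel hskew,
    toComplexVec_explicitVel hskew, explicitVelC_eq hskew, explicitVelC_eq hskew,
    map_exp_smul_tildeU hskew, Matrix.mulVec_mulVec, specFn_mul]
  congr 1
  refine specFn_congr _ fun i => ?_
  rw [mul_left_comm, ← Complex.exp_add]
  congr 2
  push_cast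
  ring

/-- The exponential factor disappears at the midpoint. Since the speed is constant, `|U / sin U x|`
is therefore the initial speed. -/
theorem explicitVel_half (x : EuclideanSpace ℝ (Fin q)) (θ : EuclideanSpace ℝ (Fin m)) :
    explicitVelC U x θ (1 / 2) = UdivSinU U θ *ᵥ toComplexVec x := by
  rw [explicitVelC_eq hskew, UdivSinU, cfc_eq_specFn (hermU_isHermitian hskew θ)]
  simp

theorem normUdivSinU_eq (x : EuclideanSpace ℝ (Fin q)) (θ : EuclideanSpace ℝ (Fin m)) :
    normUdivSinU U θ x = ‖explicitVel U x θ 0‖ := by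
  rw [normUdivSinU, ← explicitVel_half hskew, ← toComplexVec_explicitVel hskew, norm_toComplexVec,
    explicitVel_eq_normalVel hskew, norm_normalVel hskew]

theorem explicitPos_zero (x : EuclideanSpace ℝ (Fin q)) (θ : EuclideanSpace ℝ (Fin m)) :
    explicitPos U x θ 0 = 0 := by
  apply toComplexVec_injective
  rw [toComplexVec_explicitPos hskew, explicitPosC_eq hskew]
  have : (fun y : ℝ => ((0 * Real.sinc (0 * y) / Real.sinc y : ℝ) : ℂ) *
        Complex.exp (-(Complex.I * ((0 - 1 : ℝ) : ℂ)) * y)) = fun _ => 0 := by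
    ext y; simp
  rw [this]
  ext l
  simp [specFn, toComplexVec]

theorem explicitPos_one {θ : EuclideanSpace ℝ (Fin m)} (hθ : θ ∈ goodSet U)
    (x : EuclideanSpace ℝ (Fin q)) : explicitPos U x θ 1 = x := by
  apply toComplexVec_injective
  rw [toComplexVec_explicitPos hskew, explicitPosC_eq hskew,
    specFn_congr (hermU_isHermitian hskew θ) (g := fun _ => 1) fun i => ?_]
  · simp [specFn]
  · have := sinc_eigenvalues_ne_zero hskew hθ i
    simp [this]

theorem hasDerivAt_explicitPos {θ : EuclideanSpace ℝ (Fin m)} (hθ : θ ∈ goodSet U)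
    (x : EuclideanSpace ℝ (Fin q)) (s : ℝ) :
    HasDerivAt (explicitPos U x θ) (explicitVel U x θ s) s := by
  have h : HasDerivAt (explicitPosC U x θ) (explicitVelC U x θ s) s := by
    rw [explicitVelC_eq hskew, show explicitPosC U x θ = _ from funext (explicitPosC_eq hskew x θ)]
    exact hasDerivAt_specFn_mulVec (hermU_isHermitian hskew θ)
      (f := fun r y => ((r * Real.sinc (r * y) / Real.sinc y : ℝ) : ℂ) *
        Complex.exp (-(Complex.I * ((r - 1 : ℝ) : ℂ)) * y))
      (f' := fun r y => ((Real.sinc y)⁻¹ : ℝ) *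
        Complex.exp (-(Complex.I * ((2 * r - 1 : ℝ) : ℂ)) * y))
      (fun i => hasDerivAt_sinc_exp (sinc_eigenvalues_ne_zero hskew hθ i) s) _
  have hre : HasDerivAt (fun r l => (explicitPosC U x θ r l).re)
      (fun l => (explicitVelC U x θ s l).re) s :=
    hasDerivAt_pi.mpr fun l => Complex.reCLM.hasFDerivAt.comp_hasDerivAt s (hasDerivAt_pi.mp h l)
  exact (PiLp.continuousLinearEquiv 2 ℝ
    fun _ : Fin q => ℝ).symm.toContinuousLinearMap.hasFDerivAt.comp_hasDerivAt s hre

theorem explicitPos_eq_normalPos {θ : EuclideanSpace ℝ (Fin m)} (hθ : θ ∈ goodSet U)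
    (x : EuclideanSpace ℝ (Fin q)) (s : ℝ) :
    explicitPos U x θ s = normalPos U (explicitVel U x θ 0) θ s := by
  have e : explicitVel U x θ = normalVel U (explicitVel U x θ 0) θ :=
    funext (explicitVel_eq_normalVel hskew x θ)
  have := intervalIntegral.integral_eq_sub_of_hasDerivAt (a := 0) (b := s)
    (fun r _ => hasDerivAt_explicitPos hskew hθ x r)
    (by rw [e]; exact (continuous_normalVel U _ θ).intervalIntegrable _ _)
  rw [explicitPos_zero hskew, sub_zero, e] at this
  exact this.symm

theorem explicitGeod_eq_normalGeod {θ : EuclideanSpace ℝ (Fin m)} (hθ : θ ∈ goodSet U)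
    (x : EuclideanSpace ℝ (Fin q)) (s : ℝ) :
    explicitGeod U x θ s = normalGeod U (explicitVel U x θ 0) θ s := by
  refine Prod.ext (explicitPos_eq_normalPos hskew hθ x s) ?_
  rw [normalGeod_snd]
  simp only [← explicitPos_eq_normalPos hskew hθ, ← explicitVel_eq_normalVel hskew,
    pairingL_apply, explicitGeod]

/-- The quadratic form of `U(θ) cot U(θ)` in terms of the initial velocity. -/
theorem UcotU_form {θ : EuclideanSpace ℝ (Fin m)} (hθ : θ ∈ goodSet U)
    (x : EuclideanSpace ℝ (Fin q)) :
    (star (toComplexVec x) ⬝ᵥ (UcotU U θ *ᵥ toComplexVec x)).re =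
      inner ℝ x (explicitVel U x θ 0) := by
  -- As `Ũ = -iU`, one has `(U / sin U) e^{-Ũ} = (U / sin U)(cos U + i sin U) = U cot U + iU`. The
  -- correction `Ũ` is skew and drops out of the quadratic form.
  have h : UcotU U θ *ᵥ toComplexVec x =
      toComplexVec (explicitVel U x θ 0) + toComplexVec (opU U θ x) := by
    have h1 : toComplexVec (opU U θ x) = (-Complex.I • hermU U θ) *ᵥ toComplexVec x := by
      have := smul_tildeU_map (U := U) 1 θ
      rw [one_smul, Complex.ofReal_one, mul_one] at this
      rw [← this, ← toComplexVec_matAct, opU_eq, matAct_eq]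
    have h2 : -Complex.I • hermU U θ =
        specFn (hermU_isHermitian hskew θ) fun y => -Complex.I * y := by
      rw [← specFn_smul, specFn_ofReal]
    rw [h1, h2, toComplexVec_explicitVel hskew, explicitVelC_eq hskew, UcotU,
      cfc_eq_specFn (hermU_isHermitian hskew θ), ← Matrix.add_mulVec, specFn_add]
    congr 1
    refine specFn_congr _ fun i => ?_
    set y := (hermU_isHermitian hskew θ).eigenvalues i
    have hy : (Real.sinc y : ℂ) ≠ 0 :=
      Complex.ofReal_ne_zero.mpr (sinc_eigenvalues_ne_zero hskew hθ i)
    have hs : (Real.sin y : ℂ) = y * Real.sinc y := by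
      rw [← Complex.ofReal_mul]
      congr 1
      by_cases h0 : y = 0
      · simp [h0]
      · rw [Real.sinc_of_ne_zero h0]; field_simp
    have he : Complex.exp (-(Complex.I * ((2 * 0 - 1 : ℝ) : ℂ)) * y) =
        Real.cos y + Real.sin y * Complex.I := by
      rw [Complex.ofReal_cos, Complex.ofReal_sin, ← Complex.exp_mul_I]
      congr 1
      push_cast; ring
    rw [he, hs]
    push_cast
    field_simp
    ring
  rw [h, dotProduct_add, Complex.add_re, re_star_dotProduct_toComplexVec,
    re_star_dotProduct_toComplexVec, real_inner_comm (opU U θ x), opU_inner_self hskew, add_zero]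

end HermU

/-! ### Perturbation of one-parameter groups of isometries. -/

section OneParameterGroups

variable {E : Type*} [NormedAddCommGroup E] [InnerProductSpace ℝ E] [CompleteSpace E]

omit [CompleteSpace E] in
theorem apply_exp_smul (A : E →L[ℝ] E) (c : ℝ) (v : E) :
    A (NormedSpace.exp (c • A) v) = NormedSpace.exp (c • A) (A v) := by
  have h : Commute A (NormedSpace.exp (c • A)) := ((Commute.refl A).smul_right c).exp_right
  exact congrArg (fun T : E →L[ℝ] E => T v) h

/-- Duhamel's argument: `e^{-rB} e^{rA} v` has derivative `e^{-rB} (A - B) e^{rA} v`, and both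
exponentials are isometries. -/
theorem norm_exp_smul_apply_sub_le {A B : E →L[ℝ] E} (hA : ∀ x, inner ℝ (A x) x = 0)
    (hB : ∀ x, inner ℝ (B x) x = 0) (v : E) {s : ℝ} (hs : s ∈ Set.Icc (0 : ℝ) 1) :
    ‖NormedSpace.exp (s • B) v - NormedSpace.exp (s • A) v‖ ≤ ‖B - A‖ * ‖v‖ := by
  have hd : ∀ r : ℝ, HasDerivAt
      (fun r : ℝ => NormedSpace.exp ((-r) • B) (NormedSpace.exp (r • A) v))
      (NormedSpace.exp ((-r) • B) ((A - B) (NormedSpace.exp (r • A) v))) r := fun r => by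
    have h1 : HasDerivAt (fun r : ℝ => NormedSpace.exp ((-r) • B))
        (-(NormedSpace.exp ((-r) • B) * B)) r := by
      have := (hasDerivAt_exp_smul_const (𝕂 := ℝ) B (-r)).scomp r (hasDerivAt_neg r)
      simpa [Function.comp_def] using this
    refine (h1.clm_apply (hasDerivAt_exp_smul_apply A v r)).congr_deriv ?_
    simp [sub_eq_neg_add]
  have hb : ∀ r ∈ Set.Icc (0 : ℝ) 1,
      ‖NormedSpace.exp ((-r) • B) ((A - B) (NormedSpace.exp (r • A) v))‖ ≤ ‖B - A‖ * ‖v‖ := by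
    intro r _
    rw [norm_exp_smul_apply _ hB, ← norm_exp_smul_apply A hA v r, norm_sub_rev B]
    exact ContinuousLinearMap.le_opNorm _ _
  have h := (convex_Icc (0 : ℝ) 1).norm_image_sub_le_of_norm_hasDerivWithin_le
    (fun r _ => (hd r).hasDerivWithinAt) hb (Set.left_mem_Icc.mpr zero_le_one) hs
  have e : NormedSpace.exp (s • B) (NormedSpace.exp ((-s) • B) (NormedSpace.exp (s • A) v)) =
      NormedSpace.exp (s • A) v := by
    have : NormedSpace.exp (s • B) * NormedSpace.exp ((-s) • B) = 1 := by
      let _ : NormedAlgebra ℚ (E →L[ℝ] E) := NormedAlgebra.restrictScalars ℚ ℝ _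
      rw [← NormedSpace.exp_add_of_commute (((Commute.refl B).smul_left s).smul_right (-s)),
        neg_smul, add_neg_cancel, NormedSpace.exp_zero]
    exact congrArg (fun T : E →L[ℝ] E => T (NormedSpace.exp (s • A) v)) this
  simp only [neg_zero, zero_smul, NormedSpace.exp_zero, one_apply_eq_self, sub_zero] at h
  rw [← norm_exp_smul_apply B hB _ s, map_sub, e, Real.norm_of_nonneg hs.1, norm_sub_rev] at h
  exact h.trans (mul_le_of_le_one_right (by positivity) hs.2)

end OneParameterGroups

/-! ### The endpoint map and the gradient of the reference function. -/

section EndpointMap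

variable {q m : ℕ} (U : Fin m → Matrix (Fin q) (Fin q) ℝ)

theorem normalVel_add (a b : EuclideanSpace ℝ (Fin q)) (θ : EuclideanSpace ℝ (Fin m)) (s : ℝ) :
    normalVel U (a + b) θ s = normalVel U a θ s + normalVel U b θ s := by
  simp only [normalVel_eq, map_add]

theorem normalVel_sub (a b : EuclideanSpace ℝ (Fin q)) (θ : EuclideanSpace ℝ (Fin m)) (s : ℝ) :
    normalVel U (a - b) θ s = normalVel U a θ s - normalVel U b θ s := by
  simp only [normalVel_eq, map_sub]

theorem normalVel_smul (c : ℝ) (a : EuclideanSpace ℝ (Fin q)) (θ : EuclideanSpace ℝ (Fin m))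
    (s : ℝ) : normalVel U (c • a) θ s = c • normalVel U a θ s := by
  simp only [normalVel_eq, map_smul]

/-- The linear map sending an initial velocity to the horizontal endpoint of the geodesic. -/
noncomputable def posMap (θ : EuclideanSpace ℝ (Fin m)) :
    EuclideanSpace ℝ (Fin q) →ₗ[ℝ] EuclideanSpace ℝ (Fin q) where
  toFun ζ := normalPos U ζ θ 1
  map_add' a b := by
    simp only [normalPos, normalVel_add]
    exact intervalIntegral.integral_add ((continuous_normalVel U a θ).intervalIntegrable _ _)
      ((continuous_normalVel U b θ).intervalIntegrable _ _)
  map_smul' c a := by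
    simp only [normalPos, normalVel_smul, intervalIntegral.integral_smul, RingHom.id_apply]

theorem posMap_apply (θ : EuclideanSpace ℝ (Fin m)) (ζ : EuclideanSpace ℝ (Fin q)) :
    posMap U θ ζ = normalPos U ζ θ 1 := rfl

theorem opU_normalVel (ζ : EuclideanSpace ℝ (Fin q)) (θ : EuclideanSpace ℝ (Fin m)) (s : ℝ) :
    opU U θ (normalVel U ζ θ s) = normalVel U (opU U θ ζ) θ s := by
  rw [normalVel_eq, normalVel_eq]
  exact apply_exp_smul _ _ _

theorem opU_posMap (ζ : EuclideanSpace ℝ (Fin q)) (θ : EuclideanSpace ℝ (Fin m)) :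
    opU U θ (posMap U θ ζ) = posMap U θ (opU U θ ζ) := by
  simp only [posMap_apply, normalPos, ← opU_normalVel]
  exact ((opU U θ).intervalIntegral_comp_comm
    ((continuous_normalVel U ζ θ).intervalIntegrable 0 1)).symm

/-- Periodicity and the first integral give `Ũ x(1) = 0`. Since `Ũ` commutes with the endpoint map,
`Ũ ζ` lies in its kernel. -/
theorem opU_eq_zero_of_periodic {θ : EuclideanSpace ℝ (Fin m)}
    (hinj : Function.Injective (posMap U θ)) {ζ : EuclideanSpace ℝ (Fin q)}
    (h : normalVel U ζ θ 1 = ζ) : opU U θ ζ = 0 := by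
  apply hinj
  rw [map_zero, ← opU_posMap, posMap_apply]
  have := normalVel_eq_add U ζ θ 1
  rw [h, left_eq_add] at this
  exact (smul_eq_zero_iff_right two_ne_zero).mp this

variable {U} (hskew : ∀ j, (U j)ᵀ = -U j)
include hskew

theorem posMap_explicitVel {θ : EuclideanSpace ℝ (Fin m)} (hθ : θ ∈ goodSet U)
    (x : EuclideanSpace ℝ (Fin q)) : posMap U θ (explicitVel U x θ 0) = x := by
  rw [posMap_apply, ← explicitPos_eq_normalPos hskew hθ, explicitPos_one hskew hθ]

theorem posMap_injective {θ : EuclideanSpace ℝ (Fin m)} (hθ : θ ∈ goodSet U) :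
    Function.Injective (posMap U θ) :=
  LinearMap.injective_iff_surjective.mpr fun x => ⟨_, posMap_explicitVel hskew hθ x⟩

theorem explicitVel_posMap {θ : EuclideanSpace ℝ (Fin m)} (hθ : θ ∈ goodSet U)
    (ζ : EuclideanSpace ℝ (Fin q)) : explicitVel U (posMap U θ ζ) θ 0 = ζ :=
  posMap_injective hskew hθ (posMap_explicitVel hskew hθ _)

/-- An eigenvector for `kπ` is fixed by `e^{2Ũ}`, so its real and imaginary parts are periodic
velocities and injectivity puts them in the kernel of `Ũ`. This contradicts `kπ ≠ 0`. Together with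
stability of injectivity it yields the openness of `𝒱`. -/
theorem mem_goodSet_of_injective {θ : EuclideanSpace ℝ (Fin m)}
    (hinj : Function.Injective (posMap U θ)) : θ ∈ goodSet U := by
  intro k hk hdet
  have hH := hermU_isHermitian hskew θ
  obtain ⟨i, hi⟩ := (det_sub_eq_zero_iff hH _).mp hdet
  set v : Fin q → ℂ := ⇑(hH.eigenvectorBasis i) with hv
  have hper : (NormedSpace.exp ((2 * (1 : ℝ)) • tildeU U θ)).map Complex.ofReal *ᵥ v = v := by
    rw [map_exp_smul_tildeU hskew, hv, specFn_mulVec_eigenvector, ← hi]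
    have : Complex.exp (-(Complex.I * ((2 * 1 : ℝ) : ℂ)) * (k * Real.pi)) = 1 := by
      rw [Complex.exp_eq_one_iff]
      exact ⟨-k, by push_cast; ring⟩
    rw [this, one_smul]
  have hre : opU U θ (reVec v) = 0 := by
    refine opU_eq_zero_of_periodic U hinj ?_
    rw [normalVel, ← reVec_mulVec_map, hper]
  -- `reVec (-Complex.I • v)` is the imaginary part of `v`.
  have him : opU U θ (reVec (-Complex.I • v)) = 0 := by
    refine opU_eq_zero_of_periodic U hinj ?_
    rw [normalVel, ← reVec_mulVec_map, Matrix.mulVec_smul, hper]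
  have hkv : hermU U θ *ᵥ v = ((k : ℂ) * Real.pi) • v := by
    rw [hi, hv]
    have := specFn_mulVec_eigenvector hH (fun y => (y : ℂ)) i
    rwa [specFn_ofReal] at this
  have hker : hermU U θ *ᵥ v = 0 := by
    have h1 : (tildeU U θ).map Complex.ofReal *ᵥ v = 0 := by
      have e1 : reVec ((tildeU U θ).map Complex.ofReal *ᵥ v) = 0 := by
        rw [reVec_mulVec_map]; exact hre
      have e2 : reVec (-Complex.I • ((tildeU U θ).map Complex.ofReal *ᵥ v)) = 0 := by
        rw [← Matrix.mulVec_smul, reVec_mulVec_map]; exact him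
      ext l
      have e1l := congrArg (fun z : EuclideanSpace ℝ (Fin q) => z l) e1
      have e2l := congrArg (fun z : EuclideanSpace ℝ (Fin q) => z l) e2
      simp only [reVec, Pi.smul_apply, smul_eq_mul, Complex.neg_re, Complex.mul_re, Complex.I_re,
        Complex.I_im, neg_mul, PiLp.zero_apply] at e1l e2l
      apply Complex.ext
      · simpa using e1l
      · simpa using e2l
    rw [hermU, Matrix.smul_mulVec, h1, smul_zero]
  rw [hker] at hkv
  have hk0 : ((k : ℂ) * Real.pi) ≠ 0 :=
    mul_ne_zero (Nat.cast_ne_zero.mpr hk.ne') (Complex.ofReal_ne_zero.mpr Real.pi_ne_zero)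
  have hv0 : v = 0 := (smul_eq_zero_iff_right hk0).mp hkv.symm
  have := hH.eigenvectorBasis.orthonormal.ne_zero i
  exact this (by ext l; exact congrFun hv0 l)

theorem norm_normalVel_sub_le (ζ : EuclideanSpace ℝ (Fin q)) (θ θ' : EuclideanSpace ℝ (Fin m))
    {s : ℝ} (hs : s ∈ Set.Icc (0 : ℝ) 1) :
    ‖normalVel U ζ θ' s - normalVel U ζ θ s‖ ≤ 2 * ‖opU U (θ' - θ)‖ * ‖ζ‖ := by
  have e : ∀ η : EuclideanSpace ℝ (Fin m),
      normalVel U ζ η s = NormedSpace.exp (s • opU U ((2 : ℝ) • η)) ζ := fun η => by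
    rw [normalVel_eq, map_smul, smul_smul, mul_comm]
  rw [e, e]
  refine (norm_exp_smul_apply_sub_le (opU_inner_self hskew _) (opU_inner_self hskew _) ζ
    hs).trans_eq ?_
  rw [← map_sub, ← smul_sub, map_smul, norm_smul, Real.norm_ofNat]

theorem norm_posMap_sub_le (ζ : EuclideanSpace ℝ (Fin q)) (θ θ' : EuclideanSpace ℝ (Fin m)) :
    ‖posMap U θ' ζ - posMap U θ ζ‖ ≤ 2 * ‖opU U (θ' - θ)‖ * ‖ζ‖ := by
  rw [posMap_apply, posMap_apply, normalPos, normalPos, ← intervalIntegral.integral_sub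
    ((continuous_normalVel U ζ θ').intervalIntegrable _ _)
    ((continuous_normalVel U ζ θ).intervalIntegrable _ _)]
  refine (intervalIntegral.norm_integral_le_of_norm_le_const
    (C := 2 * ‖opU U (θ' - θ)‖ * ‖ζ‖) fun r hr => ?_).trans_eq (by simp)
  rw [Set.uIoc_of_le zero_le_one] at hr
  exact norm_normalVel_sub_le hskew ζ θ θ' ⟨hr.1.le, hr.2⟩

/-- Comparison of the quadratic forms of `U cot U` at two covectors. -/
theorem inner_initial_sub (ζ ζ' : EuclideanSpace ℝ (Fin q)) (θ θ' : EuclideanSpace ℝ (Fin m))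
    {x : EuclideanSpace ℝ (Fin q)} (h : normalPos U ζ θ 1 = x) (h' : normalPos U ζ' θ' 1 = x) :
    inner ℝ x ζ' - inner ℝ x ζ = -2 * ∫ r in (0 : ℝ)..1,
      inner ℝ (pairingL U (normalPos U ζ θ r) (normalVel U ζ' θ' r)) (θ' - θ) := by
  -- This combination vanishes at 0. At 1 both positions equal `x`, so its last term vanishes by
  -- skewness and the required difference remains.
  have hd : ∀ r : ℝ, HasDerivAt
      (fun r => inner ℝ (normalPos U ζ θ r) ζ' - inner ℝ (normalPos U ζ' θ' r) ζ +
        2 * inner ℝ (normalPos U ζ θ r) (opU U θ' (normalPos U ζ' θ' r)))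
      (-2 * inner ℝ (pairingL U (normalPos U ζ θ r) (normalVel U ζ' θ' r)) (θ' - θ)) r := by
    intro r
    have h1 := hasDerivAt_normalPos U ζ θ r
    have h2 := hasDerivAt_normalPos U ζ' θ' r
    have h3 := (h1.inner ℝ (hasDerivAt_const r ζ')).sub (h2.inner ℝ (hasDerivAt_const r ζ))
    have h4 := (h1.inner ℝ ((opU U θ').hasFDerivAt.comp_hasDerivAt r h2)).const_mul 2
    refine (h3.add h4).congr_deriv ?_
    have e1 : ζ' = normalVel U ζ' θ' r - (2 : ℝ) • opU U θ' (normalPos U ζ' θ' r) := by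
      rw [normalVel_eq_add]; abel
    have e2 : ζ = normalVel U ζ θ r - (2 : ℝ) • opU U θ (normalPos U ζ θ r) := by
      rw [normalVel_eq_add]; abel
    have i1 : inner ℝ (normalVel U ζ θ r) ζ' = inner ℝ (normalVel U ζ θ r) (normalVel U ζ' θ' r) -
        2 * inner ℝ (normalVel U ζ θ r) (opU U θ' (normalPos U ζ' θ' r)) := by
      nth_rewrite 1 [e1]
      rw [inner_sub_right, inner_smul_right]
    have i2 : inner ℝ (normalVel U ζ' θ' r) ζ = inner ℝ (normalVel U ζ θ r) (normalVel U ζ' θ' r) -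
        2 * inner ℝ (opU U θ (normalPos U ζ θ r)) (normalVel U ζ' θ' r) := by
      nth_rewrite 1 [e2]
      rw [inner_sub_right, inner_smul_right, real_inner_comm,
        real_inner_comm (opU U θ (normalPos U ζ θ r))]
    rw [inner_pairing, map_sub, sub_apply, inner_sub_left,
      opU_skew hskew θ' (normalPos U ζ θ r), i1, i2, inner_zero_right, inner_zero_right,
      Function.comp_apply]
    ring
  have hc : Continuous fun r =>
      -2 * inner ℝ (pairingL U (normalPos U ζ θ r) (normalVel U ζ' θ' r)) (θ' - θ) :=
    continuous_const.mul ((((pairingL U).continuous.comp (continuous_normalPos U ζ θ)).clm_apply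
      (continuous_normalVel U ζ' θ')).inner continuous_const)
  have := intervalIntegral.integral_eq_sub_of_hasDerivAt (fun r _ => hd r)
    (hc.intervalIntegrable 0 1)
  rw [intervalIntegral.integral_const_mul] at this
  rw [this, h, h', normalPos_zero, normalPos_zero]
  have h0 : inner ℝ x (opU U θ' x) = 0 := by rw [real_inner_comm, opU_inner_self hskew]
  simp [h0]

/-- An injective linear map stays injective under a perturbation small compared with its lower
bound. The same bound controls the change of the inverse, which gives the Lipschitz estimate. -/
theorem exists_forall_norm_normalVel_sub_le {θ : EuclideanSpace ℝ (Fin m)} (hθ : θ ∈ goodSet U)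
    (x : EuclideanSpace ℝ (Fin q)) :
    ∃ C : ℝ, 0 ≤ C ∧ ∀ᶠ θ' in nhds θ, θ' ∈ goodSet U ∧ ∀ s ∈ Set.Icc (0 : ℝ) 1,
      ‖normalVel U (explicitVel U x θ' 0) θ' s - normalVel U (explicitVel U x θ 0) θ s‖ ≤
        C * ‖θ' - θ‖ := by
  obtain ⟨K, hK0, hK⟩ := (posMap U θ).exists_antilipschitzWith
    (LinearMap.ker_eq_bot.mpr (posMap_injective hskew hθ))
  have hK0' : (0 : ℝ) < K := hK0
  have hKb : ∀ v, ‖v‖ ≤ K * ‖posMap U θ v‖ := fun v => by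
    simpa using hK.le_mul_dist v 0
  set ζ := explicitVel U x θ 0 with hζ
  have hsmall : ∀ᶠ θ' in nhds θ, K * (2 * ‖opU U (θ' - θ)‖) < 1 / 2 := by
    have hc : Continuous fun θ' : EuclideanSpace ℝ (Fin m) => K * (2 * ‖opU U (θ' - θ)‖) := by
      fun_prop
    exact hc.tendsto θ |>.eventually_lt_const (by simp)
  -- The first term accounts for the change of initial velocity, the second for the change of
  -- covector with fixed initial velocity.
  refine ⟨(4 * K * ‖ζ‖ + 2 * ‖ζ‖) * ‖opU U‖, by positivity, hsmall.mono fun θ' hθ' => ?_⟩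
  set a := ‖opU U (θ' - θ)‖ with ha
  have hdiff : ∀ v, ‖posMap U θ' v - posMap U θ v‖ ≤ 2 * a * ‖v‖ := fun v =>
    norm_posMap_sub_le hskew v θ θ'
  have hgood : θ' ∈ goodSet U := by
    refine mem_goodSet_of_injective hskew (LinearMap.ker_eq_bot.mp
      (LinearMap.ker_eq_bot'.mpr fun v hv => ?_))
    have h1 := hdiff v
    rw [hv, zero_sub, norm_neg] at h1
    have h2 : ‖v‖ ≤ 1 / 2 * ‖v‖ := (hKb v).trans (by
      calc (K : ℝ) * ‖posMap U θ v‖ ≤ K * (2 * a * ‖v‖) := by gcongr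
        _ = K * (2 * a) * ‖v‖ := by ring
        _ ≤ 1 / 2 * ‖v‖ := by gcongr)
    exact norm_le_zero_iff.mp (by linarith)
  refine ⟨hgood, fun s hs => ?_⟩
  set ζ' := explicitVel U x θ' 0 with hζ'
  have hdist : ‖ζ' - ζ‖ ≤ 4 * K * ‖ζ‖ * a := by
    have h1 : posMap U θ (ζ' - ζ) = -(posMap U θ' ζ' - posMap U θ ζ') := by
      rw [map_sub, posMap_explicitVel hskew hθ, posMap_explicitVel hskew hgood]; abel
    have h2 := hKb (ζ' - ζ)
    rw [h1, norm_neg] at h2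
    have h3 : ‖ζ'‖ ≤ ‖ζ‖ + ‖ζ' - ζ‖ := norm_le_insert' ζ' ζ
    -- The unknown difference reappears on the right with factor at most 1/2 and is absorbed.
    have h4 : ‖ζ' - ζ‖ ≤ K * (2 * a) * ‖ζ‖ + 1 / 2 * ‖ζ' - ζ‖ :=
      calc ‖ζ' - ζ‖ ≤ K * (2 * a * ‖ζ'‖) := h2.trans (by gcongr; exact hdiff _)
        _ ≤ K * (2 * a * (‖ζ‖ + ‖ζ' - ζ‖)) := by gcongr
        _ = K * (2 * a) * ‖ζ‖ + K * (2 * a) * ‖ζ' - ζ‖ := by ring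
        _ ≤ K * (2 * a) * ‖ζ‖ + 1 / 2 * ‖ζ' - ζ‖ := by gcongr
    linarith
  have ha' : a ≤ ‖opU U‖ * ‖θ' - θ‖ := (opU U).le_opNorm _
  calc ‖normalVel U ζ' θ' s - normalVel U ζ θ s‖
      ≤ ‖normalVel U ζ' θ' s - normalVel U ζ θ' s‖ + ‖normalVel U ζ θ' s - normalVel U ζ θ s‖ :=
        norm_sub_le_norm_sub_add_norm_sub _ _ _
    _ ≤ 4 * K * ‖ζ‖ * a + 2 * a * ‖ζ‖ := by
        refine add_le_add ?_ (norm_normalVel_sub_le hskew ζ θ θ' hs)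
        rw [← normalVel_sub, norm_normalVel hskew]
        exact hdist
    _ = (4 * K * ‖ζ‖ + 2 * ‖ζ‖) * a := by ring
    _ ≤ (4 * K * ‖ζ‖ + 2 * ‖ζ‖) * (‖opU U‖ * ‖θ' - θ‖) := by gcongr
    _ = _ := by ring

theorem refFun_eq {θ : EuclideanSpace ℝ (Fin m)} (hθ : θ ∈ goodSet U) (g : StepTwo q m) :
    refFun U g θ = inner ℝ g.1 (explicitVel U g.1 θ 0) + 4 * inner ℝ g.2 θ := by
  rw [refFun, UcotU_form hskew hθ]

/-- In `inner_initial_sub` the increment `θ' - θ` is already a factor. Replacing the velocity at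
`θ'` by that at `θ` thus costs a second-order error, so Lipschitz dependence suffices and no matrix
function is differentiated in `θ`. -/
theorem hasGradientAt_refFun {θ : EuclideanSpace ℝ (Fin m)} (hθ : θ ∈ goodSet U)
    (x : EuclideanSpace ℝ (Fin q)) (t : EuclideanSpace ℝ (Fin m)) :
    HasGradientAt (refFun U (x, t))
      ((4 : ℝ) • (t - (normalGeod U (explicitVel U x θ 0) θ 1).2)) θ := by
  obtain ⟨C, hC0, hC⟩ := exists_forall_norm_normalVel_sub_le hskew hθ x
  set ζ := explicitVel U x θ 0 with hζ
  obtain ⟨D, hD⟩ := isCompact_Icc.exists_bound_of_continuousOn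
    (continuous_normalPos U ζ θ).continuousOn (s := Set.Icc (0 : ℝ) 1)
  have hD0 : 0 ≤ D := (norm_nonneg _).trans (hD 0 (Set.left_mem_Icc.mpr zero_le_one))
  rw [hasGradientAt_iff_isLittleO, Asymptotics.isLittleO_iff]
  intro c hc
  have hsmall : ∀ᶠ θ' in nhds θ, 2 * (‖opU U‖ * D * C) * ‖θ' - θ‖ < c := by
    have hcont : Continuous fun θ' : EuclideanSpace ℝ (Fin m) =>
      2 * (‖opU U‖ * D * C) * ‖θ' - θ‖ := by fun_prop
    exact hcont.tendsto θ |>.eventually_lt_const (by simpa using hc)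
  filter_upwards [hC, hsmall] with θ' hθ' hs'
  obtain ⟨hgood, hlip⟩ := hθ'
  set ζ' := explicitVel U x θ' 0 with hζ'
  have hcont : ∀ η η', Continuous fun r =>
      pairingL U (normalPos U ζ θ r) (normalVel U η η' r) := fun η η' =>
    ((pairingL U).continuous.comp (continuous_normalPos U ζ θ)).clm_apply
      (continuous_normalVel U η η')
  have hint : ∀ η η', ∫ r in (0 : ℝ)..1,
      inner ℝ (pairingL U (normalPos U ζ θ r) (normalVel U η η' r)) (θ' - θ) =
      inner ℝ (∫ r in (0 : ℝ)..1, pairingL U (normalPos U ζ θ r) (normalVel U η η' r))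
        (θ' - θ) := fun η η' => by
    rw [real_inner_comm]
    simp_rw [real_inner_comm (θ' - θ)]
    exact (innerSL ℝ (θ' - θ)).intervalIntegral_comp_comm ((hcont η η').intervalIntegrable 0 1)
  have key : refFun U (x, t) θ' - refFun U (x, t) θ -
      inner ℝ ((4 : ℝ) • (t - (normalGeod U ζ θ 1).2)) (θ' - θ) =
      -2 * ∫ r in (0 : ℝ)..1, inner ℝ (opU U (θ' - θ) (normalPos U ζ θ r))
        (normalVel U ζ' θ' r - normalVel U ζ θ r) := by
    have h1 := inner_initial_sub hskew ζ ζ' θ θ' (x := x) (posMap_explicitVel hskew hθ x)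
      (posMap_explicitVel hskew hgood x)
    have h2 : ∫ r in (0 : ℝ)..1, inner ℝ (opU U (θ' - θ) (normalPos U ζ θ r))
        (normalVel U ζ' θ' r - normalVel U ζ θ r) =
        (∫ r in (0 : ℝ)..1, inner ℝ (pairingL U (normalPos U ζ θ r) (normalVel U ζ' θ' r))
          (θ' - θ)) -
        ∫ r in (0 : ℝ)..1, inner ℝ (pairingL U (normalPos U ζ θ r) (normalVel U ζ θ r))
          (θ' - θ) := by
      rw [← intervalIntegral.integral_sub
        (((hcont ζ' θ').inner continuous_const).intervalIntegrable _ _)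
        (((hcont ζ θ).inner continuous_const).intervalIntegrable _ _)]
      exact intervalIntegral.integral_congr fun r _ => by
        rw [inner_pairing, inner_pairing, inner_sub_right]
    rw [refFun_eq hskew hgood, refFun_eq hskew hθ, h2, mul_sub, ← h1, hint, normalGeod_snd]
    simp only [inner_smul_left, inner_sub_left, inner_sub_right]
    simp
    ring
  rw [key, norm_mul]
  have hb : ‖∫ r in (0 : ℝ)..1, inner ℝ (opU U (θ' - θ) (normalPos U ζ θ r))
        (normalVel U ζ' θ' r - normalVel U ζ θ r)‖ ≤
      (‖opU U‖ * ‖θ' - θ‖ * D) * (C * ‖θ' - θ‖) := by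
    refine (intervalIntegral.norm_integral_le_of_norm_le_const
      (C := (‖opU U‖ * ‖θ' - θ‖ * D) * (C * ‖θ' - θ‖)) fun r hr => ?_).trans_eq (by simp)
    rw [Set.uIoc_of_le zero_le_one] at hr
    have hr' : r ∈ Set.Icc (0 : ℝ) 1 := ⟨hr.1.le, hr.2⟩
    refine (norm_inner_le_norm _ _).trans (mul_le_mul ?_ (hlip r hr') (norm_nonneg _)
      (by positivity))
    exact (ContinuousLinearMap.le_opNorm _ _).trans
      (mul_le_mul ((opU U).le_opNorm _) (hD r hr') (norm_nonneg _) (by positivity))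
  calc ‖(-2 : ℝ)‖ * _ ≤ 2 * ((‖opU U‖ * ‖θ' - θ‖ * D) * (C * ‖θ' - θ‖)) := by
        rw [norm_neg, Real.norm_ofNat]; gcongr
    _ = 2 * (‖opU U‖ * D * C) * ‖θ' - θ‖ * ‖θ' - θ‖ := by ring
    _ ≤ c * ‖θ' - θ‖ := by gcongr

theorem isCriticalPt_iff {θ : EuclideanSpace ℝ (Fin m)} (hθ : θ ∈ goodSet U)
    (x : EuclideanSpace ℝ (Fin q)) (t : EuclideanSpace ℝ (Fin m)) :
    IsCriticalPt U (x, t) θ ↔ normalGeod U (explicitVel U x θ 0) θ 1 = (x, t) := by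
  have hgrad := hasGradientAt_refFun hskew hθ x t
  have hfst : (normalGeod U (explicitVel U x θ 0) θ 1).1 = x := posMap_explicitVel hskew hθ x
  constructor
  · intro h
    have h0 := h.unique hgrad
    rw [eq_comm, smul_eq_zero_iff_right (by norm_num), sub_eq_zero] at h0
    exact Prod.ext hfst h0.symm
  · intro h
    rw [h, sub_self, smul_zero] at hgrad
    exact hgrad

theorem refFun_of_isCriticalPt {θ : EuclideanSpace ℝ (Fin m)} (hθ : θ ∈ goodSet U)
    (g : StepTwo q m) (h : IsCriticalPt U g θ) :
    refFun U g θ = ‖explicitVel U g.1 θ 0‖ ^ 2 := by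
  have hg := (isCriticalPt_iff hskew hθ g.1 g.2).mp h
  have h1 := inner_normalGeod_snd hskew (explicitVel U g.1 θ 0) θ
  have h2 : normalPos U (explicitVel U g.1 θ 0) θ 1 = g.1 := congrArg Prod.fst hg
  rw [hg, h2, real_inner_comm g.1] at h1
  rw [refFun_eq hskew hθ, h1]
  ring

end EndpointMap

/-! ### Concatenation of horizontal curves and reachability of every point. -/

section HorizontalCurves

variable {q m : ℕ} {U : Fin m → Matrix (Fin q) (Fin q) ℝ} {γ : ℝ → StepTwo q m}
  {u : ℝ → EuclideanSpace ℝ (Fin q)}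

theorem IsHorizontal.continuousOn_fst (h : IsHorizontal U γ u) :
    ContinuousOn (fun s => (γ s).1) (Set.Icc 0 1) := by
  have h1 : ContinuousOn (fun s => (γ 0).1 + ∫ r in (0 : ℝ)..s, u r) (Set.Icc 0 1) := by
    refine continuousOn_const.add ?_
    have := intervalIntegral.continuousOn_primitive_interval (μ := volume) (f := u) (a := 0) (b := 1)
      (by
        rw [Set.uIcc_of_le zero_le_one]
        exact (intervalIntegrable_iff_integrableOn_Icc_of_le zero_le_one).mp h.integrable)
    rwa [Set.uIcc_of_le zero_le_one] at this
  exact h1.congr h.eq_fst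

theorem IsHorizontal.intervalIntegrable_pairing (h : IsHorizontal U γ u) (L :
    EuclideanSpace ℝ (Fin q) →L[ℝ] EuclideanSpace ℝ (Fin q) →L[ℝ] EuclideanSpace ℝ (Fin m)) :
    IntervalIntegrable (fun r => L (γ r).1 (u r)) volume 0 1 := by
  obtain ⟨C, hC⟩ := isCompact_Icc.exists_bound_of_continuousOn h.continuousOn_fst
  have hu := h.integrable
  rw [intervalIntegrable_iff_integrableOn_Icc_of_le zero_le_one] at hu ⊢
  have hm : AEStronglyMeasurable (fun s => (γ s).1) (volume.restrict (Set.Icc 0 1)) :=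
    h.continuousOn_fst.aestronglyMeasurable measurableSet_Icc
  refine Integrable.mono' (g := fun r => ‖L‖ * C * ‖u r‖) (hu.norm.const_mul _)
    (L.aestronglyMeasurable_comp₂ hm hu.aestronglyMeasurable) ?_
  filter_upwards [ae_restrict_mem measurableSet_Icc] with r hr
  refine (L.le_opNorm₂ _ _).trans ?_
  gcongr
  exact hC r hr

/-- Concatenation of two functions on `[0, 1]`, each run at double speed. -/
noncomputable def concatVel {V : Type*} [NormedAddCommGroup V] [NormedSpace ℝ V] (f g : ℝ → V)
    (s : ℝ) : V :=
  if s ≤ 1 / 2 then (2 : ℝ) • f (2 * s) else (2 : ℝ) • g (2 * s - 1)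

section Concat

variable {V : Type*} [NormedAddCommGroup V] [NormedSpace ℝ V] {f g : ℝ → V}

theorem integral_concatVel_left {s : ℝ} (hs : s ≤ 1 / 2) (h0 : 0 ≤ s) :
    ∫ r in (0 : ℝ)..s, concatVel f g r = ∫ r in (0 : ℝ)..(2 * s), f r := by
  have : ∫ r in (0 : ℝ)..s, concatVel f g r = ∫ r in (0 : ℝ)..s, (2 : ℝ) • f (2 * r) := by
    refine intervalIntegral.integral_congr fun r hr => ?_
    rw [Set.uIcc_of_le h0] at hr
    exact if_pos (hr.2.trans hs)
  rw [this, intervalIntegral.integral_smul, intervalIntegral.smul_integral_comp_mul_left, mul_zero]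

theorem integral_concatVel_right {s : ℝ} (hs : 1 / 2 ≤ s) :
    ∫ r in (1 / 2 : ℝ)..s, concatVel f g r = ∫ r in (0 : ℝ)..(2 * s - 1), g r := by
  have : ∫ r in (1 / 2 : ℝ)..s, concatVel f g r =
      ∫ r in (1 / 2 : ℝ)..s, (2 : ℝ) • g (2 * r - 1) := by
    refine intervalIntegral.integral_congr_ae (Filter.Eventually.of_forall fun r hr => ?_)
    rw [Set.uIoc_of_le hs] at hr
    exact if_neg (not_le.mpr hr.1)
  rw [this, intervalIntegral.integral_smul, intervalIntegral.smul_integral_comp_mul_sub]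
  norm_num

theorem intervalIntegrable_concatVel (hf : IntervalIntegrable f volume 0 1)
    (hg : IntervalIntegrable g volume 0 1) :
    IntervalIntegrable (concatVel f g) volume 0 (1 / 2) ∧
      IntervalIntegrable (concatVel f g) volume (1 / 2) 1 := by
  constructor
  · have h1 : IntervalIntegrable (fun r => (2 : ℝ) • f (2 * r)) volume 0 (1 / 2) := by
      have := (hf.comp_mul_left (c := 2)).smul (2 : ℝ)
      norm_num at this
      exact this
    refine h1.congr fun r hr => ?_
    rw [Set.uIoc_of_le (by norm_num)] at hr
    exact (if_pos hr.2).symm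
  · have h1 : IntervalIntegrable (fun r => (2 : ℝ) • g (2 * r - 1)) volume (1 / 2) 1 := by
      have h2 := (hg.comp_sub_right 1).comp_mul_left (c := 2)
      have h3 := h2.smul (2 : ℝ)
      norm_num at h3
      exact h3
    refine h1.congr fun r hr => ?_
    rw [Set.uIoc_of_le (by norm_num)] at hr
    exact (if_neg (not_le.mpr hr.1)).symm

theorem integral_concatVel (hf : IntervalIntegrable f volume 0 1)
    (hg : IntervalIntegrable g volume 0 1) {s : ℝ} (hs : s ∈ Set.Icc (1 / 2 : ℝ) 1) :
    ∫ r in (0 : ℝ)..s, concatVel f g r =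
      (∫ r in (0 : ℝ)..1, f r) + ∫ r in (0 : ℝ)..(2 * s - 1), g r := by
  obtain ⟨h1, h2⟩ := intervalIntegrable_concatVel hf hg
  rw [← intervalIntegral.integral_add_adjacent_intervals h1 (h2.mono_set
    (by rw [Set.uIcc_of_le hs.1, Set.uIcc_of_le (by norm_num)]; exact Set.Icc_subset_Icc_right hs.2)),
    integral_concatVel_left le_rfl (by norm_num), integral_concatVel_right hs.1]
  norm_num

end Concat

variable (U) in
/-- The set of endpoints of horizontal curves that start at the identity. -/
def reachable : Set (StepTwo q m) :=
  {g | ∃ (γ : ℝ → StepTwo q m) (u : ℝ → EuclideanSpace ℝ (Fin q)),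
    IsHorizontal U γ u ∧ γ 0 = 0 ∧ γ 1 = g}

/-- The second curve is left-translated by `g` and appended to the first; translation adds the term
`⟨𝕌 g.1, u₂⟩` to its central velocity. -/
theorem reachable_mul {g h : StepTwo q m} (hg : g ∈ reachable U) (hh : h ∈ reachable U) :
    (g.1 + h.1, g.2 + h.2 + (1 / 2 : ℝ) • pairingL U g.1 h.1) ∈ reachable U := by
  obtain ⟨γ₁, u₁, H₁, h₁0, h₁1⟩ := hg
  obtain ⟨γ₂, u₂, H₂, h₂0, h₂1⟩ := hh
  have p₁ := H₁.intervalIntegrable_pairing (pairingL U)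
  have p₂ := H₂.intervalIntegrable_pairing (pairingL U)
  have c₂ : IntervalIntegrable (fun r => pairingL U g.1 (u₂ r)) volume 0 1 :=
    ⟨(pairingL U g.1).integrable_comp H₂.integrable.1,
      (pairingL U g.1).integrable_comp H₂.integrable.2⟩
  let x : ℝ → EuclideanSpace ℝ (Fin q) := fun s => ∫ r in (0 : ℝ)..s, concatVel u₁ u₂ r
  let γ : ℝ → StepTwo q m := fun s =>
    (x s, (1 / 2 : ℝ) • ∫ r in (0 : ℝ)..s, pairing U (x r) (concatVel u₁ u₂ r))
  obtain ⟨i1, i2⟩ := intervalIntegrable_concatVel H₁.integrable H₂.integrable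
  have hx1 : ∀ s ∈ Set.Icc (0 : ℝ) (1 / 2), x s = (γ₁ (2 * s)).1 := fun s hs => by
    rw [H₁.eq_fst _ ⟨by linarith [hs.1], by linarith [hs.2]⟩, h₁0]
    simp only [x, integral_concatVel_left hs.2 hs.1, Prod.fst_zero, zero_add]
  have hg1 : ∫ r in (0 : ℝ)..1, u₁ r = g.1 := by
    rw [← h₁1, H₁.eq_fst 1 ⟨zero_le_one, le_rfl⟩, h₁0, Prod.fst_zero, zero_add]
  have hx2 : ∀ s ∈ Set.Icc (1 / 2 : ℝ) 1, x s = g.1 + (γ₂ (2 * s - 1)).1 := fun s hs => by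
    rw [H₂.eq_fst _ ⟨by linarith [hs.1], by linarith [hs.2]⟩, h₂0]
    simp only [x, integral_concatVel H₁.integrable H₂.integrable hs, Prod.fst_zero, zero_add, hg1]
  have hp : ∫ r in (0 : ℝ)..1, pairing U (x r) (concatVel u₁ u₂ r) = ∫ r in (0 : ℝ)..1,
      concatVel (fun r => pairingL U (γ₁ r).1 (u₁ r))
        (fun r => pairingL U g.1 (u₂ r) + pairingL U (γ₂ r).1 (u₂ r)) r := by
    refine intervalIntegral.integral_congr fun r hr => ?_
    rw [Set.uIcc_of_le zero_le_one] at hr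
    by_cases h : r ≤ 1 / 2
    · simp only [concatVel, if_pos h, hx1 r ⟨hr.1, h⟩, ← pairingL_apply, map_smul]
    · simp only [concatVel, if_neg h, hx2 r ⟨(not_le.mp h).le, hr.2⟩, ← pairingL_apply, map_smul,
        map_add, add_apply]
  refine ⟨γ, concatVel u₁ u₂, ⟨i1.trans i2, fun s _ => ?_, fun s _ => ?_⟩, ?_, ?_⟩
  · simp [γ, x]
  · simp [γ]
  · simp [γ, x]
  · refine Prod.ext ?_ ?_
    · have := hx2 1 (by norm_num)
      norm_num at this
      rw [← h₂1]; exact this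
    · change (1 / 2 : ℝ) • ∫ r in (0 : ℝ)..1, pairing U (x r) (concatVel u₁ u₂ r) = _
      have e1 : g.2 = (1 / 2 : ℝ) • ∫ r in (0 : ℝ)..1, pairingL U (γ₁ r).1 (u₁ r) := by
        rw [← h₁1, H₁.eq_snd 1 ⟨zero_le_one, le_rfl⟩, h₁0, Prod.snd_zero, zero_add]; rfl
      have e2 : h.2 = (1 / 2 : ℝ) • ∫ r in (0 : ℝ)..1, pairingL U (γ₂ r).1 (u₂ r) := by
        rw [← h₂1, H₂.eq_snd 1 ⟨zero_le_one, le_rfl⟩, h₂0, Prod.snd_zero, zero_add]; rfl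
      have e3 : ∫ r in (0 : ℝ)..1, pairingL U g.1 (u₂ r) = pairingL U g.1 h.1 := by
        rw [(pairingL U g.1).intervalIntegral_comp_comm H₂.integrable, ← h₂1,
          H₂.eq_fst 1 ⟨zero_le_one, le_rfl⟩, h₂0, Prod.fst_zero, zero_add]
      rw [hp, integral_concatVel p₁ (c₂.add p₂) (by norm_num), e1, e2, ← e3]
      norm_num
      rw [intervalIntegral.integral_add c₂ p₂]
      module

variable (hskew : ∀ j, (U j)ᵀ = -U j)
include hskew

theorem line_mem_reachable (x : EuclideanSpace ℝ (Fin q)) :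
    ((x, 0) : StepTwo q m) ∈ reachable U := by
  refine ⟨fun s => (s • x, 0), fun _ => x, ⟨by simp, fun s _ => by simp, fun s _ => ?_⟩,
    by simp, by simp⟩
  simp [← pairingL_apply, pairing_self hskew]

/-- The group commutator of two horizontal segments is central, and its two halves of the pairing
add up to the full one. -/
theorem commutator_mem_reachable (a b : EuclideanSpace ℝ (Fin q)) :
    ((0, pairingL U a b) : StepTwo q m) ∈ reachable U := by
  have h := reachable_mul (reachable_mul (reachable_mul (line_mem_reachable hskew a)
    (line_mem_reachable hskew b)) (line_mem_reachable hskew (-a))) (line_mem_reachable hskew (-b))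
  convert h using 2
  · simp
  · simp [pairing_self hskew, pairing_skew hskew b a]
    module

omit hskew in
theorem opU_injective (hlin : LinearIndependent ℝ U) : Function.Injective (opU U) := by
  refine (injective_iff_map_eq_zero _).mpr fun θ hθ => ?_
  rw [opU_eq, EmbeddingLike.map_eq_zero_iff] at hθ
  ext j
  exact Fintype.linearIndependent_iff.mp hlin _ hθ j

/-- A covector orthogonal to all pairings has `Ũ(θ) = 0`, hence vanishes by linear independence, so
commutators span the centre. -/
theorem reachable_eq_univ (hlin : LinearIndependent ℝ U) (g : StepTwo q m) :
    g ∈ reachable U := by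
  have hspan : Submodule.span ℝ (Set.range fun p : EuclideanSpace ℝ (Fin q) ×
      EuclideanSpace ℝ (Fin q) => pairingL U p.1 p.2) = ⊤ := by
    rw [← Submodule.orthogonal_eq_bot_iff, Submodule.eq_bot_iff]
    intro θ hθ
    apply opU_injective hlin
    rw [map_zero]
    ext1 a
    refine ext_inner_right ℝ fun b => ?_
    rw [← inner_pairing, zero_apply, inner_zero_left]
    exact (Submodule.mem_orthogonal _ _).mp hθ _ (Submodule.subset_span ⟨(a, b), rfl⟩)
  -- All multiples `c • t` are carried along so that the span induction passes through scalar
  -- multiplication.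
  have hcent : ∀ t : EuclideanSpace ℝ (Fin m), ∀ c : ℝ,
      ((0, c • t) : StepTwo q m) ∈ reachable U := fun t => by
    have ht : t ∈ Submodule.span ℝ (Set.range fun p : EuclideanSpace ℝ (Fin q) ×
      EuclideanSpace ℝ (Fin q) => pairingL U p.1 p.2) := hspan ▸ Submodule.mem_top
    induction ht using Submodule.span_induction with
    | mem t ht =>
      obtain ⟨p, rfl⟩ := ht
      intro c
      simpa using commutator_mem_reachable hskew (c • p.1) p.2
    | zero => intro c; simpa using line_mem_reachable (m := m) hskew 0
    | add t t' _ _ h h' =>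
      intro c
      simpa using reachable_mul (h c) (h' c)
    | smul a t _ h => intro c; rw [smul_smul]; exact h _
  simpa using reachable_mul (hcent g.2 1) (line_mem_reachable hskew g.1)

end HorizontalCurves

/-! ### Penalized energy of polygons and its first and second variations. -/

section Polygons

variable {q m : ℕ} (U : Fin m → Matrix (Fin q) (Fin q) ℝ)

/-- The central coordinate of the endpoint of the polygon with vertices `y 0, …, y N`. -/
noncomputable def polyArea (N : ℕ) (y : ℕ → EuclideanSpace ℝ (Fin q)) : EuclideanSpace ℝ (Fin m) :=
  (1 / 2 : ℝ) • ∑ k ∈ Finset.range N, pairingL U (y k) (y (k + 1))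

/-- The energy of the polygon with vertices `y 0, …, y N` with equal time steps. -/
noncomputable def polyEnergy (N : ℕ) (y : ℕ → EuclideanSpace ℝ (Fin q)) : ℝ :=
  N * ∑ k ∈ Finset.range N, ‖y (k + 1) - y k‖ ^ 2

/-- The polarization of `polyArea`. -/
noncomputable def polyPolar (N : ℕ) (y w : ℕ → EuclideanSpace ℝ (Fin q)) :
    EuclideanSpace ℝ (Fin m) :=
  (1 / 2 : ℝ) • ∑ k ∈ Finset.range N, (pairingL U (y k) (w (k + 1)) + pairingL U (w k) (y (k + 1)))

/-- The energy penalized by the distance of the central coordinate to a target. -/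
noncomputable def polyPenalty (N : ℕ) (p : ℝ) (t : EuclideanSpace ℝ (Fin m))
    (y : ℕ → EuclideanSpace ℝ (Fin q)) : ℝ :=
  polyEnergy N y + p * ‖polyArea U N y - t‖ ^ 2

theorem polyEnergy_nonneg (N : ℕ) (y : ℕ → EuclideanSpace ℝ (Fin q)) : 0 ≤ polyEnergy N y :=
  mul_nonneg N.cast_nonneg (Finset.sum_nonneg fun _ _ => by positivity)

theorem polyPenalty_nonneg (N : ℕ) {p : ℝ} (hp : 0 ≤ p) (t : EuclideanSpace ℝ (Fin m))
    (y : ℕ → EuclideanSpace ℝ (Fin q)) : 0 ≤ polyPenalty U N p t y :=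
  add_nonneg (polyEnergy_nonneg N y) (by positivity)

/-- Cauchy–Schwarz on the edge lengths; this is the coercivity needed for minimizers. -/
theorem norm_sq_le_polyEnergy {N : ℕ} {y : ℕ → EuclideanSpace ℝ (Fin q)} (h0 : y 0 = 0) {k : ℕ}
    (hk : k ≤ N) : ‖y k‖ ^ 2 ≤ polyEnergy N y := by
  have h1 : y k = ∑ i ∈ Finset.range k, (y (i + 1) - y i) := by
    rw [Finset.sum_range_sub, h0, sub_zero]
  have h2 : ‖y k‖ ≤ ∑ i ∈ Finset.range N, ‖y (i + 1) - y i‖ := by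
    rw [h1]
    refine (norm_sum_le _ _).trans (Finset.sum_le_sum_of_subset_of_nonneg ?_ fun _ _ _ =>
      norm_nonneg _)
    exact Finset.range_mono hk
  have h3 := sq_sum_le_card_mul_sum_sq (s := Finset.range N) (f := fun i => ‖y (i + 1) - y i‖)
  rw [Finset.card_range] at h3
  exact (pow_le_pow_left₀ (norm_nonneg _) h2 2).trans h3

theorem exists_polyPenalty_minimizer {N : ℕ} {p : ℝ} (hp : 0 ≤ p) (x : EuclideanSpace ℝ (Fin q))
    (t : EuclideanSpace ℝ (Fin m)) {c : ℕ → EuclideanSpace ℝ (Fin q)} (hc0 : c 0 = 0)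
    (hcN : c N = x) :
    ∃ y : ℕ → EuclideanSpace ℝ (Fin q), y 0 = 0 ∧ y N = x ∧ ∀ y', y' 0 = 0 → y' N = x →
      polyPenalty U N p t y ≤ polyPenalty U N p t y' := by
  -- The added 1 ensures that the competitor's value is at most `R ^ 2`.
  set R := polyPenalty U N p t c + 1 with hR
  have hJ0 := polyPenalty_nonneg U N hp t c
  let K : Set (ℕ → EuclideanSpace ℝ (Fin q)) :=
    (Set.univ.pi fun _ => Metric.closedBall 0 R) ∩ {y | y 0 = 0 ∧ y N = x}
  have hK : IsCompact K := by
    refine (isCompact_univ_pi fun _ => isCompact_closedBall 0 R).inter_right ?_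
    exact (isClosed_eq (continuous_apply 0) continuous_const).inter
      (isClosed_eq (continuous_apply N) continuous_const)
  -- Vertices beyond `N` do not enter the functional; setting them to zero makes sublevel sets fit
  -- in a compact product.
  let tr : (ℕ → EuclideanSpace ℝ (Fin q)) → ℕ → EuclideanSpace ℝ (Fin q) :=
    fun y k => if k ≤ N then y k else 0
  have htr : ∀ y, polyPenalty U N p t (tr y) = polyPenalty U N p t y := fun y => by
    have e1 : ∀ k ∈ Finset.range N, tr y k = y k := fun k hk =>
      if_pos (Finset.mem_range.mp hk).le
    have e2 : ∀ k ∈ Finset.range N, tr y (k + 1) = y (k + 1) := fun k hk =>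
      if_pos (Finset.mem_range.mp hk)
    unfold polyPenalty polyEnergy polyArea
    congr 1
    · congr 1
      exact Finset.sum_congr rfl fun k hk => by rw [e1 k hk, e2 k hk]
    · congr 5
      exact Finset.sum_congr rfl fun k hk => by rw [e1 k hk, e2 k hk]
  have hmem : ∀ y, y 0 = 0 → y N = x → polyPenalty U N p t y ≤ polyPenalty U N p t c →
      tr y ∈ K := fun y h0 hN hle => by
    refine ⟨fun k _ => ?_, by simp [tr, h0], by simp [tr, hN]⟩
    by_cases hk : k ≤ N
    · have h1 : ‖y k‖ ^ 2 ≤ R ^ 2 := by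
        have h2 : polyEnergy N y ≤ polyPenalty U N p t y := le_add_of_nonneg_right (by positivity)
        have := norm_sq_le_polyEnergy h0 hk
        nlinarith
      simpa [tr, hk] using (pow_le_pow_iff_left₀ (norm_nonneg _) (by positivity) two_ne_zero).mp h1
    · simp [tr, hk]; positivity
  have hcont : Continuous (polyPenalty U N p t) := by
    unfold polyPenalty polyEnergy polyArea
    have : ∀ k, Continuous fun y : ℕ → EuclideanSpace ℝ (Fin q) => pairingL U (y k) (y (k + 1)) :=
      fun k => ((pairingL U).continuous.comp (continuous_apply k)).clm_apply (continuous_apply _)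
    fun_prop
  obtain ⟨y, hyK, hy⟩ := hK.exists_isMinOn ⟨_, hmem c hc0 hcN le_rfl⟩ hcont.continuousOn
  refine ⟨y, hyK.2.1, hyK.2.2, fun y' h0 hN => ?_⟩
  rcases le_total (polyPenalty U N p t y') (polyPenalty U N p t c) with h | h
  · rw [← htr y']; exact hy (hmem y' h0 hN h)
  · refine le_trans ?_ h
    rw [← htr c]; exact hy (hmem c hc0 hcN le_rfl)

theorem quartic_nonneg {a b c d : ℝ} (h : ∀ e : ℝ, 0 ≤ a * e + b * e ^ 2 + c * e ^ 3 + d * e ^ 4) :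
    a = 0 ∧ 0 ≤ b := by
  have ha : a = 0 := by
    have hd : HasDerivAt (fun e : ℝ => a * e + b * e ^ 2 + c * e ^ 3 + d * e ^ 4) a 0 := by
      have h1 := (((hasDerivAt_id (0 : ℝ)).const_mul a).fun_add
        ((hasDerivAt_pow 2 (0 : ℝ)).const_mul b)).fun_add ((hasDerivAt_pow 3 (0 : ℝ)).const_mul c)
      exact (h1.fun_add ((hasDerivAt_pow 4 (0 : ℝ)).const_mul d)).congr_deriv (by simp)
    refine IsLocalMin.hasDerivAt_eq_zero (Filter.Eventually.of_forall fun e => ?_) hd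
    simpa using h e
  refine ⟨ha, ?_⟩
  have ht : Filter.Tendsto (fun e : ℝ => b + c * e + d * e ^ 2) (nhdsWithin 0 (Set.Ioi 0))
      (nhds b) := by
    have : Continuous fun e : ℝ => b + c * e + d * e ^ 2 := by fun_prop
    simpa using (this.tendsto 0).mono_left nhdsWithin_le_nhds
  refine ge_of_tendsto ht (eventually_nhdsWithin_of_forall fun e (he : 0 < e) => ?_)
  have h1 := h e
  rw [ha] at h1
  have h2 : 0 ≤ e ^ 2 * (b + c * e + d * e ^ 2) := by linarith
  exact nonneg_of_mul_nonneg_right h2 (by positivity)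

theorem polyArea_add_smul (N : ℕ) (y w : ℕ → EuclideanSpace ℝ (Fin q)) (e : ℝ) :
    polyArea U N (fun k => y k + e • w k) =
      polyArea U N y + e • polyPolar U N y w + e ^ 2 • polyArea U N w := by
  simp only [polyArea, polyPolar, smul_comm e, smul_comm (e ^ 2), ← smul_add, Finset.smul_sum,
    ← Finset.sum_add_distrib]
  refine Finset.sum_congr rfl fun k _ => ?_
  congr 1
  simp only [map_add, map_smul, add_apply, smul_apply]
  module

theorem polyEnergy_add_smul (N : ℕ) (y w : ℕ → EuclideanSpace ℝ (Fin q)) (e : ℝ) :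
    polyEnergy N (fun k => y k + e • w k) = polyEnergy N y +
      2 * e * (N * ∑ k ∈ Finset.range N, inner ℝ (y (k + 1) - y k) (w (k + 1) - w k)) +
      e ^ 2 * polyEnergy N w := by
  have : ∀ k, ‖y (k + 1) + e • w (k + 1) - (y k + e • w k)‖ ^ 2 = ‖y (k + 1) - y k‖ ^ 2 +
      2 * e * inner ℝ (y (k + 1) - y k) (w (k + 1) - w k) +
      e ^ 2 * ‖w (k + 1) - w k‖ ^ 2 := fun k => by
    have h : y (k + 1) + e • w (k + 1) - (y k + e • w k) =
        (y (k + 1) - y k) + e • (w (k + 1) - w k) := by module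
    rw [h, norm_add_sq_real, inner_smul_right, norm_smul, mul_pow, Real.norm_eq_abs, sq_abs]
    ring
  simp only [polyEnergy, this, Finset.sum_add_distrib, ← Finset.mul_sum]
  ring

/-- First and second order conditions at a minimizer of the penalized energy. -/
theorem polyPenalty_minimizer_variation {N : ℕ} {p : ℝ} {t : EuclideanSpace ℝ (Fin m)}
    {y : ℕ → EuclideanSpace ℝ (Fin q)}
    (hmin : ∀ y', y' 0 = y 0 → y' N = y N → polyPenalty U N p t y ≤ polyPenalty U N p t y')
    {w : ℕ → EuclideanSpace ℝ (Fin q)} (hw0 : w 0 = 0) (hwN : w N = 0) :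
    N * ∑ k ∈ Finset.range N, inner ℝ (y (k + 1) - y k) (w (k + 1) - w k) =
      inner ℝ (polyPolar U N y w) (p • (t - polyArea U N y)) ∧
    (polyPolar U N y w = 0 →
      2 * inner ℝ (polyArea U N w) (p • (t - polyArea U N y)) ≤ polyEnergy N w) := by
  set D := N * ∑ k ∈ Finset.range N, inner ℝ (y (k + 1) - y k) (w (k + 1) - w k) with hD
  set B := polyPolar U N y w with hB
  set T := polyArea U N w with hT
  set a := polyArea U N y - t with ha
  have hθ : p • (t - polyArea U N y) = -(p • a) := by rw [ha, ← smul_neg, neg_sub]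
  -- The penalized energy along `y + e w` is a quartic polynomial in `e`, minimal at `e = 0`.
  have key : ∀ e : ℝ, 0 ≤ (2 * D + 2 * p * inner ℝ B a) * e +
      (polyEnergy N w + p * ‖B‖ ^ 2 + 2 * p * inner ℝ T a) * e ^ 2 +
      (2 * p * inner ℝ B T) * e ^ 3 + (p * ‖T‖ ^ 2) * e ^ 4 := fun e => by
    have h := hmin (fun k => y k + e • w k) (by simp [hw0]) (by simp [hwN])
    have h1 : polyArea U N (fun k => y k + e • w k) - t = a + e • B + e ^ 2 • T := by
      rw [polyArea_add_smul]; simp only [ha]; abel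
    have h2 : ‖a + e • B + e ^ 2 • T‖ ^ 2 = ‖a‖ ^ 2 + e ^ 2 * ‖B‖ ^ 2 + e ^ 4 * ‖T‖ ^ 2 +
        2 * e * inner ℝ B a + 2 * e ^ 2 * inner ℝ T a + 2 * e ^ 3 * inner ℝ B T := by
      rw [norm_add_sq_real, norm_add_sq_real, inner_add_left]
      simp only [inner_smul_left, inner_smul_right, norm_smul, mul_pow, Real.norm_eq_abs, sq_abs,
        real_inner_comm a, conj_trivial, abs_pow]
      ring
    rw [polyPenalty, polyPenalty, polyEnergy_add_smul, h1, h2, ← ha] at h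
    simp only [← hD] at h
    linarith
  obtain ⟨h1, h2⟩ := quartic_nonneg key
  rw [hθ, inner_neg_right, inner_neg_right, inner_smul_right, inner_smul_right]
  refine ⟨by linarith, fun hB0 => ?_⟩
  -- When the polarization vanishes, the term `p * ‖B‖ ^ 2` disappears, so the second-order
  -- condition involves `p` only through the multiplier.
  rw [hB0, norm_zero] at h2
  linarith

variable {U} (hskew : ∀ j, (U j)ᵀ = -U j)
include hskew

/-- The discrete Euler equation. -/
theorem polyPenalty_minimizer_euler {N : ℕ} {p : ℝ} {t : EuclideanSpace ℝ (Fin m)}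
    {y : ℕ → EuclideanSpace ℝ (Fin q)}
    (hmin : ∀ y', y' 0 = y 0 → y' N = y N → polyPenalty U N p t y ≤ polyPenalty U N p t y')
    {i : ℕ} (hi : i + 1 < N) :
    (N : ℝ) • ((y (i + 2) - y (i + 1)) - (y (i + 1) - y i)) =
      (1 / 2 : ℝ) • opU U (p • (t - polyArea U N y))
        ((y (i + 1) - y i) + (y (i + 2) - y (i + 1))) := by
  refine ext_inner_right ℝ fun z => ?_
  set θ := p • (t - polyArea U N y) with hθ
  let w : ℕ → EuclideanSpace ℝ (Fin q) := fun k => if k = i + 1 then z else 0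
  have hw : ∀ k, k ≠ i + 1 → w k = 0 := fun k hk => if_neg hk
  have hwi : w (i + 1) = z := if_pos rfl
  have h := (polyPenalty_minimizer_variation U hmin (hw 0 (by omega)) (hw N (by omega))).1
  -- Moving only the vertex `i + 1` affects just the two edges meeting there.
  have hs : ∀ {V : Type} [AddCommGroup V] (f : ℕ → V), (∀ k, k ≠ i → k ≠ i + 1 → f k = 0) →
      ∑ k ∈ Finset.range N, f k = f i + f (i + 1) := fun f hf =>
    Finset.sum_eq_add_of_mem i (i + 1) (Finset.mem_range.mpr (by omega))
      (Finset.mem_range.mpr hi) (by omega) fun k _ hk => hf k hk.1 hk.2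
  rw [polyPolar, hs, hs] at h
  · simp only [hwi, hw i (by omega), hw (i + 1 + 1) (by omega), map_zero, zero_apply, add_zero,
      zero_add, sub_zero, zero_sub, inner_neg_right, ← hθ, inner_smul_left, inner_add_left,
      inner_pairing] at h
    rw [opU_skew hskew θ z, real_inner_comm (opU U θ (y (i + 1 + 1)))] at h
    simp only [inner_smul_left, map_sub, map_add, inner_sub_left, inner_add_left,
      conj_trivial] at h ⊢
    linarith
  · intro k h1 h2
    rw [hw k h2, hw (k + 1) (by omega), map_zero, map_zero, zero_apply, add_zero]
  · intro k h1 h2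
    rw [hw k h2, hw (k + 1) (by omega), sub_zero, inner_zero_right]

end Polygons

/-! ### Subdivided polygons and chains of triangles. -/

section Refinement

theorem sum_range_mul_eq {V : Type*} [AddCommMonoid V] (R r : ℕ) (f : ℕ → V) :
    ∑ k ∈ Finset.range (R * r), f k =
      ∑ b ∈ Finset.range R, ∑ j ∈ Finset.range r, f (b * r + j) := by
  induction R with
  | zero => simp
  | succ R ih => rw [Nat.succ_mul, Finset.sum_range_add, ih, Finset.sum_range_succ]

variable {E : Type*} [AddCommGroup E] [Module ℝ E]

/-- The polygon with vertices `W 0, W 1, …`, each edge of which is divided into `r` equal parts. -/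
noncomputable def subdivide (r : ℕ) (W : ℕ → E) (k : ℕ) : E :=
  W (k / r) + ((k % r : ℕ) / r : ℝ) • (W (k / r + 1) - W (k / r))

/-- The endpoint `j = r` is included, although integer division then moves to the next block;
consecutive vertices can thus be treated within one block. -/
theorem subdivide_apply {r : ℕ} (hr : 0 < r) (W : ℕ → E) (b : ℕ) {j : ℕ} (hj : j ≤ r) :
    subdivide r W (b * r + j) = W b + (j / r : ℝ) • (W (b + 1) - W b) := by
  have hr' : (r : ℝ) ≠ 0 := Nat.cast_ne_zero.mpr hr.ne'
  rcases hj.lt_or_eq with h | rfl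
  · have h1 : (b * r + j) / r = b := by
      rw [mul_comm, Nat.mul_add_div hr, Nat.div_eq_of_lt h, add_zero]
    have h2 : (b * r + j) % r = j := by
      rw [mul_comm, Nat.mul_add_mod, Nat.mod_eq_of_lt h]
    rw [subdivide, h1, h2]
  · have h1 : (b * j + j) / j = b + 1 := by rw [← Nat.succ_mul, Nat.mul_div_cancel _ hr]
    have h2 : (b * j + j) % j = 0 := by rw [← Nat.succ_mul, Nat.mul_mod_left]
    rw [subdivide, h1, h2, div_self hr']
    simp

/-- A chain of triangles with vertices `0`, `c b • a`, `c b • a'`. -/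
def triangles (n : ℕ) (c : Fin (n + 1) → ℝ) (a a' : E) (k : ℕ) : E :=
  c (Fin.ofNat (n + 1) (k / 3)) • if k % 3 = 1 then a else if k % 3 = 2 then a' else 0

theorem triangles_apply (n : ℕ) (c : Fin (n + 1) → ℝ) (a a' : E) (b : ℕ) :
    triangles n c a a' (b * 3) = 0 ∧
      triangles n c a a' (b * 3 + 1) = c (Fin.ofNat (n + 1) b) • a ∧
      triangles n c a a' (b * 3 + 2) = c (Fin.ofNat (n + 1) b) • a' ∧
      triangles n c a a' (b * 3 + 3) = 0 := by
  have h1 : (b * 3 + 1) / 3 = b := by omega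
  have h2 : (b * 3 + 2) / 3 = b := by omega
  have h3 : (b * 3 + 1) % 3 = 1 := by omega
  have h4 : (b * 3 + 2) % 3 = 2 := by omega
  have h5 : (b * 3 + 3) % 3 = 0 := by omega
  refine ⟨by simp [triangles], ?_, ?_, ?_⟩
  · rw [triangles, h1, h3]; simp
  · rw [triangles, h2, h4]; simp
  · rw [triangles, h5]; simp

theorem subdivide_triangles_add (n r : ℕ) (c c' : Fin (n + 1) → ℝ) (a a' : E) (k : ℕ) :
    subdivide r (triangles n (c + c') a a') k =
      subdivide r (triangles n c a a') k + subdivide r (triangles n c' a a') k := by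
  simp only [subdivide, triangles, Pi.add_apply]
  module

theorem subdivide_triangles_smul (n r : ℕ) (e : ℝ) (c : Fin (n + 1) → ℝ) (a a' : E) (k : ℕ) :
    subdivide r (triangles n (e • c) a a') k = e • subdivide r (triangles n c a a') k := by
  simp only [subdivide, triangles, Pi.smul_apply, smul_eq_mul]
  module

end Refinement

/-! ### The uniform bound for the multiplier. -/

section MultiplierBound

variable {q m : ℕ} (U : Fin m → Matrix (Fin q) (Fin q) ℝ)

/-- The factor `N` in the energy compensates for cutting edges. Together with `polyArea_subdivide`
this keeps the test variations independent of the mesh. -/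
theorem polyEnergy_subdivide {r : ℕ} (hr : 0 < r) (R : ℕ) (W : ℕ → EuclideanSpace ℝ (Fin q)) :
    polyEnergy (R * r) (subdivide r W) = polyEnergy R W := by
  have hr' : (r : ℝ) ≠ 0 := Nat.cast_ne_zero.mpr hr.ne'
  rw [polyEnergy, sum_range_mul_eq, polyEnergy, Nat.cast_mul, mul_assoc, Finset.mul_sum]
  congr 1
  refine Finset.sum_congr rfl fun b _ => ?_
  have : ∀ j ∈ Finset.range r, ‖subdivide r W (b * r + j + 1) - subdivide r W (b * r + j)‖ ^ 2 =
      (1 / r : ℝ) ^ 2 * ‖W (b + 1) - W b‖ ^ 2 := fun j hj => by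
    have hj' := Finset.mem_range.mp hj
    rw [add_assoc, subdivide_apply hr W b hj', subdivide_apply hr W b hj'.le, add_sub_add_left_eq_sub,
      ← sub_smul, norm_smul, mul_pow, Real.norm_eq_abs, sq_abs]
    congr 2
    push_cast
    ring
  rw [Finset.sum_congr rfl this, Finset.sum_const, Finset.card_range, nsmul_eq_mul]
  field_simp

theorem polyEnergy_triangles (n : ℕ) (c : Fin (n + 1) → ℝ) (a a' : EuclideanSpace ℝ (Fin q)) :
    polyEnergy ((n + 1) * 3) (triangles n c a a') = ((n + 1) * 3 : ℕ) *
      ((∑ b ∈ Finset.range (n + 1), c (Fin.ofNat (n + 1) b) ^ 2) *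
        (‖a‖ ^ 2 + ‖a' - a‖ ^ 2 + ‖a'‖ ^ 2)) := by
  rw [polyEnergy, sum_range_mul_eq, Finset.sum_mul]
  congr 1
  refine Finset.sum_congr rfl fun b _ => ?_
  obtain ⟨h0, h1, h2, h3⟩ := triangles_apply n c a a' b
  simp only [Finset.sum_range_succ, Finset.sum_range_zero, zero_add, add_zero, add_assoc,
    Nat.reduceAdd, h0, h1, h2, h3, sub_zero, zero_sub, norm_neg, ← smul_sub, norm_smul, mul_pow,
    Real.norm_eq_abs, sq_abs]
  ring

/-- The polarization against refined triangles, as a linear map in the sizes of the triangles. -/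
noncomputable def polarTriangles (N n r : ℕ) (y : ℕ → EuclideanSpace ℝ (Fin q))
    (a a' : EuclideanSpace ℝ (Fin q)) : (Fin (n + 1) → ℝ) →ₗ[ℝ] EuclideanSpace ℝ (Fin m) where
  toFun c := polyPolar U N y (subdivide r (triangles n c a a'))
  map_add' c c' := by
    simp only [polyPolar, subdivide_triangles_add, ← smul_add, ← Finset.sum_add_distrib, map_add,
      add_apply]
    congr 1
    exact Finset.sum_congr rfl fun k _ => by abel
  map_smul' e c := by
    simp only [polyPolar, subdivide_triangles_smul, map_smul, smul_apply, ← smul_add,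
      ← Finset.smul_sum, RingHom.id_apply]
    rw [smul_comm]

variable {U} (hskew : ∀ j, (U j)ᵀ = -U j)
include hskew

/-- By skewness, each of the `r` consecutive pairs on an edge contributes the fraction `1 / r` of
the pairing of its ends. -/
theorem polyArea_subdivide {r : ℕ} (hr : 0 < r) (R : ℕ) (W : ℕ → EuclideanSpace ℝ (Fin q)) :
    polyArea U (R * r) (subdivide r W) = polyArea U R W := by
  have hr' : (r : ℝ) ≠ 0 := Nat.cast_ne_zero.mpr hr.ne'
  rw [polyArea, sum_range_mul_eq, polyArea]
  congr 1
  refine Finset.sum_congr rfl fun b _ => ?_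
  have : ∀ j ∈ Finset.range r,
      pairingL U (subdivide r W (b * r + j)) (subdivide r W (b * r + j + 1)) =
      (1 / r : ℝ) • pairingL U (W b) (W (b + 1)) := fun j hj => by
    have hj' := Finset.mem_range.mp hj
    rw [add_assoc, subdivide_apply hr W b hj', subdivide_apply hr W b hj'.le]
    simp only [map_add, map_smul, map_sub, add_apply, smul_apply, sub_apply, pairing_self hskew,
      pairing_skew hskew (W (b + 1)) (W b)]
    push_cast
    module
  rw [Finset.sum_congr rfl this, Finset.sum_const, Finset.card_range, ← Nat.cast_smul_eq_nsmul ℝ,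
    smul_smul, mul_one_div_cancel hr', one_smul]

omit hskew in
theorem polyArea_triangles (n : ℕ) (c : Fin (n + 1) → ℝ) (a a' : EuclideanSpace ℝ (Fin q)) :
    polyArea U ((n + 1) * 3) (triangles n c a a') =
      (1 / 2 * ∑ b ∈ Finset.range (n + 1), c (Fin.ofNat (n + 1) b) ^ 2) • pairingL U a a' := by
  rw [polyArea, sum_range_mul_eq, mul_smul, Finset.sum_smul]
  congr 1
  refine Finset.sum_congr rfl fun b _ => ?_
  obtain ⟨h0, h1, h2, h3⟩ := triangles_apply n c a a' b
  simp only [Finset.sum_range_succ, Finset.sum_range_zero, zero_add, add_zero, add_assoc,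
    Nat.reduceAdd, h0, h1, h2, h3, map_zero, zero_apply, map_smul, smul_apply, smul_smul, sq,
    smul_zero, zero_add]

/-- The variation consists of triangles `0, c a, c a'` with zero polarization. Energy and area are
both proportional to the same positive sum of the `c²`, which is divided out of the second-order
condition. -/
theorem inner_multiplier_le {r : ℕ} (hr : 0 < r) {p : ℝ} {t : EuclideanSpace ℝ (Fin m)}
    {y : ℕ → EuclideanSpace ℝ (Fin q)}
    (hmin : ∀ y', y' 0 = y 0 → y' ((m + 1) * 3 * r) = y ((m + 1) * 3 * r) →
      polyPenalty U ((m + 1) * 3 * r) p t y ≤ polyPenalty U ((m + 1) * 3 * r) p t y')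
    (a a' : EuclideanSpace ℝ (Fin q)) :
    inner ℝ (opU U (p • (t - polyArea U ((m + 1) * 3 * r) y)) a) a' ≤
      ((m + 1) * 3 : ℕ) * (‖a‖ ^ 2 + ‖a' - a‖ ^ 2 + ‖a'‖ ^ 2) := by
  -- There are `m + 1` triangle sizes and `m` linear conditions, hence a nonzero solution.
  obtain ⟨c, hc, hc0⟩ := Submodule.exists_mem_ne_zero_of_ne_bot
    (LinearMap.ker_ne_bot_of_finrank_lt
      (f := polarTriangles U ((m + 1) * 3 * r) m r y a a') (by simp))
  set w := subdivide r (triangles m c a a') with hw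
  have hB : polyPolar U ((m + 1) * 3 * r) y w = 0 := hc
  have hw0 : w 0 = 0 := by
    have := subdivide_apply hr (triangles m c a a') 0 (Nat.zero_le r)
    simpa [(triangles_apply m c a a' 0).1, triangles] using this
  have hwN : w ((m + 1) * 3 * r) = 0 := by
    have := subdivide_apply hr (triangles m c a a') ((m + 1) * 3) (Nat.zero_le r)
    simpa [(triangles_apply m c a a' (m + 1)).1] using this
  have h := (polyPenalty_minimizer_variation U hmin hw0 hwN).2 hB
  rw [hw, polyArea_subdivide hskew hr, polyEnergy_subdivide hr, polyArea_triangles,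
    polyEnergy_triangles, inner_smul_left, inner_pairing] at h
  have hpos : 0 < ∑ b ∈ Finset.range (m + 1), c (Fin.ofNat (m + 1) b) ^ 2 := by
    obtain ⟨i, hi⟩ := Function.ne_iff.mp hc0
    refine Finset.sum_pos' (fun _ _ => sq_nonneg _) ⟨i, Finset.mem_range.mpr i.2, ?_⟩
    have : Fin.ofNat (m + 1) (i : ℕ) = i := Fin.ext (Nat.mod_eq_of_lt i.2)
    rw [this]
    exact sq_pos_iff.mpr hi
  set S := ∑ b ∈ Finset.range (m + 1), c (Fin.ofNat (m + 1) b) ^ 2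
  simp only [conj_trivial] at h
  refine le_of_mul_le_mul_left ?_ hpos
  linarith

/-- The constant depends on neither mesh, penalty nor target; this is what gives compactness of the
multipliers. -/
theorem exists_multiplier_bound (hlin : LinearIndependent ℝ U) : ∃ C : ℝ, ∀ (r : ℕ), 0 < r →
    ∀ (p : ℝ) (t : EuclideanSpace ℝ (Fin m)) (y : ℕ → EuclideanSpace ℝ (Fin q)),
    (∀ y', y' 0 = y 0 → y' ((m + 1) * 3 * r) = y ((m + 1) * 3 * r) →
      polyPenalty U ((m + 1) * 3 * r) p t y ≤ polyPenalty U ((m + 1) * 3 * r) p t y') →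
    ‖p • (t - polyArea U ((m + 1) * 3 * r) y)‖ ≤ C := by
  obtain ⟨K, hK0, hK⟩ := (opU U).toLinearMap.exists_antilipschitzWith
    (LinearMap.ker_eq_bot.mpr (opU_injective hlin))
  refine ⟨K * (((m + 1) * 3 : ℕ) * 6), fun r hr p t y hmin => ?_⟩
  set θ := p • (t - polyArea U ((m + 1) * 3 * r) y) with hθ
  have h1 : ‖opU U θ‖ ≤ ((m + 1) * 3 : ℕ) * 6 := by
    refine ContinuousLinearMap.opNorm_le_of_unit_norm (by positivity) fun a ha => ?_
    by_cases hb : opU U θ a = 0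
    · rw [hb, norm_zero]; positivity
    have hb' : ‖opU U θ a‖ ≠ 0 := norm_ne_zero_iff.mpr hb
    -- Testing against the unit vector along `Ũ(θ) a` recovers the operator norm; the squared sides
    -- of the triangle are then at most 1, 4 and 1, whence the factor 6.
    have h := inner_multiplier_le hskew hr hmin a ((‖opU U θ a‖)⁻¹ • opU U θ a)
    have hn : ‖(‖opU U θ a‖)⁻¹ • opU U θ a‖ = 1 := norm_smul_inv_norm hb
    rw [← hθ, inner_smul_right, real_inner_self_eq_norm_sq, ha, hn] at h
    have hsub := norm_sub_le ((‖opU U θ a‖)⁻¹ • opU U θ a) a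
    rw [ha, hn] at hsub
    have h2 : ‖(‖opU U θ a‖)⁻¹ • opU U θ a - a‖ ^ 2 ≤ 4 := by
      nlinarith [norm_nonneg ((‖opU U θ a‖)⁻¹ • opU U θ a - a)]
    calc ‖opU U θ a‖ = ‖opU U θ a‖⁻¹ * ‖opU U θ a‖ ^ 2 := by field_simp
      _ ≤ _ := h
      _ ≤ ((m + 1) * 3 : ℕ) * 6 := by
        refine mul_le_mul_of_nonneg_left ?_ (Nat.cast_nonneg _)
        linarith
  have h2 : ‖θ‖ ≤ K * ‖opU U θ‖ := by simpa using hK.le_mul_dist θ 0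
  exact h2.trans (by gcongr)

end MultiplierBound

/-! ### Approximation of horizontal curves by polygons. -/

section InscribedPolygons

variable {q m : ℕ} {U : Fin m → Matrix (Fin q) (Fin q) ℝ} {γ : ℝ → StepTwo q m}
  {u : ℝ → EuclideanSpace ℝ (Fin q)}

/-- A partition of `[0, 1]` into `N` intervals on each of which `‖u‖` has integral at most `L / N`. -/
theorem exists_equidistributed_partition (hu : IntervalIntegrable u volume 0 1) {L : ℝ}
    (hL : horLength u < L) {N : ℕ} (hN : 0 < N) :
    ∃ s : ℕ → ℝ, s 0 = 0 ∧ s N = 1 ∧ (∀ k ≤ N, s k ∈ Set.Icc (0 : ℝ) 1) ∧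
      (∀ k < N, s k ≤ s (k + 1)) ∧ ∀ k < N, ∫ r in (s k)..(s (k + 1)), ‖u r‖ ≤ L / N := by
  set δ := L - horLength u with hδ
  have hδ0 : 0 < δ := sub_pos.mpr hL
  have hlen0 : 0 ≤ horLength u :=
    intervalIntegral.integral_nonneg zero_le_one fun _ _ => norm_nonneg _
  have hL0 : 0 < L := hlen0.trans_lt hL
  have hN' : (0 : ℝ) < N := Nat.cast_pos.mpr hN
  have hsub : ∀ {a b : ℝ}, a ∈ Set.Icc (0 : ℝ) 1 → b ∈ Set.Icc (0 : ℝ) 1 →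
      IntervalIntegrable (fun r => ‖u r‖) volume a b := fun ha hb =>
    hu.norm.mono_set (by
      rw [Set.uIcc_of_le zero_le_one]; exact Set.uIcc_subset_Icc ha hb)
  -- The slack `δ` makes `σ` strictly increasing with total increment `L`, even where `u` vanishes;
  -- its level points give the partition.
  let σ : ℝ → ℝ := fun s => (∫ r in (0 : ℝ)..s, ‖u r‖) + δ * s
  have hσc : ContinuousOn σ (Set.Icc 0 1) := by
    have := intervalIntegral.continuousOn_primitive_interval (μ := volume)
      (f := fun r => ‖u r‖) (a := 0) (b := 1) (by
        rw [Set.uIcc_of_le zero_le_one]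
        exact (intervalIntegrable_iff_integrableOn_Icc_of_le zero_le_one).mp hu.norm)
    rw [Set.uIcc_of_le zero_le_one] at this
    exact this.add (continuous_const.mul continuous_id).continuousOn
  have h0 : (0 : ℝ) ∈ Set.Icc (0 : ℝ) 1 := Set.left_mem_Icc.mpr zero_le_one
  have h1 : (1 : ℝ) ∈ Set.Icc (0 : ℝ) 1 := Set.right_mem_Icc.mpr zero_le_one
  have hσ0 : σ 0 = 0 := by simp [σ]
  have hσ1 : σ 1 = L := by
    simp only [σ, hδ, mul_one]
    change horLength u + (L - horLength u) = L
    ring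
  have hσd : ∀ {a b : ℝ}, a ∈ Set.Icc (0 : ℝ) 1 → b ∈ Set.Icc (0 : ℝ) 1 →
      σ b - σ a = (∫ r in a..b, ‖u r‖) + δ * (b - a) := fun ha hb => by
    have := intervalIntegral.integral_add_adjacent_intervals (hsub h0 ha) (hsub ha hb)
    simp only [σ]
    rw [← this]; ring
  have hmono : ∀ {a b : ℝ}, a ∈ Set.Icc (0 : ℝ) 1 → b ∈ Set.Icc (0 : ℝ) 1 → a ≤ b →
      δ * (b - a) ≤ σ b - σ a := fun ha hb hab => by
    rw [hσd ha hb]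
    exact le_add_of_nonneg_left (intervalIntegral.integral_nonneg hab fun _ _ => norm_nonneg _)
  have hex : ∀ k : ℕ, ∃ s : ℝ, k ≤ N → s ∈ Set.Icc (0 : ℝ) 1 ∧ σ s = k * L / N := fun k => by
    by_cases hk : k ≤ N
    · have hk' : (k : ℝ) ≤ N := Nat.cast_le.mpr hk
      have : (k * L / N : ℝ) ∈ Set.Icc (σ 0) (σ 1) := by
        rw [hσ0, hσ1]
        refine ⟨by positivity, ?_⟩
        rw [div_le_iff₀ hN', mul_comm L]
        gcongr
      obtain ⟨s, hs, hs'⟩ := intermediate_value_Icc zero_le_one hσc this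
      exact ⟨s, fun _ => ⟨hs, hs'⟩⟩
    · exact ⟨0, fun h => absurd h hk⟩
  choose s hs using hex
  have hsI : ∀ k ≤ N, s k ∈ Set.Icc (0 : ℝ) 1 := fun k hk => (hs k hk).1
  have hstep : ∀ k < N, σ (s (k + 1)) - σ (s k) = L / N := fun k hk => by
    rw [(hs k hk.le).2, (hs (k + 1) hk).2]; push_cast; ring
  have hle : ∀ k < N, s k ≤ s (k + 1) := fun k hk => by
    by_contra hlt
    have h2 := hmono (hsI _ hk) (hsI k hk.le) (not_le.mp hlt).le
    have h3 := hstep k hk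
    have h4 : 0 < L / N := by positivity
    have h5 : 0 ≤ δ * (s k - s (k + 1)) := mul_nonneg hδ0.le (by linarith)
    linarith
  refine ⟨s, ?_, ?_, hsI, hle, fun k hk => ?_⟩
  · have h2 := hmono h0 (hsI 0 N.zero_le) (hsI 0 N.zero_le).1
    rw [(hs 0 N.zero_le).2, hσ0, Nat.cast_zero, zero_mul, zero_div, sub_self] at h2
    have := (hsI 0 N.zero_le).1
    nlinarith
  · have h2 := hmono (hsI N le_rfl) h1 (hsI N le_rfl).2
    rw [(hs N le_rfl).2, hσ1, mul_div_assoc, mul_div_cancel₀ _ hN'.ne', sub_self] at h2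
    have := (hsI N le_rfl).2
    nlinarith
  · have h2 := hσd (hsI k hk.le) (hsI (k + 1) hk)
    rw [hstep k hk] at h2
    rw [h2]
    exact le_add_of_nonneg_right (mul_nonneg hδ0.le (sub_nonneg.mpr (hle k hk)))

variable (hskew : ∀ j, (U j)ᵀ = -U j)
include hskew

/-- A horizontal curve is approximated by an inscribed polygon of nearly the same energy. -/
theorem IsHorizontal.exists_inscribed_polygon (h : IsHorizontal U γ u) (hγ0 : γ 0 = 0) {L : ℝ}
    (hL : horLength u < L) {N : ℕ} (hN : 0 < N) :
    ∃ y : ℕ → EuclideanSpace ℝ (Fin q), y 0 = 0 ∧ y N = (γ 1).1 ∧ polyEnergy N y ≤ L ^ 2 ∧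
      ‖polyArea U N y - (γ 1).2‖ ≤ ‖pairingL U‖ * L ^ 2 / N := by
  obtain ⟨s, hs0, hsN, hsI, hsle, hsL⟩ := exists_equidistributed_partition h.integrable hL hN
  have hN' : (0 : ℝ) < N := Nat.cast_pos.mpr hN
  have hsub : ∀ {f : ℝ → EuclideanSpace ℝ (Fin m)}, IntervalIntegrable f volume 0 1 →
      ∀ {a b : ℝ}, a ∈ Set.Icc (0 : ℝ) 1 → b ∈ Set.Icc (0 : ℝ) 1 →
      IntervalIntegrable f volume a b := fun hf _ _ ha hb =>
    hf.mono_set (by rw [Set.uIcc_of_le zero_le_one]; exact Set.uIcc_subset_Icc ha hb)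
  have husub : ∀ {a b : ℝ}, a ∈ Set.Icc (0 : ℝ) 1 → b ∈ Set.Icc (0 : ℝ) 1 →
      IntervalIntegrable u volume a b := fun ha hb =>
    h.integrable.mono_set (by rw [Set.uIcc_of_le zero_le_one]; exact Set.uIcc_subset_Icc ha hb)
  have h0 : (0 : ℝ) ∈ Set.Icc (0 : ℝ) 1 := Set.left_mem_Icc.mpr zero_le_one
  have hdiff : ∀ {a b : ℝ}, a ∈ Set.Icc (0 : ℝ) 1 → b ∈ Set.Icc (0 : ℝ) 1 →
      (γ b).1 - (γ a).1 = ∫ r in a..b, u r := fun {a b} ha hb => by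
    rw [h.eq_fst a ha, h.eq_fst b hb,
      ← intervalIntegral.integral_add_adjacent_intervals (husub h0 ha) (husub ha hb)]
    abel
  have hnear : ∀ k < N, ∀ r ∈ Set.Icc (s k) (s (k + 1)), ‖(γ r).1 - (γ (s k)).1‖ ≤ L / N := by
    intro k hk r hr
    have hrI : r ∈ Set.Icc (0 : ℝ) 1 := ⟨(hsI k hk.le).1.trans hr.1, hr.2.trans (hsI (k + 1) hk).2⟩
    rw [hdiff (hsI k hk.le) hrI]
    refine (intervalIntegral.norm_integral_le_integral_norm hr.1).trans (le_trans ?_ (hsL k hk))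
    exact intervalIntegral.integral_mono_interval le_rfl hr.1 hr.2
      (Filter.Eventually.of_forall fun _ => norm_nonneg _)
      (husub (hsI k hk.le) (hsI (k + 1) hk)).norm
  refine ⟨fun k => (γ (s k)).1, by simp [hs0, hγ0], by simp [hsN], ?_, ?_⟩
  · have h1 : ∀ k ∈ Finset.range N, ‖(γ (s (k + 1))).1 - (γ (s k)).1‖ ^ 2 ≤ (L / N) ^ 2 :=
      fun k hk => pow_le_pow_left₀ (norm_nonneg _) (hnear k (Finset.mem_range.mp hk) _
        ⟨hsle k (Finset.mem_range.mp hk), le_rfl⟩) 2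
    calc polyEnergy N (fun k => (γ (s k)).1) ≤ N * ∑ _k ∈ Finset.range N, (L / N) ^ 2 := by
          exact mul_le_mul_of_nonneg_left (Finset.sum_le_sum h1) hN'.le
      _ = L ^ 2 := by
          rw [Finset.sum_const, Finset.card_range, nsmul_eq_mul]; field_simp
  · have hp := h.intervalIntegrable_pairing (pairingL U)
    have h2 : (γ 1).2 = (1 / 2 : ℝ) • ∑ k ∈ Finset.range N,
        ∫ r in (s k)..(s (k + 1)), pairingL U (γ r).1 (u r) := by
      rw [intervalIntegral.sum_integral_adjacent_intervals
        (fun k hk => hsub hp (hsI k hk.le) (hsI (k + 1) hk)), hs0, hsN,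
        h.eq_snd 1 ⟨zero_le_one, le_rfl⟩, hγ0, Prod.snd_zero, zero_add]
      rfl
    have h3 : ∀ k ∈ Finset.range N, ‖pairingL U (γ (s k)).1 (γ (s (k + 1))).1 -
        ∫ r in (s k)..(s (k + 1)), pairingL U (γ r).1 (u r)‖ ≤
        ‖pairingL U‖ * (L / N) * (L / N) := fun k hk' => by
      have hk := Finset.mem_range.mp hk'
      have ha := hsI k hk.le
      have hb := hsI (k + 1) hk
      -- By skewness the pairing of two consecutive vertices is the area integral with the position
      -- frozen at the first one.
      have e1 : pairingL U (γ (s k)).1 (γ (s (k + 1))).1 =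
          ∫ r in (s k)..(s (k + 1)), pairingL U (γ (s k)).1 (u r) := by
        rw [(pairingL U (γ (s k)).1).intervalIntegral_comp_comm (husub ha hb), ← hdiff ha hb,
          map_sub, pairing_self hskew, sub_zero]
      have i1 : IntervalIntegrable (fun r => pairingL U (γ (s k)).1 (u r)) volume (s k)
          (s (k + 1)) :=
        ⟨(pairingL U (γ (s k)).1).integrable_comp (husub ha hb).1,
          (pairingL U (γ (s k)).1).integrable_comp (husub ha hb).2⟩
      rw [e1, ← intervalIntegral.integral_sub i1 (hsub hp ha hb)]
      calc ‖∫ r in (s k)..(s (k + 1)),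
            (pairingL U (γ (s k)).1 (u r) - pairingL U (γ r).1 (u r))‖
          ≤ ∫ r in (s k)..(s (k + 1)), ‖pairingL U‖ * (L / N) * ‖u r‖ := by
            refine intervalIntegral.norm_integral_le_of_norm_le (hsle k hk)
              (Filter.Eventually.of_forall fun r hr => ?_)
              ((husub ha hb).norm.const_mul _)
            rw [← sub_apply, ← map_sub]
            refine ((pairingL U).le_opNorm₂ _ _).trans ?_
            gcongr
            rw [norm_sub_rev]
            exact hnear k hk r ⟨hr.1.le, hr.2⟩
        _ ≤ ‖pairingL U‖ * (L / N) * (L / N) := by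
            rw [intervalIntegral.integral_const_mul]
            have hLN : 0 ≤ L / N :=
              (norm_nonneg _).trans (hnear k hk _ ⟨le_rfl, hsle k hk⟩)
            gcongr
            exact hsL k hk
    rw [h2, polyArea, ← smul_sub, ← Finset.sum_sub_distrib, norm_smul]
    calc ‖(1 / 2 : ℝ)‖ * ‖∑ k ∈ Finset.range N, (pairingL U (γ (s k)).1 (γ (s (k + 1))).1 -
          ∫ r in (s k)..(s (k + 1)), pairingL U (γ r).1 (u r))‖
        ≤ ‖(1 / 2 : ℝ)‖ * ∑ _k ∈ Finset.range N, ‖pairingL U‖ * (L / N) * (L / N) := by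
          gcongr
          exact norm_sum_le_of_le _ h3
      _ = 1 / 2 * (‖pairingL U‖ * L ^ 2 / N) := by
          rw [Finset.sum_const, Finset.card_range, nsmul_eq_mul]; norm_num; field_simp
      _ ≤ ‖pairingL U‖ * L ^ 2 / N := by
          have : 0 ≤ ‖pairingL U‖ * L ^ 2 / N := by positivity
          linarith

end InscribedPolygons

/-! ### Stability and convergence of the implicit midpoint rule. -/

section CayleyScheme

variable {E : Type*} [NormedAddCommGroup E] [InnerProductSpace ℝ E]

theorem norm_add_smul_skew {B : E →L[ℝ] E} (hB : ∀ x, inner ℝ (B x) x = 0) (c : ℝ) (e : E) :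
    ‖e + c • B e‖ ^ 2 = ‖e‖ ^ 2 + c ^ 2 * ‖B e‖ ^ 2 := by
  rw [norm_add_sq_real, inner_smul_right, real_inner_comm, hB, norm_smul, mul_pow,
    Real.norm_eq_abs, sq_abs]
  ring

/-- A skew `B` makes `e` and `B e` orthogonal, so the sign is irrelevant. This isometry between `1 +
cB` and `1 - cB` is the stability of the midpoint rule. -/
theorem norm_add_smul_skew_eq {B : E →L[ℝ] E} (hB : ∀ x, inner ℝ (B x) x = 0) (c : ℝ) (e : E) :
    ‖e + c • B e‖ = ‖e - c • B e‖ := by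
  have h := norm_add_smul_skew hB (-c) e
  rw [neg_smul, ← sub_eq_add_neg, neg_sq, ← norm_add_smul_skew hB] at h
  exact ((pow_left_inj₀ (norm_nonneg _) (norm_nonneg _) two_ne_zero).mp h).symm

theorem norm_le_norm_sub_smul_skew {B : E →L[ℝ] E} (hB : ∀ x, inner ℝ (B x) x = 0) (c : ℝ)
    (e : E) : ‖e‖ ≤ ‖e - c • B e‖ := by
  rw [← norm_add_smul_skew_eq hB, ← pow_le_pow_iff_left₀ (norm_nonneg _) (norm_nonneg _)
    two_ne_zero, norm_add_smul_skew hB]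
  exact le_add_of_nonneg_right (by positivity)

variable [CompleteSpace E]

theorem norm_exp_smul_sub_exp_smul_le {A : E →L[ℝ] E} (hA : ∀ x, inner ℝ (A x) x = 0) (v : E)
    (a b : ℝ) : ‖NormedSpace.exp (b • A) v - NormedSpace.exp (a • A) v‖ ≤ ‖A‖ * ‖v‖ * |b - a| := by
  refine convex_univ.norm_image_sub_le_of_norm_hasDerivWithin_le
    (f := fun r : ℝ => NormedSpace.exp (r • A) v)
    (fun r _ => (hasDerivAt_exp_smul_apply A v r).hasDerivWithinAt) (fun r _ => ?_)
    (Set.mem_univ a) (Set.mem_univ b)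
  rw [← norm_exp_smul_apply A hA v r]
  exact A.le_opNorm _

theorem norm_exp_smul_taylor_le {A : E →L[ℝ] E} (hA : ∀ x, inner ℝ (A x) x = 0) (v : E)
    {a b : ℝ} (hab : a ≤ b) :
    ‖NormedSpace.exp (b • A) v - NormedSpace.exp (a • A) v -
      (b - a) • A (NormedSpace.exp (a • A) v)‖ ≤ ‖A‖ ^ 2 * ‖v‖ * (b - a) ^ 2 := by
  have hd : ∀ r : ℝ, HasDerivAt
      (fun r : ℝ => NormedSpace.exp (r • A) v - r • A (NormedSpace.exp (a • A) v))
      (A (NormedSpace.exp (r • A) v - NormedSpace.exp (a • A) v)) r := fun r => by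
    refine ((hasDerivAt_exp_smul_apply A v r).fun_sub
      ((hasDerivAt_id r).smul_const _)).congr_deriv ?_
    rw [map_sub, one_smul]
  have hb : ∀ r ∈ Set.Icc a b, ‖A (NormedSpace.exp (r • A) v - NormedSpace.exp (a • A) v)‖ ≤
      ‖A‖ * (‖A‖ * ‖v‖ * (b - a)) := fun r hr => by
    refine (A.le_opNorm _).trans (mul_le_mul_of_nonneg_left ?_ (norm_nonneg _))
    refine (norm_exp_smul_sub_exp_smul_le hA v a r).trans ?_
    rw [abs_of_nonneg (sub_nonneg.mpr hr.1)]
    gcongr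
    exact hr.2
  have h := (convex_Icc a b).norm_image_sub_le_of_norm_hasDerivWithin_le
    (fun r _ => (hd r).hasDerivWithinAt) hb (Set.left_mem_Icc.mpr hab) (Set.right_mem_Icc.mpr hab)
  rw [Real.norm_of_nonneg (sub_nonneg.mpr hab)] at h
  refine le_trans (le_of_eq ?_) (h.trans_eq (by ring))
  congr 1
  module

/-- Convergence estimate for the implicit midpoint scheme of `z' = A z`. -/
theorem norm_midpoint_scheme_sub_le {A B : E →L[ℝ] E} (hA : ∀ x, inner ℝ (A x) x = 0)
    (hB : ∀ x, inner ℝ (B x) x = 0) (v : E) {N : ℕ} (hN : 0 < N) {Z : ℕ → E}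
    (hZ : ∀ k, k + 1 < N → (N : ℝ) • (Z (k + 1) - Z k) = (1 / 2 : ℝ) • B (Z k + Z (k + 1)))
    {k : ℕ} (hk : k < N) :
    ‖Z k - NormedSpace.exp ((k / N : ℝ) • A) v‖ ≤
      ‖Z 0 - v‖ * (1 + ‖B‖) + (2 * ‖A‖ ^ 2 * ‖v‖ / N + ‖B - A‖ * ‖v‖) := by
  have hN' : (0 : ℝ) < N := Nat.cast_pos.mpr hN
  have hN1 : (1 : ℝ) ≤ N := Nat.one_le_cast.mpr hN
  set c : ℝ := 1 / (2 * N) with hc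
  set κ := 2 * ‖A‖ ^ 2 * ‖v‖ / N + ‖B - A‖ * ‖v‖ with hκ
  have hκ0 : 0 ≤ κ := by positivity
  let z : ℕ → E := fun k => NormedSpace.exp ((k / N : ℝ) • A) v
  have hz : ∀ k, ‖z k‖ = ‖v‖ := fun k => norm_exp_smul_apply A hA v _
  have hstep : ∀ k : ℕ, ((k + 1 : ℕ) / N : ℝ) - k / N = 1 / N := fun k => by push_cast; ring
  have hlocal : ∀ k, ‖z (k + 1) - z k - c • B (z k + z (k + 1))‖ ≤ κ / N := fun k => by
    have h1 : ‖z (k + 1) - z k - (1 / N : ℝ) • A (z k)‖ ≤ ‖A‖ ^ 2 * ‖v‖ * (1 / N) ^ 2 := by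
      have := norm_exp_smul_taylor_le hA v (a := (k / N : ℝ)) (b := ((k + 1 : ℕ) / N : ℝ))
        (by gcongr; exact k.le_succ)
      rwa [hstep] at this
    have h2 : ‖z (k + 1) - z k‖ ≤ ‖A‖ * ‖v‖ * (1 / N) := by
      have := norm_exp_smul_sub_exp_smul_le hA v (k / N : ℝ) ((k + 1 : ℕ) / N : ℝ)
      rwa [hstep, abs_of_nonneg (by positivity)] at this
    have h3 : z (k + 1) - z k - c • B (z k + z (k + 1)) =
        (z (k + 1) - z k - (1 / N : ℝ) • A (z k)) - c • A (z (k + 1) - z k) -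
          c • (B - A) (z k + z (k + 1)) := by
      have : (1 / N : ℝ) = 2 * c := by rw [hc]; field_simp
      rw [this]
      simp only [map_add, map_sub, sub_apply]
      module
    have hc0 : ‖c‖ = 1 / (2 * N) := Real.norm_of_nonneg (by positivity)
    have h4 : ‖c • A (z (k + 1) - z k)‖ ≤ 1 / (2 * N) * (‖A‖ * (‖A‖ * ‖v‖ * (1 / N))) := by
      rw [norm_smul, hc0]
      gcongr
      exact (A.le_opNorm _).trans (by gcongr)
    have h5 : ‖c • (B - A) (z k + z (k + 1))‖ ≤ 1 / (2 * N) * (‖B - A‖ * (‖v‖ + ‖v‖)) := by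
      rw [norm_smul, hc0]
      gcongr
      refine ((B - A).le_opNorm _).trans ?_
      gcongr
      exact (norm_add_le _ _).trans (by rw [hz, hz])
    rw [h3]
    refine (norm_sub_le _ _).trans ((add_le_add ((norm_sub_le _ _).trans (add_le_add h1 h4))
      h5).trans ?_)
    have h6 : κ / N = ‖A‖ ^ 2 * ‖v‖ * (1 / N) ^ 2 + 1 / (2 * N) * (‖A‖ * (‖A‖ * ‖v‖ * (1 / N))) +
      1 / (2 * N) * (‖B - A‖ * (‖v‖ + ‖v‖)) + 1 / 2 * (‖A‖ ^ 2 * ‖v‖ * (1 / N) ^ 2) := by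
      rw [hκ]; field_simp; ring
    rw [h6]
    exact le_add_of_nonneg_right (by positivity)
  -- The error is measured after applying `1 - cB`. In this quantity a step is an isometry up to the
  -- local error, so errors only add and do not grow exponentially.
  let n : ℕ → ℝ := fun k => ‖(Z k - z k) - c • B (Z k - z k)‖
  have hn : ∀ k, k + 1 < N → n (k + 1) ≤ n k + κ / N := fun k hk => by
    have h1 : Z (k + 1) - Z k = c • B (Z k + Z (k + 1)) := by
      have h2 : Z (k + 1) - Z k = (1 / N : ℝ) • (N : ℝ) • (Z (k + 1) - Z k) := by
        rw [smul_smul, one_div_mul_cancel hN'.ne', one_smul]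
      rw [h2, hZ k hk, smul_smul]
      congr 1
      rw [hc]; field_simp
    have h3 : (Z (k + 1) - z (k + 1)) - c • B (Z (k + 1) - z (k + 1)) =
        ((Z k - z k) + c • B (Z k - z k)) -
          (z (k + 1) - z k - c • B (z k + z (k + 1))) := by
      have h4 : Z (k + 1) = Z k + c • B (Z k) + c • B (Z (k + 1)) := by
        rw [add_assoc, ← smul_add, ← map_add, ← h1]; abel
      rw [map_sub, smul_sub]
      nth_rewrite 1 [h4]
      simp only [map_add, map_sub]
      module
    simp only [n]
    rw [h3, ← norm_add_smul_skew_eq hB]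
    exact (norm_sub_le _ _).trans (add_le_add le_rfl (hlocal k))
  have hind : ∀ k, k < N → n k ≤ n 0 + k * (κ / N) := fun k => by
    induction k with
    | zero => intro _; simp
    | succ k ih =>
      intro hk
      refine (hn k hk).trans ((add_le_add (ih (by omega)) le_rfl).trans_eq ?_)
      push_cast; ring
  have hn0 : n 0 ≤ ‖Z 0 - v‖ * (1 + ‖B‖) := by
    have hz0 : z 0 = v := by simp [z]
    simp only [n, hz0]
    refine (norm_sub_le _ _).trans ?_
    rw [norm_smul, mul_add, mul_one]
    refine add_le_add le_rfl ?_
    have hc1 : ‖c‖ ≤ 1 := by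
      rw [Real.norm_of_nonneg (by positivity), hc, div_le_one (by positivity)]
      linarith
    calc ‖c‖ * ‖B (Z 0 - v)‖ ≤ 1 * (‖B‖ * ‖Z 0 - v‖) := by
          gcongr; exact B.le_opNorm _
      _ = ‖Z 0 - v‖ * ‖B‖ := by ring
  calc ‖Z k - z k‖ ≤ n k := norm_le_norm_sub_smul_skew hB _ _
    _ ≤ n 0 + k * (κ / N) := hind k hk
    _ ≤ ‖Z 0 - v‖ * (1 + ‖B‖) + κ := by
      refine add_le_add hn0 ?_
      rw [mul_div_left_comm]
      exact mul_le_of_le_one_right hκ0 ((div_le_one hN').mpr (Nat.cast_le.mpr hk.le))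

end CayleyScheme

/-! ### Endpoints of polygons with nearly geodesic velocity. -/

section LimitOfPolygons

variable {q m : ℕ} {U : Fin m → Matrix (Fin q) (Fin q) ℝ} (hskew : ∀ j, (U j)ᵀ = -U j)
include hskew

omit hskew in
theorem normalVel_eq_exp_smul (ζ : EuclideanSpace ℝ (Fin q)) (θ : EuclideanSpace ℝ (Fin m)) (s : ℝ) :
    normalVel U ζ θ s = NormedSpace.exp (s • opU U ((2 : ℝ) • θ)) ζ := by
  rw [normalVel_eq, map_smul, smul_smul, mul_comm]

theorem norm_normalPos_sub_le (ζ : EuclideanSpace ℝ (Fin q)) (θ : EuclideanSpace ℝ (Fin m))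
    (a b : ℝ) : ‖normalPos U ζ θ b - normalPos U ζ θ a‖ ≤ ‖ζ‖ * |b - a| :=
  convex_univ.norm_image_sub_le_of_norm_hasDerivWithin_le
    (fun r _ => (hasDerivAt_normalPos U ζ θ r).hasDerivWithinAt)
    (fun r _ => (norm_normalVel hskew ζ θ r).le) (Set.mem_univ a) (Set.mem_univ b)

/-- A polygon whose velocity is uniformly close to that of a normal geodesic ends near it. -/
theorem norm_polygon_sub_normalGeod_le {N : ℕ} (hN : 0 < N) {y : ℕ → EuclideanSpace ℝ (Fin q)}
    (hy0 : y 0 = 0) (ζ : EuclideanSpace ℝ (Fin q)) (θ : EuclideanSpace ℝ (Fin m)) {ε : ℝ}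
    (hε : ∀ k < N, ∀ s ∈ Set.Icc (k / N : ℝ) ((k + 1 : ℕ) / N),
      ‖(N : ℝ) • (y (k + 1) - y k) - normalVel U ζ θ s‖ ≤ ε) :
    ‖y N - (normalGeod U ζ θ 1).1‖ ≤ ε ∧
    ‖polyArea U N y - (normalGeod U ζ θ 1).2‖ ≤
      ‖pairingL U‖ * ((‖ζ‖ + ε) * ε + (ε + ‖ζ‖ / N) * ‖ζ‖) := by
  have hN' : (0 : ℝ) < N := Nat.cast_pos.mpr hN
  have hstep : ∀ k : ℕ, ((k + 1 : ℕ) / N : ℝ) - k / N = 1 / N := fun k => by push_cast; ring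
  have hle : ∀ k : ℕ, (k / N : ℝ) ≤ (k + 1 : ℕ) / N := fun k => by gcongr; exact k.le_succ
  have hε0 : 0 ≤ ε := (norm_nonneg _).trans (hε 0 hN _ ⟨le_rfl, hle 0⟩)
  have hconst : ∀ {V : Type} [NormedAddCommGroup V] [NormedSpace ℝ V] [CompleteSpace V]
      (k : ℕ) (v : V),
      ∫ _ in (k / N : ℝ)..((k + 1 : ℕ) / N : ℝ), (N : ℝ) • v = v := fun k v => by
    rw [intervalIntegral.integral_const, hstep, smul_smul, one_div_mul_cancel hN'.ne', one_smul]
  have hvel : ∀ a b, IntervalIntegrable (normalVel U ζ θ) volume a b := fun a b =>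
    (continuous_normalVel U ζ θ).intervalIntegrable a b
  have hpos : ∀ a b, normalPos U ζ θ b - normalPos U ζ θ a = ∫ r in a..b, normalVel U ζ θ r :=
    fun a b => intervalIntegral.integral_interval_sub_left (hvel _ _) (hvel _ _)
  have hx : ∀ k ≤ N, ‖y k - normalPos U ζ θ (k / N)‖ ≤ k * (ε / N) := fun k => by
    induction k with
    | zero => intro _; simp [hy0, normalPos_zero]
    | succ k ih =>
      intro hk
      have h1 : y (k + 1) - normalPos U ζ θ ((k + 1 : ℕ) / N) =
          (y k - normalPos U ζ θ (k / N)) + ∫ r in (k / N : ℝ)..((k + 1 : ℕ) / N : ℝ),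
            ((N : ℝ) • (y (k + 1) - y k) - normalVel U ζ θ r) := by
        rw [intervalIntegral.integral_sub (by simp) (hvel _ _), hconst, ← hpos]
        abel
      have h2 : ‖∫ r in (k / N : ℝ)..((k + 1 : ℕ) / N : ℝ),
            ((N : ℝ) • (y (k + 1) - y k) - normalVel U ζ θ r)‖ ≤ ε / N := by
        refine (intervalIntegral.norm_integral_le_of_norm_le_const (C := ε)
          fun r hr => ?_).trans_eq ?_
        · rw [Set.uIoc_of_le (hle k)] at hr
          exact hε k hk r ⟨hr.1.le, hr.2⟩
        · rw [hstep, abs_of_nonneg (by positivity)]; ring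
      rw [h1]
      refine (norm_add_le _ _).trans ((add_le_add (ih (by omega)) h2).trans_eq ?_)
      push_cast; ring
  have hx' : ∀ k ≤ N, ‖y k - normalPos U ζ θ (k / N)‖ ≤ ε := fun k hk => by
    refine (hx k hk).trans ?_
    rw [mul_div_left_comm]
    exact mul_le_of_le_one_right hε0 ((div_le_one hN').mpr (Nat.cast_le.mpr hk))
  refine ⟨by simpa [div_self hN'.ne', normalGeod_fst] using hx' N le_rfl, ?_⟩
  have hsum : (normalGeod U ζ θ 1).2 = (1 / 2 : ℝ) • ∑ k ∈ Finset.range N,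
      ∫ r in (k / N : ℝ)..((k + 1 : ℕ) / N : ℝ),
        pairingL U (normalPos U ζ θ r) (normalVel U ζ θ r) := by
    have := intervalIntegral.sum_integral_adjacent_intervals (μ := volume) (n := N)
      (a := fun k : ℕ => (k / N : ℝ))
      (fun k _ => (continuous_pairing_normal U ζ θ).intervalIntegrable _ _)
    rw [this, normalGeod_snd]
    simp [div_self hN'.ne']
  set D := ‖pairingL U‖ * ((‖ζ‖ + ε) * ε + (ε + ‖ζ‖ / N) * ‖ζ‖) with hD
  have hD0 : 0 ≤ D := by positivity
  have hterm : ∀ k ∈ Finset.range N, ‖pairingL U (y k) (y (k + 1)) -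
      ∫ r in (k / N : ℝ)..((k + 1 : ℕ) / N : ℝ),
        pairingL U (normalPos U ζ θ r) (normalVel U ζ θ r)‖ ≤ D / N := fun k hk' => by
    have hk := Finset.mem_range.mp hk'
    have h1 : pairingL U (y k) (y (k + 1)) = ∫ _ in (k / N : ℝ)..((k + 1 : ℕ) / N : ℝ),
        pairingL U (y k) ((N : ℝ) • (y (k + 1) - y k)) := by
      simp only [map_smul]
      rw [hconst, map_sub, pairing_self hskew, sub_zero]
    rw [h1, ← intervalIntegral.integral_sub (by simp)
      ((continuous_pairing_normal U ζ θ).intervalIntegrable _ _)]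
    refine (intervalIntegral.norm_integral_le_of_norm_le_const (C := D)
      fun r hr => ?_).trans_eq ?_
    · rw [Set.uIoc_of_le (hle k)] at hr
      have hr' : r ∈ Set.Icc (k / N : ℝ) ((k + 1 : ℕ) / N) := ⟨hr.1.le, hr.2⟩
      have hkN : (k / N : ℝ) ≤ 1 := (div_le_one hN').mpr (Nat.cast_le.mpr hk.le)
      have hxb : ‖normalPos U ζ θ (k / N)‖ ≤ ‖ζ‖ := by
        have := norm_normalPos_sub_le hskew ζ θ 0 (k / N)
        rw [normalPos_zero, sub_zero, sub_zero, abs_of_nonneg (by positivity)] at this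
        exact this.trans (mul_le_of_le_one_right (norm_nonneg _) hkN)
      have hyb : ‖y k‖ ≤ ‖ζ‖ + ε := by
        have := norm_le_insert' (y k) (normalPos U ζ θ (k / N))
        linarith [hx' k hk.le]
      have hxr : ‖y k - normalPos U ζ θ r‖ ≤ ε + ‖ζ‖ / N := by
        have h2 := norm_normalPos_sub_le hskew ζ θ r (k / N)
        have h3 : |(k / N : ℝ) - r| ≤ 1 / N := by
          rw [abs_sub_comm, abs_of_nonneg (sub_nonneg.mpr hr'.1), ← hstep k]
          linarith [hr'.2]
        calc ‖y k - normalPos U ζ θ r‖ ≤ ‖y k - normalPos U ζ θ (k / N)‖ +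
              ‖normalPos U ζ θ (k / N) - normalPos U ζ θ r‖ :=
              norm_sub_le_norm_sub_add_norm_sub _ _ _
          _ ≤ ε + ‖ζ‖ * (1 / N) := add_le_add (hx' k hk.le) (h2.trans (by gcongr))
          _ = ε + ‖ζ‖ / N := by ring
      have h4 : pairingL U (y k) ((N : ℝ) • (y (k + 1) - y k)) -
          pairingL U (normalPos U ζ θ r) (normalVel U ζ θ r) =
          pairingL U (y k) ((N : ℝ) • (y (k + 1) - y k) - normalVel U ζ θ r) +
          pairingL U (y k - normalPos U ζ θ r) (normalVel U ζ θ r) := by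
        simp only [map_sub, sub_apply]; abel
      rw [h4]
      calc _ ≤ ‖pairingL U‖ * ‖y k‖ * ‖(N : ℝ) • (y (k + 1) - y k) - normalVel U ζ θ r‖ +
            ‖pairingL U‖ * ‖y k - normalPos U ζ θ r‖ * ‖normalVel U ζ θ r‖ :=
            (norm_add_le _ _).trans
              (add_le_add ((pairingL U).le_opNorm₂ _ _) ((pairingL U).le_opNorm₂ _ _))
        _ ≤ ‖pairingL U‖ * (‖ζ‖ + ε) * ε + ‖pairingL U‖ * (ε + ‖ζ‖ / N) * ‖ζ‖ := by
            rw [norm_normalVel hskew]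
            gcongr
            exact hε k hk r hr'
        _ = D := by rw [hD]; ring
    · rw [hstep, abs_of_nonneg (by positivity)]; ring
  rw [hsum, polyArea, ← smul_sub, ← Finset.sum_sub_distrib, norm_smul]
  calc ‖(1 / 2 : ℝ)‖ * ‖∑ k ∈ Finset.range N, (pairingL U (y k) (y (k + 1)) -
        ∫ r in (k / N : ℝ)..((k + 1 : ℕ) / N : ℝ),
          pairingL U (normalPos U ζ θ r) (normalVel U ζ θ r))‖
      ≤ ‖(1 / 2 : ℝ)‖ * ∑ _k ∈ Finset.range N, D / N := by
        gcongr
        exact norm_sum_le_of_le _ hterm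
    _ = 1 / 2 * D := by
        rw [Finset.sum_const, Finset.card_range, nsmul_eq_mul, mul_div_cancel₀ _ hN'.ne']
        norm_num
    _ ≤ D := by linarith

end LimitOfPolygons

/-! ### From horizontal curves to normal geodesics. -/

section MinimizingGeodesics

variable {q m : ℕ} {U : Fin m → Matrix (Fin q) (Fin q) ℝ} (hskew : ∀ j, (U j)ᵀ = -U j)
include hskew

/-- Pairing the Euler equation with the sum of two consecutive edges kills the skew side and leaves
the difference of their squared lengths: constant speed in discrete form. -/
theorem norm_edge_eq {N : ℕ} (hN : 0 < N) {η : EuclideanSpace ℝ (Fin m)}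
    {y : ℕ → EuclideanSpace ℝ (Fin q)}
    (hy : ∀ i, i + 1 < N → (N : ℝ) • ((y (i + 2) - y (i + 1)) - (y (i + 1) - y i)) =
      (1 / 2 : ℝ) • opU U η ((y (i + 1) - y i) + (y (i + 2) - y (i + 1))))
    {k : ℕ} (hk : k < N) : ‖y (k + 1) - y k‖ = ‖y 1 - y 0‖ := by
  induction k with
  | zero => rfl
  | succ k ih =>
    rw [← ih (by omega)]
    have hN' : (N : ℝ) ≠ 0 := Nat.cast_ne_zero.mpr hN.ne'
    have h := congrArg
      (fun v => inner ℝ v ((y (k + 1) - y k) + (y (k + 2) - y (k + 1)))) (hy k hk)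
    simp only [inner_smul_left, opU_inner_self hskew, mul_zero] at h
    have h1 : inner ℝ ((y (k + 2) - y (k + 1)) - (y (k + 1) - y k))
        ((y (k + 1) - y k) + (y (k + 2) - y (k + 1))) = (0 : ℝ) := by
      simpa [hN'] using h
    rw [inner_sub_left, inner_add_right, inner_add_right, real_inner_self_eq_norm_sq,
      real_inner_self_eq_norm_sq, real_inner_comm (y (k + 1) - y k)] at h1
    have h2 : ‖y (k + 2) - y (k + 1)‖ ^ 2 = ‖y (k + 1) - y k‖ ^ 2 := by
      rw [real_inner_comm] at h1
      linarith
    exact (pow_left_inj₀ (norm_nonneg _) (norm_nonneg _) two_ne_zero).mp h2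

theorem polyEnergy_eq_norm_sq {N : ℕ} (hN : 0 < N) {η : EuclideanSpace ℝ (Fin m)}
    {y : ℕ → EuclideanSpace ℝ (Fin q)}
    (hy : ∀ i, i + 1 < N → (N : ℝ) • ((y (i + 2) - y (i + 1)) - (y (i + 1) - y i)) =
      (1 / 2 : ℝ) • opU U η ((y (i + 1) - y i) + (y (i + 2) - y (i + 1)))) :
    polyEnergy N y = ‖(N : ℝ) • (y 1 - y 0)‖ ^ 2 := by
  rw [polyEnergy, Finset.sum_congr rfl fun k hk => by
    rw [norm_edge_eq hskew hN hy (Finset.mem_range.mp hk)], Finset.sum_const, Finset.card_range,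
    nsmul_eq_mul, norm_smul, mul_pow, Real.norm_natCast]
  ring

/-- The velocity of a discrete geodesic is close to that of a normal geodesic. -/
theorem norm_edge_sub_normalVel_le {N : ℕ} (hN : 0 < N) {η : EuclideanSpace ℝ (Fin m)}
    {y : ℕ → EuclideanSpace ℝ (Fin q)}
    (hy : ∀ i, i + 1 < N → (N : ℝ) • ((y (i + 2) - y (i + 1)) - (y (i + 1) - y i)) =
      (1 / 2 : ℝ) • opU U η ((y (i + 1) - y i) + (y (i + 2) - y (i + 1))))
    (ζ : EuclideanSpace ℝ (Fin q)) (θ : EuclideanSpace ℝ (Fin m)) {k : ℕ} (hk : k < N) {s : ℝ}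
    (hs : s ∈ Set.Icc (k / N : ℝ) ((k + 1 : ℕ) / N)) :
    ‖(N : ℝ) • (y (k + 1) - y k) - normalVel U ζ θ s‖ ≤
      ‖(N : ℝ) • (y 1 - y 0) - ζ‖ * (1 + ‖opU U η‖) +
        (2 * ‖opU U ((2 : ℝ) • θ)‖ ^ 2 * ‖ζ‖ / N + ‖opU U η - opU U ((2 : ℝ) • θ)‖ * ‖ζ‖) +
        ‖opU U ((2 : ℝ) • θ)‖ * ‖ζ‖ * (1 / N) := by
  have h1 := norm_midpoint_scheme_sub_le (opU_inner_self hskew ((2 : ℝ) • θ))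
    (opU_inner_self hskew η) ζ hN (Z := fun k => (N : ℝ) • (y (k + 1) - y k))
    (fun i hi => by rw [← smul_sub, hy i hi, ← smul_add, map_smul, smul_comm]) hk
  rw [← normalVel_eq_exp_smul] at h1
  have h2 := norm_exp_smul_sub_exp_smul_le (opU_inner_self hskew ((2 : ℝ) • θ)) ζ s (k / N)
  rw [← normalVel_eq_exp_smul, ← normalVel_eq_exp_smul] at h2
  have h3 : |(k / N : ℝ) - s| ≤ 1 / N := by
    rw [abs_sub_comm, abs_of_nonneg (sub_nonneg.mpr hs.1)]
    have : ((k + 1 : ℕ) / N : ℝ) - k / N = 1 / N := by push_cast; ring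
    linarith [hs.2]
  exact (norm_sub_le_norm_sub_add_norm_sub _ _ _).trans
    (add_le_add h1 (h2.trans (by gcongr)))

/-- A horizontal curve from the identity can be replaced by a normal geodesic that is not longer
than any given bound for its length. -/
theorem exists_normalGeod_of_isHorizontal (hlin : LinearIndependent ℝ U) {γ : ℝ → StepTwo q m}
    {u : ℝ → EuclideanSpace ℝ (Fin q)} (h : IsHorizontal U γ u) (hγ0 : γ 0 = 0) {L : ℝ}
    (hL : horLength u < L) :
    ∃ (ζ : EuclideanSpace ℝ (Fin q)) (θ : EuclideanSpace ℝ (Fin m)),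
      ‖ζ‖ ≤ L ∧ normalGeod U ζ θ 1 = γ 1 := by
  obtain ⟨C₁, hC₁⟩ := exists_multiplier_bound hskew hlin
  have hL0 : 0 ≤ L :=
    (intervalIntegral.integral_nonneg zero_le_one fun _ _ => norm_nonneg _).trans hL.le
  -- The number of edges is a multiple of `(m + 1) * 3`, as the multiplier bound requires.
  let n : ℕ → ℕ := fun r => (m + 1) * 3 * (r + 1)
  have hn : ∀ r, 0 < n r := fun r => by positivity
  have hn' : ∀ r, (0 : ℝ) < n r := fun r => Nat.cast_pos.mpr (hn r)
  set C₂ := ‖pairingL U‖ * L ^ 2 with hC₂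
  -- The penalty parameter is the number `n r` of edges: the inscribed polygon misses the target by
  -- `O(1 / n r)` and pays only `O(1 / n r)`, while a minimizer of bounded value must still approach
  -- the target.
  have hex : ∀ r, ∃ y : ℕ → EuclideanSpace ℝ (Fin q), y 0 = 0 ∧ y (n r) = (γ 1).1 ∧
      (∀ y', y' 0 = y 0 → y' (n r) = y (n r) → polyPenalty U (n r) (n r) (γ 1).2 y ≤
        polyPenalty U (n r) (n r) (γ 1).2 y') ∧
      polyPenalty U (n r) (n r) (γ 1).2 y ≤ L ^ 2 + C₂ ^ 2 * (1 / n r) := fun r => by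
    obtain ⟨c, hc0, hcN, hcE, hcA⟩ := h.exists_inscribed_polygon hskew hγ0 hL (hn r)
    obtain ⟨y, hy0, hyN, hmin⟩ := exists_polyPenalty_minimizer U (n r).cast_nonneg (γ 1).1
      (γ 1).2 hc0 hcN
    refine ⟨y, hy0, hyN, fun y' h0 hN => hmin y' (h0.trans hy0) (hN.trans hyN),
      (hmin c hc0 hcN).trans (add_le_add hcE ?_)⟩
    calc (n r : ℝ) * ‖polyArea U (n r) c - (γ 1).2‖ ^ 2 ≤ n r * (C₂ / n r) ^ 2 := by gcongr
      _ = C₂ ^ 2 * (1 / n r) := by field_simp [(hn' r).ne']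
  choose y hy0 hyN hmin hJ using hex
  let η : ℕ → EuclideanSpace ℝ (Fin m) := fun r =>
    (n r : ℝ) • ((γ 1).2 - polyArea U (n r) (y r))
  let ξ : ℕ → EuclideanSpace ℝ (Fin q) := fun r => (n r : ℝ) • (y r 1 - y r 0)
  have heuler : ∀ r i, i + 1 < n r →
      (n r : ℝ) • ((y r (i + 2) - y r (i + 1)) - (y r (i + 1) - y r i)) =
      (1 / 2 : ℝ) • opU U (η r) ((y r (i + 1) - y r i) + (y r (i + 2) - y r (i + 1))) :=
    fun r i hi => polyPenalty_minimizer_euler hskew (hmin r) hi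
  have hη : ∀ r, ‖η r‖ ≤ C₁ := fun r => hC₁ (r + 1) r.succ_pos _ _ _ (hmin r)
  have hξ : ∀ r, ‖ξ r‖ ^ 2 ≤ L ^ 2 + C₂ ^ 2 * (1 / n r) := fun r => by
    rw [← polyEnergy_eq_norm_sq hskew (hn r) (heuler r)]
    refine le_trans ?_ (hJ r)
    exact le_add_of_nonneg_right (by positivity)
  have hA : ∀ r, ‖polyArea U (n r) (y r) - (γ 1).2‖ ^ 2 ≤
      (L ^ 2 + C₂ ^ 2 * (1 / n r)) * (1 / n r) := fun r => by
    rw [mul_one_div, le_div_iff₀ (hn' r), mul_comm]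
    refine le_trans ?_ (hJ r)
    exact le_add_of_nonneg_left (polyEnergy_nonneg _ _)
  have hn1 : ∀ r, (1 / n r : ℝ) ≤ 1 := fun r =>
    (div_le_one (hn' r)).mpr (Nat.one_le_cast.mpr (hn r))
  have hbdd : ∀ r, (ξ r, η r) ∈ Metric.closedBall (0 : EuclideanSpace ℝ (Fin q) ×
      EuclideanSpace ℝ (Fin m)) (max (L + C₂) C₁) := fun r => by
    rw [mem_closedBall_zero_iff, Prod.norm_def]
    refine max_le_max ?_ (hη r)
    have hC₂0 : 0 ≤ C₂ := by positivity
    refine (pow_le_pow_iff_left₀ (norm_nonneg _) (by positivity) two_ne_zero).mp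
      ((hξ r).trans ?_)
    have : C₂ ^ 2 * (1 / n r) ≤ C₂ ^ 2 := mul_le_of_le_one_right (by positivity) (hn1 r)
    have : 0 ≤ 2 * L * C₂ := by positivity
    linarith [add_sq L C₂]
  obtain ⟨⟨ζ, ϑ⟩, -, φ, hφ, hlim⟩ := tendsto_subseq_of_bounded Metric.isBounded_closedBall hbdd
  have hξlim : Filter.Tendsto (fun j => ξ (φ j)) Filter.atTop (nhds ζ) :=
    (continuous_fst.tendsto _).comp hlim
  have hηlim : Filter.Tendsto (fun j => η (φ j)) Filter.atTop (nhds ϑ) :=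
    (continuous_snd.tendsto _).comp hlim
  have hnlim : Filter.Tendsto (fun j => (1 / n (φ j) : ℝ)) Filter.atTop (nhds 0) := by
    have h1 : Filter.Tendsto n Filter.atTop Filter.atTop :=
      Filter.tendsto_atTop_mono (fun r => r.le_succ.trans
        (Nat.le_mul_of_pos_left (r + 1) (by positivity))) Filter.tendsto_id
    exact tendsto_one_div_atTop_nhds_zero_nat.comp (h1.comp hφ.tendsto_atTop)
  -- The limit of the Euler equations is `ζ' = Ũ(ϑ) ζ`, whereas `normalVel` solves `ζ' = 2 Ũ(θ) ζ`.
  set θ := (1 / 2 : ℝ) • ϑ with hθ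
  have hϑ : (2 : ℝ) • θ = ϑ := by rw [hθ, smul_smul]; norm_num
  let ε : ℕ → ℝ := fun j => ‖ξ (φ j) - ζ‖ * (1 + ‖opU U (η (φ j))‖) +
        (2 * ‖opU U ((2 : ℝ) • θ)‖ ^ 2 * ‖ζ‖ / n (φ j) +
          ‖opU U (η (φ j)) - opU U ((2 : ℝ) • θ)‖ * ‖ζ‖) +
        ‖opU U ((2 : ℝ) • θ)‖ * ‖ζ‖ * (1 / n (φ j))
  have hεlim : Filter.Tendsto ε Filter.atTop (nhds 0) := by
    have hop : Filter.Tendsto (fun j => opU U (η (φ j))) Filter.atTop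
        (nhds (opU U ((2 : ℝ) • θ))) := by
      rw [hϑ]; exact ((opU U).continuous.tendsto _).comp hηlim
    have t1 := ((hξlim.sub_const ζ).norm).mul (hop.norm.const_add 1)
    have t2 := hnlim.const_mul (2 * ‖opU U ((2 : ℝ) • θ)‖ ^ 2 * ‖ζ‖)
    have t3 := ((hop.sub_const (opU U ((2 : ℝ) • θ))).norm).mul_const ‖ζ‖
    have t4 := hnlim.const_mul (‖opU U ((2 : ℝ) • θ)‖ * ‖ζ‖)
    have t := (t1.add (t2.add t3)).add t4
    simp only [sub_self, norm_zero, zero_mul, mul_zero, add_zero, mul_one_div] at t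
    refine t.congr fun j => ?_
    simp only [ε, mul_one_div]
  have hclose := fun j => norm_polygon_sub_normalGeod_le hskew (hn (φ j)) (hy0 (φ j)) ζ θ
    fun k hk s hs => norm_edge_sub_normalVel_le hskew (hn (φ j)) (heuler (φ j)) ζ θ hk hs
  refine ⟨ζ, θ, ?_, Prod.ext ?_ ?_⟩
  · refine (pow_le_pow_iff_left₀ (norm_nonneg _) hL0 two_ne_zero).mp ?_
    refine le_of_tendsto_of_tendsto' (hξlim.norm.pow 2) ?_ fun j => hξ (φ j)
    simpa using (hnlim.const_mul (C₂ ^ 2)).const_add (L ^ 2)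
  · rw [eq_comm, ← sub_eq_zero, ← norm_le_zero_iff]
    refine ge_of_tendsto' hεlim fun j => ?_
    rw [← hyN (φ j)]
    exact (hclose j).1
  · rw [eq_comm, ← sub_eq_zero, ← norm_le_zero_iff]
    have t1 : Filter.Tendsto (fun j => √((L ^ 2 + C₂ ^ 2 * (1 / n (φ j))) * (1 / n (φ j))))
        Filter.atTop (nhds 0) := by
      have := ((((hnlim.const_mul (C₂ ^ 2)).const_add (L ^ 2)).mul hnlim)).sqrt
      simpa using this
    have t2 : Filter.Tendsto (fun j => ‖pairingL U‖ * ((‖ζ‖ + ε j) * ε j +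
        (ε j + ‖ζ‖ * (1 / n (φ j))) * ‖ζ‖)) Filter.atTop (nhds 0) := by
      have := ((((hεlim.const_add ‖ζ‖).mul hεlim).add
        ((hεlim.add (hnlim.const_mul ‖ζ‖)).mul_const ‖ζ‖)).const_mul ‖pairingL U‖)
      simpa using this
    have t := t1.add t2
    rw [add_zero] at t
    refine ge_of_tendsto' t fun j => ?_
    refine (norm_sub_le_norm_sub_add_norm_sub _ (polyArea U (n (φ j)) (y (φ j))) _).trans
      (add_le_add ?_ ?_)
    · rw [norm_sub_rev]
      exact Real.le_sqrt_of_sq_le (hA (φ j))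
    · rw [mul_one_div]
      exact (hclose j).2

/-- The Carnot–Carathéodory distance is approximated by lengths of normal geodesics. -/
theorem exists_normalGeod_of_ccDist_lt (hlin : LinearIndependent ℝ U) (g : StepTwo q m) {L : ℝ}
    (hL : ccDist U 0 g < L) :
    ∃ (ζ : EuclideanSpace ℝ (Fin q)) (θ : EuclideanSpace ℝ (Fin m)),
      ‖ζ‖ ≤ L ∧ normalGeod U ζ θ 1 = g := by
  -- Reachability supplies a competitor: the infimum of an empty set would be the default value 0,
  -- and `exists_lt_of_csInf_lt` needs nonemptiness.
  obtain ⟨γ₀, u₀, H₀, h₀0, h₀1⟩ := reachable_eq_univ hskew hlin g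
  obtain ⟨_, ⟨γ, u, H, h0, h1, rfl⟩, hlt⟩ := exists_lt_of_csInf_lt
    (by exact ⟨_, γ₀, u₀, H₀, h₀0, h₀1, rfl⟩) hL
  rw [← h1]
  exact exists_normalGeod_of_isHorizontal hskew hlin H h0 hlt

omit hskew in
theorem horLength_nonneg (u : ℝ → EuclideanSpace ℝ (Fin q)) : 0 ≤ horLength u :=
  intervalIntegral.integral_nonneg zero_le_one fun _ _ => norm_nonneg _

omit hskew in
theorem ccDist_nonneg (g h : StepTwo q m) : 0 ≤ ccDist U g h := by
  refine Real.sInf_nonneg ?_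
  rintro _ ⟨γ, u, -, -, -, rfl⟩
  exact horLength_nonneg u

omit hskew in
theorem ccDist_le_horLength {γ : ℝ → StepTwo q m} {u : ℝ → EuclideanSpace ℝ (Fin q)}
    (h : IsHorizontal U γ u) : ccDist U (γ 0) (γ 1) ≤ horLength u := by
  refine csInf_le ⟨0, ?_⟩ ⟨γ, u, h, rfl, rfl, rfl⟩
  rintro _ ⟨γ, u, -, -, -, rfl⟩
  exact horLength_nonneg u

theorem ccDist_normalGeod_le (ζ : EuclideanSpace ℝ (Fin q)) (θ : EuclideanSpace ℝ (Fin m)) :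
    ccDist U 0 (normalGeod U ζ θ 1) ≤ ‖ζ‖ := by
  have h := ccDist_le_horLength (isHorizontal_normalGeod U ζ θ)
  rwa [horLength_normalVel hskew, show normalGeod U ζ θ 0 = 0 by simp [normalGeod]] at h

end MinimizingGeodesics

/-! ### The main theorem. -/

theorem theorem2p4 (q m : ℕ) (hq : 0 < q) (hm : 0 < m)
    (U : Fin m → Matrix (Fin q) (Fin q) ℝ)
    (hskew : ∀ j, (U j)ᵀ = -U j) (hlin : LinearIndependent ℝ U) :
    -- the explicit curve is a (real, non-trivial, good) normal geodesic
    (∀ (x₀ : EuclideanSpace ℝ (Fin q)) (θ₀ : EuclideanSpace ℝ (Fin m)), x₀ ≠ 0 → θ₀ ∈ goodSet U →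
      (∀ s : ℝ, toComplexVec (explicitPos U x₀ θ₀ s) = explicitPosC U x₀ θ₀ s) ∧
      (∀ s : ℝ, toComplexVec (explicitVel U x₀ θ₀ s) = explicitVelC U x₀ θ₀ s) ∧
      explicitVel U x₀ θ₀ 0 ≠ 0 ∧
      (∀ s ∈ Set.Icc (0 : ℝ) 1,
        explicitVel U x₀ θ₀ s = normalVel U (explicitVel U x₀ θ₀ 0) θ₀ s ∧
        explicitGeod U x₀ θ₀ s = normalGeod U (explicitVel U x₀ θ₀ 0) θ₀ s) ∧
      IsHorizontal U (explicitGeod U x₀ θ₀) (explicitVel U x₀ θ₀)) ∧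
    -- if `θ₀` is a critical point of `φ(g₀; ·)`, the explicit curve joins `o` to `g₀ = (x₀, t₀)`
    (∀ (x₀ : EuclideanSpace ℝ (Fin q)) (θ₀ : EuclideanSpace ℝ (Fin m)), x₀ ≠ 0 → θ₀ ∈ goodSet U →
      ∀ t₀ : EuclideanSpace ℝ (Fin m), IsCriticalPt U (x₀, t₀) θ₀ →
        explicitGeod U x₀ θ₀ 0 = 0 ∧
        explicitGeod U x₀ θ₀ 1 = (x₀, t₀) ∧
        ccDist U 0 (x₀, t₀) ^ 2 ≤ horLength (explicitVel U x₀ θ₀) ^ 2 ∧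
        horLength (explicitVel U x₀ θ₀) ^ 2 = normUdivSinU U θ₀ x₀ ^ 2 ∧
        normUdivSinU U θ₀ x₀ ^ 2 = refFun U (x₀, t₀) θ₀) ∧
    -- conversely, `θ₀` is a critical point of `φ((x₀, t(1)); ·)`
    (∀ (x₀ : EuclideanSpace ℝ (Fin q)) (θ₀ : EuclideanSpace ℝ (Fin m)), x₀ ≠ 0 → θ₀ ∈ goodSet U →
      IsCriticalPt U (x₀, (explicitGeod U x₀ θ₀ 1).2) θ₀) ∧
    -- and every non-trivial good normal geodesic is of this form
    (∀ (ζ₀ : EuclideanSpace ℝ (Fin q)) (θ₀ : EuclideanSpace ℝ (Fin m)), ζ₀ ≠ 0 → θ₀ ∈ goodSet U →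
      (normalGeod U ζ₀ θ₀ 1).1 ≠ 0 ∧
      IsCriticalPt U (normalGeod U ζ₀ θ₀ 1) θ₀ ∧
      ∀ s ∈ Set.Icc (0 : ℝ) 1,
        normalVel U ζ₀ θ₀ s = explicitVel U (normalGeod U ζ₀ θ₀ 1).1 θ₀ s ∧
        normalGeod U ζ₀ θ₀ s = explicitGeod U (normalGeod U ζ₀ θ₀ 1).1 θ₀ s) ∧
    -- off the endpoints of bad normal geodesics, `d²` is the infimum of the critical values
    (∀ g : StepTwo q m, g ∉ badEndpoints U →
      (∀ θ ∈ goodSet U, IsCriticalPt U g θ → refFun U g θ = normUdivSinU U θ g.1 ^ 2) ∧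
      IsGLB {r : ℝ | ∃ θ ∈ goodSet U, IsCriticalPt U g θ ∧ r = refFun U g θ}
        (ccDist U 0 g ^ 2)) := by
  have hvel : ∀ x₀ θ₀, explicitVel U x₀ θ₀ = normalVel U (explicitVel U x₀ θ₀ 0) θ₀ :=
    fun x₀ θ₀ => funext (explicitVel_eq_normalVel hskew x₀ θ₀)
  have hgeod : ∀ x₀, ∀ θ₀ ∈ goodSet U,
      explicitGeod U x₀ θ₀ = normalGeod U (explicitVel U x₀ θ₀ 0) θ₀ :=
    fun x₀ θ₀ hθ => funext (explicitGeod_eq_normalGeod hskew hθ x₀)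
  have hback : ∀ (ζ₀ : EuclideanSpace ℝ (Fin q)), ∀ θ₀ ∈ goodSet U,
      explicitVel U (normalGeod U ζ₀ θ₀ 1).1 θ₀ 0 = ζ₀ :=
    fun ζ₀ θ₀ hθ => explicitVel_posMap hskew hθ ζ₀
  have hcrit : ∀ (ζ₀ : EuclideanSpace ℝ (Fin q)), ∀ θ₀ ∈ goodSet U,
      IsCriticalPt U (normalGeod U ζ₀ θ₀ 1) θ₀ := fun ζ₀ θ₀ hθ =>
    (isCriticalPt_iff hskew hθ (normalGeod U ζ₀ θ₀ 1).1 (normalGeod U ζ₀ θ₀ 1).2).mpr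
      (by rw [hback ζ₀ θ₀ hθ])
  refine ⟨fun x₀ θ₀ hx hθ => ⟨toComplexVec_explicitPos hskew x₀ θ₀,
      toComplexVec_explicitVel hskew x₀ θ₀, fun h0 => hx ?_,
      fun s _ => ⟨explicitVel_eq_normalVel hskew x₀ θ₀ s,
        explicitGeod_eq_normalGeod hskew hθ x₀ s⟩, ?_⟩,
    fun x₀ θ₀ _ hθ t₀ hc => ?_, fun x₀ θ₀ _ hθ => ?_,
    fun ζ₀ θ₀ hζ hθ => ⟨fun h0 => hζ ?_, hcrit ζ₀ θ₀ hθ, fun s _ => ?_⟩,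
    fun g hg => ⟨fun θ hθ hc => ?_, ?_, fun r hr => ?_⟩⟩
  · rw [← posMap_explicitVel hskew hθ x₀, h0, map_zero]
  · rw [hgeod x₀ θ₀ hθ]
    nth_rewrite 2 [hvel]
    exact isHorizontal_normalGeod U _ θ₀
  · have h1 := (isCriticalPt_iff hskew hθ x₀ t₀).mp hc
    have hlen : horLength (explicitVel U x₀ θ₀) = ‖explicitVel U x₀ θ₀ 0‖ := by
      rw [hvel, horLength_normalVel hskew, normalVel_zero]
    refine ⟨by rw [hgeod x₀ θ₀ hθ]; simp [normalGeod], by rw [hgeod x₀ θ₀ hθ, h1], ?_, ?_, ?_⟩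
    · rw [hlen, ← h1]
      exact pow_le_pow_left₀ (ccDist_nonneg _ _) (ccDist_normalGeod_le hskew _ _) 2
    · rw [hlen, normUdivSinU_eq hskew]
    · rw [refFun_of_isCriticalPt hskew hθ _ hc, normUdivSinU_eq hskew]
  · rw [isCriticalPt_iff hskew hθ, hgeod x₀ θ₀ hθ]
    exact Prod.ext (posMap_explicitVel hskew hθ x₀) rfl
  · have := explicitVel_posMap hskew hθ 0
    rw [map_zero, ← h0, hback ζ₀ θ₀ hθ] at this
    exact this.trans h0
  · rw [hgeod _ θ₀ hθ, explicitVel_eq_normalVel hskew, hback ζ₀ θ₀ hθ]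
    exact ⟨rfl, rfl⟩
  · rw [refFun_of_isCriticalPt hskew hθ g hc, normUdivSinU_eq hskew]
  · rintro _ ⟨θ, hθ, hc, rfl⟩
    have h1 := (isCriticalPt_iff hskew hθ g.1 g.2).mp hc
    rw [refFun_of_isCriticalPt hskew hθ g hc]
    refine pow_le_pow_left₀ (ccDist_nonneg _ _) ?_ 2
    have := ccDist_normalGeod_le hskew (explicitVel U g.1 θ 0) θ
    rwa [h1] at this
  -- Normal geodesics are found only for bounds `L` above the distance; letting `L` decrease to it
  -- gives the claim without a minimizer.
  · have hle : ∀ L, ccDist U 0 g < L → r ≤ L ^ 2 := fun L hL => by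
      obtain ⟨ζ, θ, hζ, rfl⟩ := exists_normalGeod_of_ccDist_lt hskew hlin g hL
      have hθ : θ ∈ goodSet U := by
        by_contra hθ
        exact hg ⟨ζ, θ, hθ, rfl⟩
      refine (hr ⟨θ, hθ, hcrit ζ θ hθ, rfl⟩).trans ?_
      rw [refFun_of_isCriticalPt hskew hθ _ (hcrit ζ θ hθ), hback ζ θ hθ]
      exact pow_le_pow_left₀ (norm_nonneg _) hζ 2
    refine ge_of_tendsto (x := nhdsWithin (ccDist U 0 g) (Set.Ioi (ccDist U 0 g)))
      (((continuous_pow 2).tendsto _).mono_left nhdsWithin_le_nhds) ?_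
    exact eventually_nhdsWithin_of_forall hle
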